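/- For a real polynomial $f$ in one variable and an angle $\theta$, the closed polynomial half plane $H_{f,\theta}$ is $$\{(x,y)\in\mathbb R^2 : f(\cos\theta\, x+\sin\theta\, y)-(-\sin\theta\, x+\cos\theta\, y)\ge 0\},$$ the closed region below the graph of $f$, rotated by $\theta$; its boundary is the rotated graph of $f$. A region of type I is a simply connected set that is the intersection of finitely many closed polynomial half planes; its sides lie on the graphs of the polynomials of these half planes. A shortest-length curve in a set $Y\subseteq\mathbb R^2$ is a piecewise $C^2$ curve $\gamma:[a,b]\to Y$ (with $a\le b$) whose length is least among all piecewise $C^2$ curves in $Y$ from $\gamma(a)$ to $\gamma(b)$. **Corollary 3.8.** Let $X$ be the intersection of finitely many closed polynomial half planes. Then $X$ is a union $T_1\cup\dots\cup T_m$ of finitely many regions of type I. Moreover, let $X=T_1\cup\dots\cup T_m$ be any such representation, where $T_j=\bigcap_l H_{f_{j,l},\theta_{j,l}}$ is a region of type I for each $j$, and let $\gamma:[a,b]\to X$ be a shortest-length curve in $X$. Then for each $j$ the set $\{t\in[a,b]:\gamma(t)\in T_j\}$ is a union of finitely many closed intervals $[c_i,d_i]$ (possibly single points) such that the sets $\gamma([c_i,d_i])$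 are pairwise disjoint and each restriction $\gamma|_{[c_i,d_i]}$ is a shortest-length curve in $T_j$. Each of these restrictions is either constant (a point) or an alternating sequence of line segments and boundary arcs in the following sense: there are $N\ge1$ and $c_i=t_0<t_1<\dots<t_N=d_i$ such that each piece $\gamma([t_{p},t_{p+1}])$ either * is a nondegenerate line segment with endpoints $\gamma(t_p)$ and $\gamma(t_{p+1})$, or * is contained in the boundary of $T_j$ and, for some $l$, is the part of the rotated graph of $f_{j,l}$ over a nondegenerate interval $[s,u]$ of the first coordinate in the rotated frame, on which $f_{j,l}$ is strictly convex (the side is convex upward in its own coordinate frame); and one can choose the pieces such that no two consecutive pieces are both line segments, and two consecutive boundary arcs have different indices $l$. -/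

import Mathlib

open Set Polynomial

noncomputable section

/-- The Euclidean plane. -/
abbrev Plane : Type := EuclideanSpace ℝ (Fin 2)

/-- The data of a closed polynomial half plane: a real polynomial `f` in one variable and the
angle `θ` of its coordinate frame. (Translating the region below a graph yields the region below
the graph of another polynomial, so translations need no separate datum.) -/
structure PolyHalfPlane where
  poly : ℝ[X]
  angle : ℝ

namespace PolyHalfPlane

/-- The set of all `(x, y)` with `f(cos θ x + sin θ y) - (-sin θ x + cos θ y) ≥ 0`: the region
on or below the graph of `f`, rotated by the angle `θ`. -/
def carrier (H : PolyHalfPlane) : Set Plane :=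
  {p | 0 ≤ H.poly.eval (Real.cos H.angle * p 0 + Real.sin H.angle * p 1)
        - (-Real.sin H.angle * p 0 + Real.cos H.angle * p 1)}

/-- The point of the plane which in the coordinate frame of `H` has the coordinates
`(x, f(x))`. -/
def graphPoint (H : PolyHalfPlane) (x : ℝ) : Plane :=
  !₂[Real.cos H.angle * x - Real.sin H.angle * H.poly.eval x,
     Real.sin H.angle * x + Real.cos H.angle * H.poly.eval x]

end PolyHalfPlane

/-- The intersection of finitely many closed polynomial half planes. -/
def interHalfPlanes {n : ℕ} (G : Fin n → PolyHalfPlane) : Set Plane :=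
  ⋂ l, (G l).carrier

/-- The half planes `G` describe a region of type I: their intersection is simply connected
(in particular nonempty). -/
def IsTypeI {n : ℕ} (G : Fin n → PolyHalfPlane) : Prop :=
  IsSimplyConnected (interHalfPlanes G)

/-- `X` is the union of the `m` regions `T j = interHalfPlanes (G j)`, each of type I. -/
def IsTypeIDecomposition (X : Set Plane) {m : ℕ} {n : Fin m → ℕ}
    (G : ∀ j, Fin (n j) → PolyHalfPlane) : Prop :=
  (∀ j, IsTypeI (G j)) ∧ X = ⋃ j, interHalfPlanes (G j)

/-- `γ` restricted to `[a, b]` is a piecewise `C²` curve. -/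
def IsPiecewiseC2 (γ : ℝ → Plane) (a b : ℝ) : Prop :=
  a ≤ b ∧ ContinuousOn γ (Icc a b) ∧
    ∃ (N : ℕ) (t : ℕ → ℝ), t 0 = a ∧ t N = b ∧
      ∀ i < N, t i ≤ t (i + 1) ∧ ContDiffOn ℝ 2 γ (Icc (t i) (t (i + 1)))

/-- `γ` restricted to `[a, b]` is a piecewise `C²` curve contained in `X`. -/
def IsCurveIn (X : Set Plane) (γ : ℝ → Plane) (a b : ℝ) : Prop :=
  IsPiecewiseC2 γ a b ∧ MapsTo γ (Icc a b) X

/-- `γ` restricted to `[a, b]` is a shortest-length curve in `X`: among all piecewise `C²` curves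
in `X` from `γ a` to `γ b` it has the least length. The length of a curve is the supremum of the
lengths of the inscribed polygonal lines. -/
def IsShortestCurve (X : Set Plane) (γ : ℝ → Plane) (a b : ℝ) : Prop :=
  IsCurveIn X γ a b ∧
    ∀ (δ : ℝ → Plane) (a' b' : ℝ), IsCurveIn X δ a' b' → δ a' = γ a → δ b' = γ b →
      eVariationOn γ (Icc a b) ≤ eVariationOn δ (Icc a' b')

/-- `γ` restricted to `[a, b]` runs through a nondegenerate straight line segment. -/
def IsSegmentPiece (γ : ℝ → Plane) (a b : ℝ) : Prop :=
  γ a ≠ γ b ∧ γ '' Icc a b = segment ℝ (γ a) (γ b)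

/-- `γ` restricted to `[a, b]` runs through a nondegenerate arc which lies on the boundary of `T`
and on the graph of the polynomial of `H`, in a part where this graph is convex upward in the
coordinate frame of `H`. -/
def IsConvexArcPiece (T : Set Plane) (H : PolyHalfPlane) (γ : ℝ → Plane) (a b : ℝ) : Prop :=
  γ '' Icc a b ⊆ frontier T ∧
    ∃ s u : ℝ, s < u ∧ StrictConvexOn ℝ (Icc s u) (fun x => H.poly.eval x) ∧
      γ '' Icc a b = H.graphPoint '' Icc s u

/-- The piece of `γ` over `[a, b]` is a line segment (kind `none`), or a boundary arc of the
region described by `G` that lies in a convex upward part of the side on the graph of `G l`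
(kind `some l`). -/
def IsPieceOfKind {n : ℕ} (G : Fin n → PolyHalfPlane) (κ : Option (Fin n))
    (γ : ℝ → Plane) (a b : ℝ) : Prop :=
  match κ with
  | none => IsSegmentPiece γ a b
  | some l => IsConvexArcPiece (interHalfPlanes G) (G l) γ a b

/-- `γ` restricted to `[a, b]` is an alternating sequence of line segments and boundary arcs of
the region described by `G`: it is cut into finitely many pieces, consecutive pieces being of
different kinds. So no two consecutive pieces are segments, and two consecutive arcs lie on
different sides. -/
def IsAlternating {n : ℕ} (G : Fin n → PolyHalfPlane) (γ : ℝ → Plane) (a b : ℝ) : Prop :=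
  ∃ (N : ℕ) (t : ℕ → ℝ) (κ : ℕ → Option (Fin n)),
    0 < N ∧ t 0 = a ∧ t N = b ∧
    (∀ i < N, t i < t (i + 1) ∧ IsPieceOfKind G (κ i) γ (t i) (t (i + 1))) ∧
    ∀ i, i + 1 < N → κ i ≠ κ (i + 1)

/-- `γ` restricted to `[a, b]` stays at one point. -/
def IsPointCurve (γ : ℝ → Plane) (a b : ℝ) : Prop :=
  ∀ t ∈ Icc a b, γ t = γ a

end

/-! Two facts carry everything. A real polynomial has an eventually constant sign along any
one-sided germ (`PolyGerm`), so polynomial boundaries cannot oscillate. And all questions can be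
asked germwise: at a point, along a direction, or at infinity along a direction. Compactness then
turns germs into finite statements.

Decomposition. Fix `p` in the set and a unit vector `u`, and look at thin cones around `u` (`horn`).
A half plane either contains such a cone, misses it, or has its boundary through `p` and tangent to
`u`. Tangent sides lying on the same side of the tangent are totally ordered by inclusion of germs
(`Side.Dom.total`), so one of them dominates the others. Unless the set is empty near `u`, the
boundary arc of this side stays in the set, and a small triangle cut out of the set contracts onto
the arc along parallel segments (`coverable_of_arc`). The circle of directions being compact, every
point has a neighbourhood covered by finitely many regions of type I, and so has every ball. In a
cone around `u` at infinity each half plane becomes an inequality `a * x ≤ P y` in the frame of `u`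
(`PolyHalfPlane.eventually_frame`), possibly a trivially true or false one. Systems of such
inequalities split into finitely many slabs with interval fibers and polynomial sections
(`coverable_same_frame`).

Shortest curves. Parametrized by arc length a shortest curve is `Taut`: it is 1-Lipschitz, and
straight between points that see each other. Suppose that no later point is visible from its start.
Then it leaves in a definite direction `u` (`Taut.exists_tendsto_horn`), and the view is blocked by
sides that are strictly convex upward. Among these one side dominates. Strictly inside its region
only concave sides remain active; they bound convex regions, so the curve is locally straight there.
A straight stretch cannot leave and rejoin a strictly convex graph from below, hence the curve
initially runs along the graph or is straight (`Taut.exists_piece_right`). A supremum argument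
(`exists_chain`) yields finitely many pieces, and successive straight pieces merge because a corner
between them could be cut off (`Taut.straight_merge`).

Intersection with a region. Along a straight piece or an arc, the level of any half plane is a
polynomial in a monotone parameter. So the times spent in a region form a compact set that does not
oscillate, that is, a finite union of intervals (`exists_intervals`). Injectivity of the taut curve
makes their images disjoint, and cutting and splicing shows that the restrictions are shortest
again. -/

open Filter Topology

noncomputable section

/-! ### Orthonormal coordinates -/

/-- The coordinate of a point in the direction `u`. -/
def cx (u : Plane) : Plane →L[ℝ] ℝ :=
  u 0 • (EuclideanSpace.proj 0 : Plane →L[ℝ] ℝ)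
    + u 1 • (EuclideanSpace.proj 1 : Plane →L[ℝ] ℝ)

/-- The coordinate of a point in the direction orthogonal to `u`. -/
def cy (u : Plane) : Plane →L[ℝ] ℝ :=
  (-u 1) • (EuclideanSpace.proj 0 : Plane →L[ℝ] ℝ)
    + u 0 • (EuclideanSpace.proj 1 : Plane →L[ℝ] ℝ)

/-- The vector `u` turned by a right angle. -/
def rotJ (u : Plane) : Plane := !₂[-u 1, u 0]

lemma cx_apply (u w : Plane) : cx u w = u 0 * w 0 + u 1 * w 1 := by
  simp [cx]

lemma cy_apply (u w : Plane) : cy u w = -u 1 * w 0 + u 0 * w 1 := by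
  simp [cy]

lemma norm_sq_plane (u : Plane) : ‖u‖ ^ 2 = u 0 ^ 2 + u 1 ^ 2 := by
  simp [EuclideanSpace.norm_sq_eq, Fin.sum_univ_two]

lemma unit_sq {u : Plane} (hu : ‖u‖ = 1) : u 0 ^ 2 + u 1 ^ 2 = 1 := by
  rw [← norm_sq_plane, hu]; norm_num

lemma cx_self {u : Plane} (hu : ‖u‖ = 1) : cx u u = 1 := by
  rw [cx_apply]; nlinarith [unit_sq hu]

lemma cy_self (u : Plane) : cy u u = 0 := by
  rw [cy_apply]; ring

lemma cx_rotJ (u : Plane) : cx u (rotJ u) = 0 := by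
  rw [cx_apply]; simp [rotJ]; ring

lemma cy_rotJ {u : Plane} (hu : ‖u‖ = 1) : cy u (rotJ u) = 1 := by
  rw [cy_apply]; simp [rotJ]; nlinarith [unit_sq hu]

lemma plane_ext {w w' : Plane} (h0 : w 0 = w' 0) (h1 : w 1 = w' 1) : w = w' := by
  ext i; fin_cases i <;> assumption

lemma frame_decomp {u : Plane} (hu : ‖u‖ = 1) (w : Plane) :
    w = cx u w • u + cy u w • rotJ u := by
  have h := unit_sq hu
  apply plane_ext
  · simp [cx_apply, cy_apply, rotJ]; linear_combination (-w 0) * h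
  · simp [cx_apply, cy_apply, rotJ]; linear_combination (-w 1) * h

lemma frame_ext {u : Plane} (hu : ‖u‖ = 1) {w w' : Plane} (h0 : cx u w = cx u w')
    (h1 : cy u w = cy u w') : w = w' := by
  rw [frame_decomp hu w, frame_decomp hu w', h0, h1]

lemma frame_norm_sq {u : Plane} (hu : ‖u‖ = 1) (w : Plane) :
    ‖w‖ ^ 2 = cx u w ^ 2 + cy u w ^ 2 := by
  have h := unit_sq hu
  rw [norm_sq_plane, cx_apply, cy_apply]
  linear_combination (-(w 0 ^ 2 + w 1 ^ 2)) * h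

lemma abs_cx_le {u : Plane} (hu : ‖u‖ = 1) (w : Plane) : |cx u w| ≤ ‖w‖ := by
  apply abs_le_of_sq_le_sq _ (norm_nonneg _) |>.trans' (le_of_eq rfl)
  rw [frame_norm_sq hu w]; nlinarith [sq_nonneg (cy u w)]

/-! ### Coordinates and level functions of polynomial half planes -/

namespace PolyHalfPlane

/-- The unit vector of the first axis of the frame. -/
def axis (H : PolyHalfPlane) : Plane := !₂[Real.cos H.angle, Real.sin H.angle]

/-- First coordinate in the frame of `H`. -/
abbrev fx (H : PolyHalfPlane) : Plane →L[ℝ] ℝ := cx H.axis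

/-- Second coordinate in the frame of `H`. -/
abbrev fy (H : PolyHalfPlane) : Plane →L[ℝ] ℝ := cy H.axis

lemma norm_axis (H : PolyHalfPlane) : ‖H.axis‖ = 1 := by
  have : ‖H.axis‖ ^ 2 = 1 := by
    rw [norm_sq_plane]; simp [axis]
  nlinarith [norm_nonneg H.axis]

/-- The function whose nonnegativity defines the half plane. -/
def lev (H : PolyHalfPlane) (p : Plane) : ℝ := H.poly.eval (H.fx p) - H.fy p

lemma mem_carrier (H : PolyHalfPlane) (p : Plane) : p ∈ H.carrier ↔ 0 ≤ H.lev p := by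
  simp [carrier, lev, cx_apply, cy_apply, axis]

lemma continuous_lev (H : PolyHalfPlane) : Continuous H.lev := by
  unfold lev; fun_prop

lemma isClosed_carrier (H : PolyHalfPlane) : IsClosed H.carrier := by
  have : H.carrier = {p | 0 ≤ H.lev p} := by ext p; exact H.mem_carrier p
  rw [this]; exact isClosed_le continuous_const H.continuous_lev

lemma fx_graphPoint (H : PolyHalfPlane) (x : ℝ) : H.fx (H.graphPoint x) = x := by
  simp [cx_apply, axis, graphPoint]
  linear_combination x * Real.cos_sq_add_sin_sq H.angle

lemma fy_graphPoint (H : PolyHalfPlane) (x : ℝ) : H.fy (H.graphPoint x) = H.poly.eval x := by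
  simp [cy_apply, axis, graphPoint]
  linear_combination (H.poly.eval x) * Real.cos_sq_add_sin_sq H.angle

lemma lev_graphPoint (H : PolyHalfPlane) (x : ℝ) : H.lev (H.graphPoint x) = 0 := by
  rw [lev, fx_graphPoint, fy_graphPoint, sub_self]

lemma ext_frame (H : PolyHalfPlane) {w w' : Plane} (h0 : H.fx w = H.fx w')
    (h1 : H.fy w = H.fy w') : w = w' := frame_ext H.norm_axis h0 h1

lemma eq_graphPoint (H : PolyHalfPlane) {p : Plane} (h : H.lev p = 0) :
    p = H.graphPoint (H.fx p) := by
  apply H.ext_frame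
  · rw [fx_graphPoint]
  · rw [fy_graphPoint]; unfold lev at h; linarith

lemma continuous_graphPoint (H : PolyHalfPlane) : Continuous H.graphPoint := by
  unfold graphPoint
  apply (PiLp.continuous_toLp 2 _).comp
  apply continuous_pi
  intro i; fin_cases i <;> simp <;> fun_prop

end PolyHalfPlane

lemma mem_interHalfPlanes {n : ℕ} {G : Fin n → PolyHalfPlane} {p : Plane} :
    p ∈ interHalfPlanes G ↔ ∀ l, 0 ≤ (G l).lev p := by
  simp [interHalfPlanes, PolyHalfPlane.mem_carrier]

lemma isClosed_inter {n : ℕ} (G : Fin n → PolyHalfPlane) : IsClosed (interHalfPlanes G) :=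
  isClosed_iInter fun l => (G l).isClosed_carrier

/-! ### Signs of polynomials along one-sided filters -/

/-- Along the filter every real polynomial has eventually a constant sign. -/
def PolyGerm (𝓕 : Filter ℝ) : Prop :=
  ∀ q : ℝ[X], (∀ᶠ x in 𝓕, 0 ≤ q.eval x) ∨ (∀ᶠ x in 𝓕, q.eval x < 0)

lemma poly_sign_of_no_root {q : ℝ[X]} {s : Set ℝ} (hs : IsPreconnected s)
    (h : ∀ x ∈ s, q.eval x ≠ 0) : (∀ x ∈ s, 0 ≤ q.eval x) ∨ (∀ x ∈ s, q.eval x < 0) := by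
  by_contra! hcon
  obtain ⟨⟨x, hx, hx'⟩, y, hy, hy'⟩ := hcon
  obtain ⟨z, hz, hz'⟩ := hs.intermediate_value hx hy (f := fun x => q.eval x)
    q.continuous.continuousOn ⟨hx'.le, hy'⟩
  exact h z hz hz'

/-- A nonzero polynomial has finitely many roots, and on a connected set free of roots the
intermediate value theorem fixes its sign. -/
lemma polyGerm_of {𝓕 : Filter ℝ}
    (h : ∀ Z : Set ℝ, Z.Finite → ∃ s ∈ 𝓕, IsPreconnected s ∧ Disjoint s Z) : PolyGerm 𝓕 := by
  intro q
  by_cases hq : q = 0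
  · left; simp [hq]
  obtain ⟨s, hs, hc, hd⟩ := h {x | q.IsRoot x} (Polynomial.finite_setOfPred_isRoot hq)
  have : ∀ x ∈ s, q.eval x ≠ 0 := fun x hx h0 => hd.le_bot ⟨hx, h0⟩
  rcases poly_sign_of_no_root hc this with h1 | h1
  · left; exact mem_of_superset hs h1
  · right; exact mem_of_superset hs h1

lemma polyGerm_right (x₀ : ℝ) : PolyGerm (𝓝[>] x₀) := by
  refine polyGerm_of fun Z hZ => ?_
  have : (Z \ {x₀})ᶜ ∈ 𝓝 x₀ := (hZ.subset sdiff_subset).isClosed.isOpen_compl.mem_nhds (by simp)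
  obtain ⟨l, u, hlu, hsub⟩ := mem_nhds_iff_exists_Ioo_subset.1 this
  refine ⟨Ioo x₀ u, Ioo_mem_nhdsGT hlu.2, isPreconnected_Ioo, ?_⟩
  rw [Set.disjoint_left]
  intro y hy hyZ
  exact hsub ⟨hlu.1.trans hy.1, hy.2⟩ ⟨hyZ, by simpa using hy.1.ne'⟩

lemma polyGerm_left (x₀ : ℝ) : PolyGerm (𝓝[<] x₀) := by
  refine polyGerm_of fun Z hZ => ?_
  have : (Z \ {x₀})ᶜ ∈ 𝓝 x₀ := (hZ.subset sdiff_subset).isClosed.isOpen_compl.mem_nhds (by simp)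
  obtain ⟨l, u, hlu, hsub⟩ := mem_nhds_iff_exists_Ioo_subset.1 this
  refine ⟨Ioo l x₀, Ioo_mem_nhdsLT hlu.1, isPreconnected_Ioo, ?_⟩
  rw [Set.disjoint_left]
  intro y hy hyZ
  exact hsub ⟨hy.1, hy.2.trans hlu.2⟩ ⟨hyZ, by simpa using hy.2.ne⟩

lemma polyGerm_atTop : PolyGerm atTop := by
  refine polyGerm_of fun Z hZ => ?_
  obtain ⟨M, hM⟩ := hZ.bddAbove
  exact ⟨Ioi M, Ioi_mem_atTop M, isPreconnected_Ioi,
    Set.disjoint_left.2 fun y hy hyZ => not_le.2 hy (hM hyZ)⟩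

lemma polyGerm_atBot : PolyGerm atBot := by
  refine polyGerm_of fun Z hZ => ?_
  obtain ⟨M, hM⟩ := hZ.bddBelow
  exact ⟨Iio M, Iio_mem_atBot M, isPreconnected_Iio,
    Set.disjoint_left.2 fun y hy hyZ => not_le.2 hy (hM hyZ)⟩

/-- A total transitive relation has a least element on every nonempty finite set. -/
lemma exists_least {ι : Type*} (R : ι → ι → Prop) (s : Finset ι) (hs : s.Nonempty)
    (tot : ∀ i ∈ s, ∀ j ∈ s, R i j ∨ R j i)
    (tr : ∀ i ∈ s, ∀ j ∈ s, ∀ k ∈ s, R i j → R j k → R i k) :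
    ∃ i ∈ s, ∀ j ∈ s, R i j := by
  classical
  induction hs using Finset.Nonempty.cons_induction with
  | singleton a => exact ⟨a, by simp, by simpa using tot a (by simp) a (by simp)⟩
  | cons a s ha hs ih =>
    obtain ⟨i, hi, him⟩ := ih (fun i hi j hj => tot i (by simp [hi]) j (by simp [hj]))
      (fun i hi j hj k hk => tr i (by simp [hi]) j (by simp [hj]) k (by simp [hk]))
    have haa : R a a := by simpa using tot a (by simp) a (by simp)
    rcases tot i (by simp [hi]) a (by simp) with h | h
    · refine ⟨i, by simp [hi], fun j hj => ?_⟩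
      rcases Finset.mem_cons.1 hj with rfl | hj
      · exact h
      · exact him j hj
    · refine ⟨a, by simp, fun j hj => ?_⟩
      rcases Finset.mem_cons.1 hj with rfl | hj
      · exact haa
      · exact tr a (by simp) i (by simp [hi]) j (by simp [hj]) h (him j hj)

/-! ### Germs of cones around a direction -/

/-- The filter of germs at the origin of cones around the direction `u`: along it the coordinate
in the direction `u` tends to `0` from above and the slope tends to `0`. -/
def horn (u : Plane) : Filter Plane :=
  comap (fun w => (cx u w, cy u w / cx u w)) (𝓝[>] (0 : ℝ) ×ˢ 𝓝 (0 : ℝ))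

lemma tendsto_cx_horn (u : Plane) : Tendsto (cx u) (horn u) (𝓝[>] 0) :=
  tendsto_fst.comp tendsto_comap

lemma tendsto_slope_horn (u : Plane) : Tendsto (fun w => cy u w / cx u w) (horn u) (𝓝 0) :=
  tendsto_snd.comp tendsto_comap

lemma tendsto_horn_iff {u : Plane} {α : Type*} {𝓕 : Filter α} {f : α → Plane} :
    Tendsto f 𝓕 (horn u) ↔ Tendsto (fun a => cx u (f a)) 𝓕 (𝓝[>] 0) ∧
      Tendsto (fun a => cy u (f a) / cx u (f a)) 𝓕 (𝓝 0) := by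
  rw [horn, tendsto_comap_iff, tendsto_prod_iff']; rfl

lemma cx_pos_horn (u : Plane) : ∀ᶠ w in horn u, 0 < cx u w :=
  (tendsto_cx_horn u).eventually self_mem_nhdsWithin

/-- Since the slope tends to `0`, the rescaled vector `w / cx u w` tends to `u`; first-order
behavior along the horn is therefore read off at `u`. -/
lemma tendsto_div_horn {u : Plane} (hu : ‖u‖ = 1) (φ : Plane →L[ℝ] ℝ) :
    Tendsto (fun w => φ w / cx u w) (horn u) (𝓝 (φ u)) := by
  have h : Tendsto (fun w => φ u + cy u w / cx u w * φ (rotJ u)) (horn u)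
      (𝓝 (φ u + 0 * φ (rotJ u))) :=
    tendsto_const_nhds.add ((tendsto_slope_horn u).mul tendsto_const_nhds)
  rw [zero_mul, add_zero] at h
  refine h.congr' ?_
  filter_upwards [cx_pos_horn u] with w hw
  have e : φ w = cx u w * φ u + cy u w * φ (rotJ u) := by
    conv_lhs => rw [frame_decomp hu w]
    simp only [map_add, map_smul, smul_eq_mul]
  rw [e]
  field_simp

lemma tendsto_clm_horn {u : Plane} (hu : ‖u‖ = 1) (φ : Plane →L[ℝ] ℝ) :
    Tendsto φ (horn u) (𝓝 0) := by
  have h := (tendsto_div_horn hu φ).mul ((tendsto_cx_horn u).mono_right nhdsWithin_le_nhds)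
  rw [mul_zero] at h
  refine h.congr' ?_
  filter_upwards [cx_pos_horn u] with w hw
  field_simp

lemma tendsto_clm_horn_pos {u : Plane} (hu : ‖u‖ = 1) {φ : Plane →L[ℝ] ℝ} (hφ : 0 < φ u) :
    Tendsto φ (horn u) (𝓝[>] 0) := by
  refine tendsto_nhdsWithin_iff.2 ⟨tendsto_clm_horn hu φ, ?_⟩
  filter_upwards [cx_pos_horn u, (tendsto_div_horn hu φ).eventually (lt_mem_nhds hφ)] with w h h'
  exact (div_pos_iff_of_pos_right h).1 h'

lemma horn_le_nhds {u : Plane} (hu : ‖u‖ = 1) : horn u ≤ 𝓝 0 := by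
  have h : Tendsto (fun w => cx u w • u + cy u w • rotJ u) (horn u)
      (𝓝 ((0 : ℝ) • u + (0 : ℝ) • rotJ u)) :=
    ((tendsto_clm_horn hu _).smul_const _).add ((tendsto_clm_horn hu _).smul_const _)
  rw [zero_smul, zero_smul, add_zero] at h
  exact h.congr fun w => (frame_decomp hu w).symm

lemma mem_horn_iff {u : Plane} {s : Set Plane} :
    s ∈ horn u ↔ ∃ δ > 0, ∀ w, 0 < cx u w → cx u w < δ → |cy u w| < δ * cx u w → w ∈ s := by
  constructor
  · intro h
    obtain ⟨t, ht, hts⟩ := h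
    obtain ⟨A, hA, B, hB, hAB⟩ := mem_prod_iff.1 ht
    obtain ⟨a, ha, hA⟩ := mem_nhdsGT_iff_exists_Ioo_subset.1 hA
    obtain ⟨b, hb, hB⟩ := Metric.mem_nhds_iff.1 hB
    refine ⟨min a b, lt_min ha hb, fun w h1 h2 h3 => hts (hAB ⟨hA ⟨h1, h2.trans_le (min_le_left _ _)⟩,
      hB ?_⟩)⟩
    rw [mem_ball_zero_iff, Real.norm_eq_abs, abs_div, abs_of_pos h1, div_lt_iff₀ h1]
    exact h3.trans_le (mul_le_mul_of_nonneg_right (min_le_right _ _) h1.le)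
  · rintro ⟨δ, hδ, h⟩
    have h1 := (tendsto_cx_horn u).eventually (Ioo_mem_nhdsGT hδ)
    have h2 := (tendsto_slope_horn u).eventually (Metric.ball_mem_nhds 0 hδ)
    filter_upwards [h1, h2] with w hw hw'
    refine h w hw.1 hw.2 ?_
    rwa [dist_zero_right, Real.norm_eq_abs, abs_div, abs_of_pos hw.1, div_lt_iff₀ hw.1] at hw'

/-! ### Germs of half planes at a boundary point -/

/-- The germ at the origin of a region `{w | y w ≤ ψ (ξ w)}`, where the graph of `ψ` touches the
first axis of the linear coordinates `(ξ, y)`. -/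
structure Side where
  ψ : ℝ[X]
  ξ : Plane →L[ℝ] ℝ
  y : Plane →L[ℝ] ℝ
  ψ_zero : ψ.eval 0 = 0
  ψ_deriv : ψ.derivative.eval 0 = 0
  inj : ∀ w, ξ w = 0 → y w = 0 → w = 0

namespace Side

/-- The function whose nonnegativity defines the region. -/
def lev (S : Side) (w : Plane) : ℝ := S.ψ.eval (S.ξ w) - S.y w

/-- The side touches the direction `u`. -/
def Tang (S : Side) (u : Plane) : Prop := S.y u = 0 ∧ 0 < S.ξ u

lemma exists_sq_mul (S : Side) : ∃ q : ℝ[X], ∀ h, S.ψ.eval h = h ^ 2 * q.eval h := by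
  have : X ^ 2 ∣ S.ψ := by
    rw [X_pow_dvd_iff]
    intro d hd
    interval_cases d
    · rw [coeff_zero_eq_eval_zero, S.ψ_zero]
    · have := S.ψ_deriv
      rw [← coeff_zero_eq_eval_zero, coeff_derivative] at this
      simpa using this
  obtain ⟨q, hq⟩ := this
  exact ⟨q, fun h => by rw [hq]; simp⟩

lemma quad_bound (S : Side) : ∃ K > 0, ∀ h, |h| ≤ 1 → |S.ψ.eval h| ≤ K * h ^ 2 := by
  obtain ⟨q, hq⟩ := S.exists_sq_mul
  obtain ⟨K, hK⟩ := (isCompact_Icc (a := (-1 : ℝ)) (b := 1)).exists_bound_of_continuousOn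
    (f := fun h => q.eval h) q.continuous.continuousOn
  refine ⟨|K| + 1, by positivity, fun h hh => ?_⟩
  rw [hq, abs_mul, abs_of_nonneg (sq_nonneg h), mul_comm]
  have := hK h (abs_le.1 hh)
  rw [Real.norm_eq_abs] at this
  exact mul_le_mul_of_nonneg_right (by linarith [le_abs_self K]) (sq_nonneg h)

/-- The derivative of `ψ` vanishes at `0`, so strict differentiability gives arbitrarily small
Lipschitz constants near `0`. -/
lemma small_lip (S : Side) {ε : ℝ} (hε : 0 < ε) :
    ∃ ρ > 0, ∀ r r', |r| < ρ → |r'| < ρ → |S.ψ.eval r - S.ψ.eval r'| ≤ ε * |r - r'| := by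
  have h := S.ψ.hasStrictDerivAt 0
  rw [S.ψ_deriv] at h
  have h := h.hasStrictFDerivAt.isLittleO.def hε
  obtain ⟨ρ, hρ, hb⟩ := Metric.eventually_nhds_iff.1 h
  refine ⟨ρ, hρ, fun r r' hr hr' => ?_⟩
  have := @hb (r, r') (by simp [Prod.dist_eq, hr, hr'])
  simpa using this

/-- When only `y` varies, the nonlinear term changes by at most half of what a linear term `c * y`
does. This lets the linear term decide signs in the comparison of two sides. -/
lemma cross_lip (S : Side) (a b : ℝ) {c : ℝ} (hc : c ≠ 0) : ∃ ρ > 0, ∀ x y y', |x| < ρ → |y| < ρ →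
    |y'| < ρ → |S.ψ.eval (a * x + b * y') - S.ψ.eval (a * x + b * y)| ≤ |c| / 2 * |y' - y| := by
  have hc' : 0 < |c| := abs_pos.2 hc
  have hb : 0 < |b| + 1 := by positivity
  -- The Lipschitz constant is chosen to give at most `|c| / 2` after multiplication by `|b|`.
  -- Dividing the radius by `|a| + |b| + 1` keeps the arguments `a * x + b * y` within `ρ`.
  obtain ⟨ρ, hρ, h⟩ := S.small_lip (ε := |c| / 2 / (|b| + 1)) (by positivity)
  have hab : 0 < |a| + |b| + 1 := by positivity
  refine ⟨ρ / (|a| + |b| + 1), by positivity, fun x y y' hx hy hy' => ?_⟩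
  have key : ∀ z, |z| < ρ / (|a| + |b| + 1) → |a * x + b * z| < ρ := by
    intro z hz
    calc |a * x + b * z| ≤ |a| * |x| + |b| * |z| := by
          rw [← abs_mul, ← abs_mul]; exact abs_add_le _ _
      _ ≤ |a| * (ρ / (|a| + |b| + 1)) + |b| * (ρ / (|a| + |b| + 1)) := by gcongr
      _ < ρ := by
        rw [← add_mul, mul_div_assoc', div_lt_iff₀ hab]; nlinarith
  refine (h _ _ (key _ hy') (key _ hy)).trans ?_
  have : a * x + b * y' - (a * x + b * y) = b * (y' - y) := by ring
  rw [this, abs_mul, ← mul_assoc]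
  refine mul_le_mul_of_nonneg_right ?_ (abs_nonneg _)
  rw [div_mul_eq_mul_div, div_le_iff₀ hb]
  nlinarith [abs_nonneg b]

/-- `ψ` vanishes to second order, so to first order the level is `-y`. Its sign in the horn is thus
settled by `S.y u`, except when this is zero. -/
lemma tendsto_lev_div (S : Side) {u : Plane} (hu : ‖u‖ = 1) :
    Tendsto (fun w => S.lev w / cx u w) (horn u) (𝓝 (-(S.y u))) := by
  obtain ⟨q, hq⟩ := S.exists_sq_mul
  have h1 := tendsto_div_horn hu S.ξ
  have h2 := tendsto_clm_horn hu S.ξ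
  have h3 := (q.continuous.tendsto 0).comp h2
  have h4 := tendsto_div_horn hu S.y
  have h := ((h1.mul h2).mul h3).sub h4
  simp only [mul_zero, zero_mul, zero_sub] at h
  refine h.congr' ?_
  filter_upwards [cx_pos_horn u] with w hw
  simp only [lev, hq, Function.comp]
  field_simp

lemma eventually_pos (S : Side) {u : Plane} (hu : ‖u‖ = 1) (h : S.y u < 0) :
    ∀ᶠ w in horn u, 0 < S.lev w := by
  filter_upwards [cx_pos_horn u, (S.tendsto_lev_div hu).eventually (lt_mem_nhds (neg_pos.2 h))]
    with w h1 h2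
  exact (div_pos_iff_of_pos_right h1).1 h2

lemma eventually_neg (S : Side) {u : Plane} (hu : ‖u‖ = 1) (h : 0 < S.y u) :
    ∀ᶠ w in horn u, S.lev w < 0 := by
  filter_upwards [cx_pos_horn u, (S.tendsto_lev_div hu).eventually (gt_mem_nhds (neg_neg_iff_pos.2 h))]
    with w h1 h2
  exact (div_neg_iff.1 h2).elim (fun h => absurd h.2 h1.le.not_gt) (fun h => h.1)

lemma ξ_ne_zero (S : Side) {u : Plane} (hu : ‖u‖ = 1) (h : S.y u = 0) : S.ξ u ≠ 0 := by
  intro h0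
  have := S.inj u h0 h
  rw [this, norm_zero] at hu
  exact zero_ne_one hu

lemma y_rotJ_ne_zero (S : Side) {u : Plane} (hu : ‖u‖ = 1) (h : S.y u = 0) :
    S.y (rotJ u) ≠ 0 := by
  intro h0
  have h1 : S.ξ (S.ξ (rotJ u) • u - S.ξ u • rotJ u) = 0 := by simp; ring
  have h2 : S.y (S.ξ (rotJ u) • u - S.ξ u • rotJ u) = 0 := by simp [h0, h]
  have h3 := congrArg (cy u) (S.inj _ h1 h2)
  simp [cy_self, cy_rotJ hu] at h3
  exact S.ξ_ne_zero hu h h3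

/-- The coordinates of two sides that touch the same direction. -/
lemma exists_coeffs {S T : Side} {u : Plane} (hu : ‖u‖ = 1) (hS : S.Tang u) (hT : T.Tang u) :
    ∃ a b : ℝ, 0 < a ∧ (∀ w, T.ξ w = a * S.ξ w + b * S.y w) ∧
      ∀ w, T.y w = T.y (rotJ u) / S.y (rotJ u) * S.y w := by
  have hne := S.y_rotJ_ne_zero hu hS.1
  have h1 := hS.2
  -- Both `y` kill `u`, hence they are proportional. Evaluation at `u` determines `a`, and
  -- evaluation at `rotJ u` then determines `b`.
  refine ⟨T.ξ u / S.ξ u, (T.ξ (rotJ u) - T.ξ u / S.ξ u * S.ξ (rotJ u)) / S.y (rotJ u),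
    div_pos hT.2 hS.2, fun w => ?_, fun w => ?_⟩
  · rw [frame_decomp hu w]
    simp only [map_add, map_smul, smul_eq_mul, hS.1]
    field_simp
    ring
  · rw [frame_decomp hu w]
    simp only [map_add, map_smul, smul_eq_mul, hS.1, hT.1]
    field_simp
    ring

/-- The level of `T` along the boundary of `S`, where the coordinates of `T` are
`a ξ + b y` and `c y` in terms of those of `S`. -/
def along (S T : Side) (a b c : ℝ) : ℝ[X] :=
  T.ψ.comp (C a * X + C b * S.ψ) - C c * S.ψ

lemma along_eval (S T : Side) (a b c h : ℝ) :
    (along S T a b c).eval h = T.ψ.eval (a * h + b * S.ψ.eval h) - c * S.ψ.eval h := by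
  simp [along]

/-- Comparison of the levels of two sides. -/
lemma lev_compare {S T : Side} {a b c : ℝ} (hc : c ≠ 0)
    (hξ : ∀ w, T.ξ w = a * S.ξ w + b * S.y w) (hy : ∀ w, T.y w = c * S.y w) :
    ∀ᶠ w in 𝓝 (0 : Plane),
      |T.lev w - (along S T a b c).eval (S.ξ w) - c * S.lev w| ≤ |c| / 2 * |S.lev w| := by
  obtain ⟨ρ, hρ, h⟩ := T.cross_lip a b hc
  have t1 : Tendsto (fun w => |S.ξ w|) (𝓝 0) (𝓝 0) := by
    have : Continuous fun w => |S.ξ w| := by fun_prop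
    simpa using this.tendsto 0
  have t2 : Tendsto (fun w => |S.y w|) (𝓝 0) (𝓝 0) := by
    have : Continuous fun w => |S.y w| := by fun_prop
    simpa using this.tendsto 0
  have t3 : Tendsto (fun w => |S.ψ.eval (S.ξ w)|) (𝓝 0) (𝓝 0) := by
    have : Continuous fun w => |S.ψ.eval (S.ξ w)| := by fun_prop
    simpa [S.ψ_zero] using this.tendsto 0
  filter_upwards [t1.eventually (gt_mem_nhds hρ), t2.eventually (gt_mem_nhds hρ),
    t3.eventually (gt_mem_nhds hρ)] with w h1 h2 h3
  -- The level of `T` exceeds its value on the arc of `S` by `c * S.lev w` plus a difference of two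
  -- values of `T.ψ`; their arguments differ by `b * S.lev w` up to sign, and `cross_lip` bounds
  -- that difference.
  have := h (S.ξ w) (S.ψ.eval (S.ξ w)) (S.y w) h1 h3 h2
  rw [along_eval]
  unfold lev
  rw [hξ, hy, abs_sub_comm (S.ψ.eval (S.ξ w))]
  convert this using 2
  ring

/-- Near the direction `u`, the region of `S` is contained in the region of `T`. -/
def Dom (u : Plane) (S T : Side) : Prop :=
  ∃ c > 0, ∀ᶠ w in horn u, 0 ≤ S.lev w → c * S.lev w ≤ T.lev w

lemma Dom.trans {u : Plane} {S T R : Side} (h : Dom u S T) (h' : Dom u T R) : Dom u S R := by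
  obtain ⟨c, hc, h⟩ := h
  obtain ⟨c', hc', h'⟩ := h'
  refine ⟨c' * c, by positivity, ?_⟩
  filter_upwards [h, h'] with w h1 h2 h3
  have h4 := h1 h3
  have h5 := h2 ((by positivity : 0 ≤ c * S.lev w).trans h4)
  nlinarith

/-- The sign of `T` on the boundary arc of `S` is eventually constant and decides which region is
smaller. The error in `lev_compare` is at most half of the linear term, which leaves the factors `c
/ 2` and `1 / (2 * c)`. Having a positive factor also transfers strict positivity from one level to
the other. -/
lemma Dom.total {u : Plane} (hu : ‖u‖ = 1) {S T : Side} (hS : S.Tang u) (hT : T.Tang u)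
    (hST : 0 < S.y (rotJ u) * T.y (rotJ u)) : Dom u S T ∨ Dom u T S := by
  obtain ⟨a, b, ha, hξ, hy⟩ := exists_coeffs hu hS hT
  set c := T.y (rotJ u) / S.y (rotJ u)
  have hc : 0 < c := by
    have : c = S.y (rotJ u) * T.y (rotJ u) / (S.y (rotJ u)) ^ 2 := by
      have := S.y_rotJ_ne_zero hu hS.1
      simp only [c]; field_simp
    rw [this]; have := S.y_rotJ_ne_zero hu hS.1; positivity
  have hcmp := horn_le_nhds hu (lev_compare hc.ne' hξ hy)
  rw [abs_of_pos hc] at hcmp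
  have ht := tendsto_clm_horn_pos hu hS.2
  rcases polyGerm_right 0 (along S T a b c) with h | h
  · left
    refine ⟨c / 2, by positivity, ?_⟩
    filter_upwards [hcmp, ht.eventually h] with w h1 h2 h3
    rw [abs_of_nonneg h3] at h1
    linarith [(abs_le.1 h1).1]
  · right
    refine ⟨1 / (2 * c), by positivity, ?_⟩
    filter_upwards [hcmp, ht.eventually h] with w h1 h2 h3
    have h4 : 0 ≤ S.lev w := by
      by_contra! h4
      rw [abs_of_neg h4] at h1
      nlinarith [(abs_le.1 h1).2]
    rw [abs_of_nonneg h4] at h1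
    have := (abs_le.1 h1).2
    rw [div_mul_eq_mul_div, div_le_iff₀ (by positivity)]
    nlinarith

/-- For `c < 0` the regions lie on opposite sides of the common tangent. Moving from the arc of `S`
into its region lowers the level of `T`, so if `T` already excludes the arc, the two regions are
disjoint in the horn. -/
lemma opposite_alternative {u : Plane} (hu : ‖u‖ = 1) {S T : Side} (hS : S.Tang u)
    {a b c : ℝ} (hc : c < 0)
    (hξ : ∀ w, T.ξ w = a * S.ξ w + b * S.y w) (hy : ∀ w, T.y w = c * S.y w) :
    (∀ᶠ h in 𝓝[>] 0, 0 ≤ (along S T a b c).eval h) ∨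
      (∀ᶠ w in horn u, 0 ≤ S.lev w → T.lev w < 0) := by
  refine (polyGerm_right 0 (along S T a b c)).imp id fun h => ?_
  filter_upwards [horn_le_nhds hu (lev_compare hc.ne hξ hy),
    (tendsto_clm_horn_pos hu hS.2).eventually h] with w h1 h2 h3
  rw [abs_of_nonneg h3, abs_of_neg hc] at h1
  nlinarith [(abs_le.1 h1).2]

end Side

namespace PolyHalfPlane

/-- The germ of a half plane at a boundary point `p`. The sign `σ` orients the boundary. -/
def side (H : PolyHalfPlane) (p : Plane) (σ : ℤˣ) : Side where
  ψ := H.poly.comp (C (H.fx p) + C ((σ : ℤ) : ℝ) * X) - C (H.poly.eval (H.fx p))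
    - C (H.poly.derivative.eval (H.fx p) * ((σ : ℤ) : ℝ)) * X
  ξ := ((σ : ℤ) : ℝ) • H.fx
  y := H.fy - H.poly.derivative.eval (H.fx p) • H.fx
  ψ_zero := by simp
  ψ_deriv := by simp [derivative_comp]; ring
  inj := by
    intro w h1 h2
    have h3 : H.fx w = 0 := by
      rcases Int.units_eq_one_or σ with rfl | rfl <;> simpa using h1
    apply H.ext_frame <;> simp_all

lemma side_ψ_eval (H : PolyHalfPlane) (p : Plane) (σ : ℤˣ) (h : ℝ) :
    (H.side p σ).ψ.eval h = H.poly.eval (H.fx p + ((σ : ℤ) : ℝ) * h) - H.poly.eval (H.fx p)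
      - H.poly.derivative.eval (H.fx p) * ((σ : ℤ) : ℝ) * h := by
  simp [side]

lemma unit_sq_real (σ : ℤˣ) : ((σ : ℤ) : ℝ) * ((σ : ℤ) : ℝ) = 1 := by
  rcases Int.units_eq_one_or σ with rfl | rfl <;> simp

lemma side_deriv2 (H : PolyHalfPlane) (p : Plane) (σ : ℤˣ) (h : ℝ) :
    (H.side p σ).ψ.derivative.derivative.eval h
      = H.poly.derivative.derivative.eval (H.fx p + ((σ : ℤ) : ℝ) * h) := by
  simp [side, derivative_comp]
  rw [← mul_assoc, unit_sq_real, one_mul]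

lemma side_ξ (H : PolyHalfPlane) (p : Plane) (σ : ℤˣ) (w : Plane) :
    (H.side p σ).ξ w = ((σ : ℤ) : ℝ) * H.fx w := by simp [side]

lemma side_y (H : PolyHalfPlane) (p : Plane) (σ : ℤˣ) (w : Plane) :
    (H.side p σ).y w = H.fy w - H.poly.derivative.eval (H.fx p) * H.fx w := by simp [side]

/-- An exact identity, with no error term: the tangent subtracted in `ψ` is also subtracted in `y`,
and the orientation cancels because its square is `1`. -/
lemma lev_add (H : PolyHalfPlane) {p : Plane} (hp : H.lev p = 0) (σ : ℤˣ) (w : Plane) :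
    H.lev (p + w) = (H.side p σ).lev w := by
  unfold Side.lev
  rw [side_ψ_eval, side_ξ, side_y, ← mul_assoc, unit_sq_real, one_mul]
  unfold lev at hp ⊢
  simp only [map_add]
  linear_combination hp + H.poly.derivative.eval (H.fx p) * H.fx w * unit_sq_real σ

end PolyHalfPlane

/-! ### Taut curves -/

/-- A curve in `X` that is `1`-Lipschitz on `[a, b]` and straight, with unit speed, between any
two of its points that see each other in `X`. -/
structure Taut (X : Set Plane) (η : ℝ → Plane) (a b : ℝ) : Prop where
  lip : ∀ s ∈ Icc a b, ∀ t ∈ Icc a b, dist (η s) (η t) ≤ |s - t|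
  mem : ∀ s ∈ Icc a b, η s ∈ X
  geo : ∀ s ∈ Icc a b, ∀ t ∈ Icc a b, s ≤ t → segment ℝ (η s) (η t) ⊆ X →
    dist (η s) (η t) = t - s

namespace Taut

variable {X : Set Plane} {η : ℝ → Plane} {a b : ℝ}

lemma mono (h : Taut X η a b) {a' b' : ℝ} (ha : a ≤ a') (hb : b' ≤ b) : Taut X η a' b' where
  lip s hs t ht := h.lip s ⟨ha.trans hs.1, hs.2.trans hb⟩ t ⟨ha.trans ht.1, ht.2.trans hb⟩
  mem s hs := h.mem s ⟨ha.trans hs.1, hs.2.trans hb⟩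
  geo s hs t ht := h.geo s ⟨ha.trans hs.1, hs.2.trans hb⟩ t ⟨ha.trans ht.1, ht.2.trans hb⟩

lemma continuousOn (h : Taut X η a b) : ContinuousOn η (Icc a b) := by
  have : LipschitzOnWith 1 η (Icc a b) := LipschitzOnWith.of_dist_le_mul fun s hs t ht => by
    simpa [Real.dist_eq] using h.lip s hs t ht
  exact this.continuousOn

/-- Equal points see each other along a degenerate segment, so their parameters differ by the
distance `0`. -/
lemma injOn (h : Taut X η a b) : InjOn η (Icc a b) := by
  have key : ∀ s ∈ Icc a b, ∀ t ∈ Icc a b, s ≤ t → η s = η t → s = t := by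
    intro s hs t ht hst he
    have := h.geo s hs t ht hst (by rw [he, segment_same]; simpa using h.mem t ht)
    rw [he, dist_self] at this
    linarith
  intro s hs t ht he
  rcases le_total s t with hst | hst
  · exact key s hs t ht hst he
  · exact (key t ht s hs hst he.symm).symm

lemma reverse (h : Taut X η a b) : Taut X (fun s => η (-s)) (-b) (-a) where
  lip s hs t ht := by
    have := h.lip (-s) ⟨by linarith [hs.2], by linarith [hs.1]⟩ (-t)
      ⟨by linarith [ht.2], by linarith [ht.1]⟩
    rwa [show -s - -t = -(s - t) by ring, abs_neg] at this
  mem s hs := h.mem (-s) ⟨by linarith [hs.2], by linarith [hs.1]⟩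
  geo s hs t ht hst hseg := by
    have := h.geo (-t) ⟨by linarith [ht.2], by linarith [ht.1]⟩ (-s)
      ⟨by linarith [hs.2], by linarith [hs.1]⟩ (by linarith) (by rwa [segment_symm])
    rw [dist_comm, this]; ring

/-- A stretch of full length is run through with constant unit velocity. -/
lemma affine (h : Taut X η a b) {s t : ℝ} (has : a ≤ s) (hst : s < t) (htb : t ≤ b)
    (hd : dist (η s) (η t) = t - s) :
    ∃ v : Plane, ‖v‖ = 1 ∧ ∀ r ∈ Icc s t, η r = η s + (r - s) • v := by
  have hp : 0 < t - s := by linarith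
  refine ⟨(t - s)⁻¹ • (η t - η s), ?_, fun r hr => ?_⟩
  · rw [norm_smul, ← dist_eq_norm, dist_comm, hd, norm_inv, Real.norm_eq_abs, abs_of_pos hp,
      inv_mul_cancel₀ hp.ne']
  · have h1 := h.lip s ⟨has, hst.le.trans htb⟩ r ⟨has.trans hr.1, hr.2.trans htb⟩
    have h2 := h.lip r ⟨has.trans hr.1, hr.2.trans htb⟩ t ⟨has.trans hst.le, htb⟩
    have h3 := dist_triangle (η s) (η r) (η t)
    rw [abs_of_nonpos (by linarith [hr.1])] at h1
    rw [abs_of_nonpos (by linarith [hr.2])] at h2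
    have e1 : dist (η s) (η r) = (r - s) / (t - s) * dist (η s) (η t) := by
      rw [hd]; field_simp; linarith
    have e2 : dist (η r) (η t) = (1 - (r - s) / (t - s)) * dist (η s) (η t) := by
      rw [hd]; field_simp; linarith
    -- The two Lipschitz bounds add up to the full distance, so both are equalities; strict
    -- convexity of the norm then puts `η r` on the segment.
    have := eq_lineMap_of_dist_eq_mul_of_dist_eq_mul e1 e2
    rw [this, AffineMap.lineMap_apply_module', smul_smul, div_eq_mul_inv, add_comm]

lemma dist_sub (h : Taut X η a b) {s t s' t' : ℝ} (has : a ≤ s) (hs : s ≤ s') (hst : s' ≤ t')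
    (ht : t' ≤ t) (htb : t ≤ b) (hd : dist (η s) (η t) = t - s) :
    dist (η s') (η t') = t' - s' := by
  rcases (hs.trans (hst.trans ht)).eq_or_lt with he | hlt
  · have : s' = t' := by linarith
    rw [this, dist_self, sub_self]
  · obtain ⟨v, hv, hr⟩ := h.affine has hlt htb hd
    rw [hr s' ⟨hs, hst.trans ht⟩, hr t' ⟨hs.trans hst, ht⟩, dist_add_left, dist_eq_norm, ← sub_smul,
      norm_smul, hv, Real.norm_eq_abs, abs_of_nonpos (by linarith)]
    ring

/-- A curve that is locally straight is straight. -/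
lemma straight_of_locally (h : Taut X η a b) {s t : ℝ} (has : a ≤ s) (hst : s < t) (htb : t ≤ b)
    (hloc : ∀ r ∈ Ioo s t, ∃ δ > 0, ∀ r₁ ∈ Ioo (r - δ) (r + δ), ∀ r₂ ∈ Ioo (r - δ) (r + δ),
      r₁ ∈ Icc a b → r₂ ∈ Icc a b → segment ℝ (η r₁) (η r₂) ⊆ X) :
    dist (η s) (η t) = t - s := by
  have hd : ∀ r ∈ Ioo s t, ∃ v : Plane, ‖v‖ = 1 ∧ ∀ᶠ x in 𝓝 r, HasDerivAt η v x := by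
    intro r hr
    obtain ⟨δ, hδ, hδ'⟩ := hloc r hr
    set ε := min (δ / 2) (min (r - s) (t - r)) with hε
    have hε0 : 0 < ε := lt_min (by linarith) (lt_min (by linarith [hr.1]) (by linarith [hr.2]))
    have e1 : ε ≤ δ / 2 := min_le_left _ _
    have e2 : ε ≤ r - s := (min_le_right _ _).trans (min_le_left _ _)
    have e3 : ε ≤ t - r := (min_le_right _ _).trans (min_le_right _ _)
    have m1 : r - ε ∈ Icc a b := ⟨by linarith, by linarith⟩
    have m2 : r + ε ∈ Icc a b := ⟨by linarith, by linarith⟩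
    have hg := h.geo _ m1 _ m2 (by linarith) (hδ' _ ⟨by linarith, by linarith⟩ _
      ⟨by linarith, by linarith⟩ m1 m2)
    obtain ⟨v, hv, hv'⟩ := h.affine m1.1 (by linarith) m2.2 hg
    refine ⟨v, hv, ?_⟩
    filter_upwards [Ioo_mem_nhds (show r - ε < r by linarith) (show r < r + ε by linarith)]
      with x hx
    have hlin : HasDerivAt (fun y : ℝ => η (r - ε) + (y - (r - ε)) • v) v x := by
      have := (((hasDerivAt_id x).sub_const (r - ε)).smul_const v).const_add (η (r - ε))
      simpa using this
    refine hlin.congr_of_eventuallyEq ?_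
    filter_upwards [Ioo_mem_nhds hx.1 hx.2] with y hy
    exact hv' y ⟨hy.1.le, hy.2.le⟩
  -- The velocity is locally constant, so it is constant on the connected open interval.
  have hdd : ∀ r ∈ Ioo s t, HasDerivAt (deriv η) 0 r := by
    intro r hr
    obtain ⟨v, -, hv⟩ := hd r hr
    refine (hasDerivAt_const r v).congr_of_eventuallyEq ?_
    filter_upwards [hv] with x hx using hx.deriv
  obtain ⟨v, hv⟩ := isOpen_Ioo.exists_is_const_of_deriv_eq_zero isPreconnected_Ioo
    (fun r hr => (hdd r hr).differentiableAt.differentiableWithinAt)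
    (fun r hr => (hdd r hr).deriv)
  have hv1 : ‖v‖ = 1 := by
    have hm : (s + t) / 2 ∈ Ioo s t := ⟨by linarith, by linarith⟩
    obtain ⟨w, hw, hw'⟩ := hd _ hm
    rw [← hv _ hm, hw'.self_of_nhds.deriv, hw]
  have hη : ∀ r ∈ Ioo s t, HasDerivAt (fun x : ℝ => η x - x • v) 0 r := by
    intro r hr
    obtain ⟨w, -, hw'⟩ := hd r hr
    have := hw'.self_of_nhds.differentiableAt.hasDerivAt
    rw [hv r hr] at this
    have h2 : HasDerivAt (fun x : ℝ => η x - x • v) (v - (1 : ℝ) • v) r :=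
      this.fun_sub ((hasDerivAt_id r).smul_const v)
    rwa [one_smul, sub_self] at h2
  obtain ⟨c, hc⟩ := isOpen_Ioo.exists_is_const_of_deriv_eq_zero isPreconnected_Ioo
    (fun r hr => (hη r hr).differentiableAt.differentiableWithinAt)
    (fun r hr => (hη r hr).deriv)
  have hin : ∀ x ∈ Ioo s t, ∀ y ∈ Ioo s t, dist (η x) (η y) = |x - y| := by
    intro x hx y hy
    have h1 := hc x hx
    have h2 := hc y hy
    have : η x - η y = (x - y) • v := by
      rw [sub_eq_iff_eq_add] at h1 h2
      rw [h1, h2, sub_smul]; abel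
    rw [dist_eq_norm, this, norm_smul, hv1, mul_one, Real.norm_eq_abs]
  have m1 : s ∈ Icc a b := ⟨has, hst.le.trans htb⟩
  have m2 : t ∈ Icc a b := ⟨has.trans hst.le, htb⟩
  refine le_antisymm ?_ ?_
  · have := h.lip s m1 t m2
    rwa [abs_of_nonpos (by linarith), neg_sub] at this
  -- Straightness is known on the open interval only. The endpoints are reached by moving in by `d`,
  -- at a cost controlled by the Lipschitz bound.
  · refine le_of_forall_pos_le_add fun ε hε => ?_
    set d := min (ε / 4) ((t - s) / 3)
    have d0 : 0 < d := lt_min (by linarith) (by linarith)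
    have d1 : d ≤ ε / 4 := min_le_left _ _
    have d2 : d ≤ (t - s) / 3 := min_le_right _ _
    have k1 := h.lip s m1 (s + d) ⟨by linarith, by linarith⟩
    have k2 := h.lip (t - d) ⟨by linarith, by linarith⟩ t m2
    have k3 := hin (s + d) ⟨by linarith, by linarith⟩ (t - d) ⟨by linarith, by linarith⟩
    rw [abs_of_nonpos (by linarith)] at k1 k2 k3
    have k4 := dist_triangle4 (η (s + d)) (η s) (η t) (η (t - d))
    rw [dist_comm (η (s + d)) (η s), dist_comm (η t) (η (t - d))] at k4
    linarith

end Taut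

/-! ### Auxiliary facts on real functions -/

/-- Without zeros near `s`, the intermediate value theorem lets a single positive value spread over
the whole germ. -/
lemma eventually_pos_of_frequently {f : ℝ → ℝ} {s b : ℝ} (hb : s < b)
    (hf : ContinuousOn f (Ioo s b)) (h0 : ∀ᶠ x in 𝓝[>] s, f x ≠ 0)
    (h1 : ∃ᶠ x in 𝓝[>] s, 0 < f x) : ∀ᶠ x in 𝓝[>] s, 0 < f x := by
  obtain ⟨c, hc, hc'⟩ := mem_nhdsGT_iff_exists_Ioo_subset.1
    (inter_mem h0 (Ioo_mem_nhdsGT hb))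
  obtain ⟨x, hx, hx'⟩ := (h1.and_eventually (Ioo_mem_nhdsGT hc)).exists
  filter_upwards [Ioo_mem_nhdsGT hc] with y hy
  by_contra! hy'
  obtain ⟨z, hz, hz'⟩ := isPreconnected_Ioo.intermediate_value hy hx' (f := f)
    (hf.mono fun z hz => (hc' hz).2) ⟨hy', hx.le⟩
  exact (hc' hz).1 hz'

/-- A nonnegative function without bumps between two zeros vanishes near the left end or is
positive. -/
lemma zero_or_pos_of_no_bump {g : ℝ → ℝ} {s c : ℝ} (hg : ContinuousOn g (Icc s c))
    (h0 : g s = 0) (hnn : ∀ x ∈ Icc s c, 0 ≤ g x)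
    (hb : ∀ α β, s ≤ α → α < β → β ≤ c → g α = 0 → g β = 0 → ¬ ∀ x ∈ Ioo α β, 0 < g x) :
    (∃ t ∈ Ioc s c, ∀ x ∈ Icc s t, g x = 0) ∨ ∀ x ∈ Ioc s c, 0 < g x := by
  by_cases hz : ∃ t ∈ Ioc s c, g t = 0
  swap
  · right
    push Not at hz
    exact fun x hx => lt_of_le_of_ne (hnn x ⟨hx.1.le, hx.2⟩) (hz x hx).symm
  left
  obtain ⟨t, ht, hgt⟩ := hz
  refine ⟨t, ht, fun x hx => ?_⟩
  by_contra hne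
  have comp : ∀ p q, s ≤ p → q ≤ c → IsCompact {y | y ∈ Icc p q ∧ g y = 0} := by
    intro p q hp hq
    have : {y | y ∈ Icc p q ∧ g y = 0} = Icc p q ∩ g ⁻¹' {0} := by ext; simp
    rw [this]
    exact isCompact_Icc.of_isClosed_subset ((hg.mono (Icc_subset_Icc hp hq)).preimage_isClosed_of_isClosed
      isClosed_Icc isClosed_singleton) inter_subset_left
  -- `α` and `β` are the zeros nearest to `x` on either side; between them `g` would form a
  -- forbidden bump.
  obtain ⟨α, ⟨hα, hα0⟩, hαm⟩ := (comp s x le_rfl (hx.2.trans ht.2)).exists_isGreatest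
    ⟨s, ⟨le_rfl, hx.1⟩, h0⟩
  obtain ⟨β, ⟨hβ, hβ0⟩, hβm⟩ := (comp x t hx.1 ht.2).exists_isLeast ⟨t, ⟨hx.2, le_rfl⟩, hgt⟩
  have hαx : α < x := lt_of_le_of_ne hα.2 fun h => hne (h ▸ hα0)
  have hxβ : x < β := lt_of_le_of_ne hβ.1 fun h => hne (h ▸ hβ0)
  refine hb α β hα.1 (hαx.trans hxβ) (hβ.2.trans ht.2) hα0 hβ0 fun y hy => ?_
  refine lt_of_le_of_ne (hnn y ⟨hα.1.trans hy.1.le, hy.2.le.trans (hβ.2.trans ht.2)⟩) fun h => ?_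
  rcases le_total y x with hyx | hyx
  · exact not_le.2 hy.1 (hαm ⟨⟨hα.1.trans hy.1.le, hyx⟩, h.symm⟩)
  · exact not_le.2 hy.2 (hβm ⟨⟨hyx, hy.2.le.trans hβ.2⟩, h.symm⟩)

lemma poly_deriv (q : ℝ[X]) : deriv (fun x => q.eval x) = fun x => q.derivative.eval x := by
  ext x; simp

/-! ### Convex and concave sides, and thin horns -/

namespace Side

/-- The graph bounding the region is strictly convex upward near the origin. -/
def Obst (S : Side) : Prop := ∀ᶠ h in 𝓝[>] 0, 0 < S.ψ.derivative.derivative.eval h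

/-- Positive second derivative together with `ψ 0 = 0` and `ψ' 0 = 0` makes first `ψ'` and then `ψ`
strictly increasing from `0`. -/
lemma Obst.exists_radius {S : Side} (h : S.Obst) : ∃ ρ > 0,
    StrictConvexOn ℝ (Ico 0 ρ) (fun x => S.ψ.eval x) ∧
      ∀ x ∈ Ioo 0 ρ, 0 < S.ψ.eval x ∧ 0 < S.ψ.derivative.derivative.eval x := by
  obtain ⟨ρ, hρ, hsub⟩ := mem_nhdsGT_iff_exists_Ioo_subset.1 h
  refine ⟨ρ, hρ, ?_, fun x hx => ⟨?_, hsub hx⟩⟩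
  · refine strictConvexOn_of_deriv2_pos (convex_Ico 0 ρ) S.ψ.continuous.continuousOn fun x hx => ?_
    rw [interior_Ico] at hx
    simp only [Function.iterate_succ, Function.iterate_zero, Function.comp, id, poly_deriv]
    exact hsub hx
  · have m1 : StrictMonoOn (fun x => S.ψ.derivative.eval x) (Ico 0 ρ) := by
      refine strictMonoOn_of_deriv_pos (convex_Ico 0 ρ)
        S.ψ.derivative.continuous.continuousOn fun x hx => ?_
      rw [interior_Ico] at hx
      rw [poly_deriv]; exact hsub hx
    have m2 : StrictMonoOn (fun x => S.ψ.eval x) (Ico 0 ρ) := by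
      refine strictMonoOn_of_deriv_pos (convex_Ico 0 ρ) S.ψ.continuous.continuousOn fun x hx => ?_
      rw [interior_Ico] at hx
      rw [poly_deriv]
      have := m1 ⟨le_rfl, hρ⟩ ⟨hx.1.le, hx.2⟩ hx.1
      simpa [S.ψ_deriv] using this
    have := m2 ⟨le_rfl, hρ⟩ ⟨hx.1.le, hx.2⟩ hx.1
    simpa [S.ψ_zero] using this

/-- The second derivative is a polynomial: if it is not eventually positive, it is eventually
nonpositive. -/
lemma exists_concave_radius {S : Side} (h : ¬ S.Obst) : ∃ ρ > 0,
    ConcaveOn ℝ (Ico 0 ρ) (fun x => S.ψ.eval x) := by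
  have h : ∀ᶠ h in 𝓝[>] 0, S.ψ.derivative.derivative.eval h ≤ 0 := by
    rcases polyGerm_right 0 (-S.ψ.derivative.derivative) with h' | h'
    · filter_upwards [h'] with x hx
      simpa using hx
    · exact absurd (h'.mono fun x hx => by simpa using hx) h
  obtain ⟨ρ, hρ, hsub⟩ := mem_nhdsGT_iff_exists_Ioo_subset.1 h
  refine ⟨ρ, hρ, concaveOn_of_deriv2_nonpos (convex_Ico 0 ρ) S.ψ.continuous.continuousOn
    S.ψ.differentiable.differentiableOn ?_ fun x hx => ?_⟩
  · rw [poly_deriv]; exact S.ψ.derivative.differentiable.differentiableOn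
  · rw [interior_Ico] at hx
    simp only [Function.iterate_succ, Function.iterate_zero, Function.comp, id, poly_deriv]
    exact hsub hx

/-- A point whose segment to the origin leaves the region lies in a thin horn. -/
lemma thin_of_violated (S : Side) {K : ℝ} (hK0 : 0 < K)
    (hK : ∀ h, |h| ≤ 1 → |S.ψ.eval h| ≤ K * h ^ 2) {w : Plane} (hw : |S.ξ w| ≤ 1)
    (h0 : 0 ≤ S.lev w) {c : ℝ} (hc0 : 0 ≤ c) (hc1 : c ≤ 1) (hv : S.lev (c • w) < 0) :
    |S.y w| ≤ K * S.ξ w ^ 2 := by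
  unfold lev at h0 hv
  simp only [map_smul, smul_eq_mul] at hv
  have hcp : 0 < c := lt_of_le_of_ne hc0 fun h => by
    subst h; simp [S.ψ_zero] at hv
  have h1 := abs_le.1 (hK _ hw)
  have h2 := abs_le.1 (hK (c * S.ξ w) (by
    rw [abs_mul, abs_of_pos hcp]; nlinarith [abs_nonneg (S.ξ w)]))
  -- The upper bound is `y ≤ ψ ξ` at `w`. For the lower bound, the violation at `c • w` gives `c * y
  -- > ψ (c * ξ)`, which is at least `-K * c ^ 2 * ξ ^ 2`; then divide by `c`.
  refine abs_le.2 ⟨?_, by linarith [h1.2]⟩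
  have h3 : c * (-(K * c * S.ξ w ^ 2)) < c * S.y w := by nlinarith [h2.1]
  have h4 := lt_of_mul_lt_mul_left h3 hc0
  have h5 : c * (K * S.ξ w ^ 2) ≤ K * S.ξ w ^ 2 :=
    mul_le_of_le_one_left (by positivity) hc1
  linarith

/-- The region below a concave graph is convex. Such sides can never obstruct the view between two
points of the region. -/
lemma concave_level {S : Side} {ρ : ℝ} (hρ : ConcaveOn ℝ (Ico 0 ρ) (fun x => S.ψ.eval x))
    {w w' : Plane} (hw : S.ξ w ∈ Ico 0 ρ) (hw' : S.ξ w' ∈ Ico 0 ρ) (h : 0 ≤ S.lev w)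
    (h' : 0 ≤ S.lev w') {α β : ℝ} (hα : 0 ≤ α) (hβ : 0 ≤ β) (hαβ : α + β = 1) :
    0 ≤ S.lev (α • w + β • w') := by
  have := hρ.2 hw hw' hα hβ hαβ
  unfold lev at *
  simp only [map_add, map_smul, smul_eq_mul] at *
  nlinarith

end Side

/-- A curve that approaches the origin inside finitely many thin horns has a direction there. -/
lemma exists_direction {ι : Type*} [Finite ι] (S : ι → Side) (K : ι → ℝ) {w : ℝ → Plane} {s b : ℝ}
    (hb : s < b) (hw : ContinuousOn w (Ioo s b)) (h0 : Tendsto w (𝓝[>] s) (𝓝 0))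
    (hne : ∀ᶠ x in 𝓝[>] s, w x ≠ 0)
    (hthin : ∀ᶠ x in 𝓝[>] s, ∃ i, |(S i).y (w x)| ≤ K i * (S i).ξ (w x) ^ 2) :
    ∃ u : Plane, ‖u‖ = 1 ∧ Tendsto w (𝓝[>] s) (horn u) := by
  set dir : ℝ → Plane := fun x => ‖w x‖⁻¹ • w x with hdir
  have hsph : map dir (𝓝[>] s) ≤ 𝓟 (Metric.sphere (0 : Plane) 1) := by
    rw [le_principal_iff, mem_map]
    filter_upwards [hne] with x hx
    simp [hdir, norm_smul, hx]
  -- The candidate is a cluster point of the normalized directions; the remaining task is to show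
  -- that they converge to it.
  obtain ⟨u, hu, hcl⟩ := isCompact_sphere (0 : Plane) 1 hsph
  have hu : ‖u‖ = 1 := by simpa using hu
  refine ⟨u, hu, ?_⟩
  have hcx : Tendsto (fun x => cx u (w x)) (𝓝[>] s) (𝓝 0) := by
    have := ((cx u).continuous.tendsto 0).comp h0
    rwa [map_zero] at this
  -- For all small `κ > 0` the two rays at slope `±κ` around `u` are tangent to no side: a tangent
  -- line through `u` itself meets them only at the origin, and any other is avoided by continuity.
  have hκ : ∀ᶠ κ : ℝ in 𝓝[>] 0, ∀ i, (S i).y (u + κ • rotJ u) ≠ 0 ∧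
      (S i).y (u - κ • rotJ u) ≠ 0 := by
    rw [eventually_all]
    intro i
    by_cases hy : (S i).y u = 0
    · filter_upwards [self_mem_nhdsWithin] with κ hκ
      have := (S i).y_rotJ_ne_zero hu hy
      have hκ' : κ ≠ 0 := ne_of_gt hκ
      simp [hy, this, hκ']
    · have c1 : Continuous fun κ : ℝ => (S i).y (u + κ • rotJ u) := by fun_prop
      have c2 : Continuous fun κ : ℝ => (S i).y (u - κ • rotJ u) := by fun_prop
      have t1 := c1.tendsto 0
      have t2 := c2.tendsto 0
      simp only [zero_smul, add_zero, sub_zero] at t1 t2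
      exact ((t1.eventually_ne hy).and (t2.eventually_ne hy)).filter_mono nhdsWithin_le_nhds
  -- The curve cannot meet these two rays near the origin, but it is frequently in the cone between
  -- them because `u` is a cluster direction. So it eventually stays in that cone.
  have main : ∀ κ : ℝ, 0 < κ → (∀ i, (S i).y (u + κ • rotJ u) ≠ 0 ∧
      (S i).y (u - κ • rotJ u) ≠ 0) → ∀ᶠ x in 𝓝[>] s, 0 < κ * cx u (w x) - |cy u (w x)| := by
    intro κ hκ0 hκ
    refine eventually_pos_of_frequently hb ?_ ?_ ?_
    · fun_prop
    -- At a point `t • v` of a ray, thinness reads `t * |y v| ≤ K * t ^ 2 * ξ v ^ 2`, which fails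
    -- for small `t > 0` when `y v ≠ 0`.
    · have hlim : ∀ v : Plane, (∀ i, (S i).y v ≠ 0) →
          ∀ᶠ x in 𝓝[>] s, ∀ i, K i * cx u (w x) * (S i).ξ v ^ 2 < |(S i).y v| := by
        intro v hv
        rw [eventually_all]
        intro i
        have := (hcx.const_mul (K i)).mul_const ((S i).ξ v ^ 2)
        rw [mul_zero, zero_mul] at this
        exact this.eventually (gt_mem_nhds (abs_pos.2 (hv i)))
      filter_upwards [hlim _ fun i => (hκ i).1, hlim _ fun i => (hκ i).2, hthin, hne]
        with x h1 h2 h3 h4 h5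
      have h6 : |cy u (w x)| = κ * cx u (w x) := by linarith
      have h7 : 0 ≤ cx u (w x) :=
        nonneg_of_mul_nonneg_right (h6 ▸ abs_nonneg _) hκ0
      have h8 : 0 < cx u (w x) := by
        refine lt_of_le_of_ne h7 fun h => h4 ?_
        apply frame_ext hu
        · rw [map_zero, ← h]
        · rw [map_zero, ← abs_eq_zero, h6, ← h, mul_zero]
      obtain ⟨i, hi⟩ := h3
      have key : ∀ v : Plane, w x = cx u (w x) • v →
          K i * cx u (w x) * (S i).ξ v ^ 2 < |(S i).y v| → False := by
        intro v hv hlt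
        rw [hv] at hi
        generalize cx u (w x) = t at *
        simp only [map_smul, smul_eq_mul, abs_mul, abs_of_pos h8] at hi
        have : t * |(S i).y v| ≤ t * (K i * t * (S i).ξ v ^ 2) := by nlinarith
        exact absurd (le_of_mul_le_mul_left this h8) (not_le.2 hlt)
      have hdec := frame_decomp hu (w x)
      rcases abs_eq (by positivity : 0 ≤ κ * cx u (w x)) |>.1 h6 with h9 | h9
      · refine key (u + κ • rotJ u) ?_ (h1 i)
        conv_lhs => rw [hdec, h9]
        rw [smul_add, smul_smul, mul_comm κ]
      · refine key (u - κ • rotJ u) ?_ (h2 i)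
        conv_lhs => rw [hdec, h9]
        rw [smul_sub, smul_smul, mul_comm κ, neg_smul, sub_eq_add_neg]
    · have hopen : {v : Plane | 0 < κ * cx u v - |cy u v|} ∈ 𝓝 u := by
        have hc : Continuous fun v : Plane => κ * cx u v - |cy u v| := by fun_prop
        refine (isOpen_lt continuous_const hc).mem_nhds ?_
        simp [cx_self hu, cy_self, hκ0]
      have hfr : ∃ᶠ x in 𝓝[>] s, 0 < κ * cx u (dir x) - |cy u (dir x)| :=
        (mapClusterPt_iff_frequently.1 hcl) _ hopen
      refine (hfr.and_eventually hne).mono fun x hx => ?_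
      obtain ⟨hx, hx0⟩ := hx
      have hp : 0 < ‖w x‖⁻¹ := inv_pos.2 (norm_pos_iff.2 hx0)
      simp only [hdir, map_smul, smul_eq_mul, abs_mul, abs_of_pos hp] at hx
      have : 0 < ‖w x‖⁻¹ * (κ * cx u (w x) - |cy u (w x)|) := by linarith
      exact (pos_iff_pos_of_mul_pos this).1 hp
  have hpos : ∀ ε : ℝ, 0 < ε → ∀ᶠ x in 𝓝[>] s, 0 < cx u (w x) ∧ |cy u (w x) / cx u (w x)| < ε := by
    intro ε hε
    obtain ⟨κ, hκ, hκε⟩ := (hκ.and (Ioo_mem_nhdsGT hε)).exists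
    filter_upwards [main κ hκε.1 hκ] with x hx
    have h1 : 0 < cx u (w x) := by
      have : 0 < κ * cx u (w x) := by linarith [abs_nonneg (cy u (w x))]
      exact pos_of_mul_pos_right this hκε.1.le
    refine ⟨h1, ?_⟩
    rw [abs_div, abs_of_pos h1, div_lt_iff₀ h1]
    nlinarith [hκε.2]
  rw [tendsto_horn_iff]
  refine ⟨tendsto_nhdsWithin_iff.2 ⟨hcx, (hpos 1 one_pos).mono fun x hx => hx.1⟩, ?_⟩
  rw [Metric.tendsto_nhds]
  intro ε hε
  filter_upwards [hpos ε hε] with x hx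
  rw [Real.dist_eq, sub_zero]; exact hx.2

/-- The open cone of opening and radius `δ` around the direction `u`. -/
def coneSet (u : Plane) (δ : ℝ) : Set Plane := {w | 0 < cx u w ∧ cx u w < δ ∧ |cy u w| < δ * cx u w}

lemma coneSet_mem_horn {u : Plane} {δ : ℝ} (hδ : 0 < δ) : coneSet u δ ∈ horn u :=
  mem_horn_iff.2 ⟨δ, hδ, fun _ h1 h2 h3 => ⟨h1, h2, h3⟩⟩

lemma exists_coneSet {u : Plane} {s : Set Plane} (h : s ∈ horn u) :
    ∃ δ > 0, coneSet u δ ⊆ s := by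
  obtain ⟨δ, hδ, h⟩ := mem_horn_iff.1 h
  exact ⟨δ, hδ, fun w hw => h w hw.1 hw.2.1 hw.2.2⟩

lemma isOpen_coneSet (u : Plane) (δ : ℝ) : IsOpen (coneSet u δ) := by
  have c1 : Continuous fun w => cx u w := (cx u).continuous
  have c2 : Continuous fun w => |cy u w| := (cy u).continuous.abs
  exact (isOpen_lt continuous_const c1).inter ((isOpen_lt c1 continuous_const).inter
    (isOpen_lt c2 (continuous_const.mul c1)))

lemma smul_mem_coneSet {u : Plane} {δ : ℝ} {w : Plane} (hw : w ∈ coneSet u δ) {c : ℝ} (hc : 0 < c)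
    (hc1 : c ≤ 1) : c • w ∈ coneSet u δ := by
  obtain ⟨h1, h2, h3⟩ := hw
  refine ⟨?_, ?_, ?_⟩
  · simp only [map_smul, smul_eq_mul]; positivity
  · simp only [map_smul, smul_eq_mul]; nlinarith
  · simp only [map_smul, smul_eq_mul, abs_mul, abs_of_pos hc]; nlinarith

namespace PolyHalfPlane

/-- The orientation of the boundary which makes it run in the direction `u`. -/
def orient (H : PolyHalfPlane) (u : Plane) : ℤˣ := if 0 < H.fx u then 1 else -1

lemma side_ξ_orient (H : PolyHalfPlane) (p u : Plane) :
    (H.side p (H.orient u)).ξ u = |H.fx u| := by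
  rw [side_ξ, orient]
  split_ifs with h
  · simp [abs_of_pos h]
  · simp [abs_of_nonpos (not_lt.1 h)]

lemma tang_orient (H : PolyHalfPlane) {p u : Plane} (hu : ‖u‖ = 1)
    (h : (H.side p (H.orient u)).y u = 0) : (H.side p (H.orient u)).Tang u := by
  refine ⟨h, ?_⟩
  have := (H.side p (H.orient u)).ξ_ne_zero hu h
  rw [side_ξ_orient] at this ⊢
  exact lt_of_le_of_ne (abs_nonneg _) this.symm

/-- A half plane that contains points accumulating at `p` in the direction `u` either contains a
cone around `u` or has the direction `u` as a tangent at `p`. -/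
lemma free_or_tang (H : PolyHalfPlane) {p u : Plane} (hu : ‖u‖ = 1) (hp : 0 ≤ H.lev p)
    (hf : ¬ ∀ᶠ w in horn u, H.lev (p + w) < 0) :
    (∀ᶠ w in horn u, 0 < H.lev (p + w)) ∨
      (H.lev p = 0 ∧ (H.side p (H.orient u)).Tang u) := by
  rcases hp.lt_or_eq with h | h
  · left
    have hc : Continuous fun w => H.lev (p + w) :=
      H.continuous_lev.comp (continuous_const.add continuous_id)
    have := hc.tendsto 0
    rw [add_zero] at this
    exact horn_le_nhds hu (this.eventually (lt_mem_nhds h))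
  · simp only [H.lev_add h.symm (H.orient u)] at hf ⊢
    rcases lt_trichotomy ((H.side p (H.orient u)).y u) 0 with h1 | h1 | h1
    · exact .inl (Side.eventually_pos _ hu h1)
    · exact .inr ⟨h.symm, H.tang_orient hu h1⟩
    · exact absurd (Side.eventually_neg _ hu h1) hf

end PolyHalfPlane

/-- A stretch of a curve that is straight, run through with unit speed (kind `none`), or lies on a
part of the boundary of one of the half planes which is convex upward (kind `some l`). -/
def Piece {n : ℕ} (G : Fin n → PolyHalfPlane) (η : ℝ → Plane) (κ : Option (Fin n)) (s t : ℝ) :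
    Prop :=
  match κ with
  | none => dist (η s) (η t) = t - s
  | some l => (G l).poly.derivative.derivative ≠ 0 ∧ ∀ r ∈ Icc s t, (G l).lev (η r) = 0 ∧
      0 ≤ (G l).poly.derivative.derivative.eval ((G l).fx (η r))

/-- Among finitely many sides that touch the direction `u` from the same side of the line, one
bounds the smallest region. -/
lemma exists_dominating {ι : Type*} (S : ι → Side) {u : Plane} (hu : ‖u‖ = 1) (U : Finset ι)
    {i₀ : ι} (hi₀ : i₀ ∈ U) (hT : ∀ i ∈ U, (S i).Tang u)
    (hU : ∀ i ∈ U, 0 < (S i₀).y (rotJ u) * (S i).y (rotJ u)) :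
    ∃ i ∈ U, ∀ j ∈ U, Side.Dom u (S i) (S j) := by
  refine exists_least (fun i j => Side.Dom u (S i) (S j)) U ⟨i₀, hi₀⟩ ?_
    fun i _ j _ k _ h h' => h.trans h'
  intro i hi j hj
  refine Side.Dom.total hu (hT i hi) (hT j hj) ?_
  have h1 := hU i hi
  have h2 := hU j hj
  have h3 : 0 < (S i₀).y (rotJ u) ^ 2 * ((S i).y (rotJ u) * (S j).y (rotJ u)) := by
    nlinarith [mul_pos h1 h2]
  exact (pos_iff_pos_of_mul_pos h3).1
    (lt_of_le_of_ne (sq_nonneg _) fun h => by rw [← h, zero_mul] at h3; exact h3.false)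

/-! ### Taut curves near their starting point -/

namespace Taut

variable {n : ℕ} {G : Fin n → PolyHalfPlane} {η : ℝ → Plane} {a b : ℝ}

/-- If no later point is visible from `η a`, then the curve leaves `η a` in some direction. -/
lemma exists_tendsto_horn (h : Taut (interHalfPlanes G) η a b) (hab : a < b)
    (hvis : ∀ s ∈ Ioc a b, ¬ segment ℝ (η a) (η s) ⊆ interHalfPlanes G) :
    ∃ u : Plane, ‖u‖ = 1 ∧ Tendsto (fun s => η s - η a) (𝓝[>] a) (horn u) := by
  set p := η a with hp
  have hpX : ∀ l, 0 ≤ (G l).lev p := mem_interHalfPlanes.1 (h.mem a ⟨le_rfl, hab.le⟩)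
  have hcont : Tendsto (fun s => η s - p) (𝓝[>] a) (𝓝 0) := by
    have h1 : ContinuousWithinAt η (Icc a b) a := h.continuousOn a ⟨le_rfl, hab.le⟩
    have h2 : Tendsto η (𝓝[>] a) (𝓝 p) := by
      refine h1.tendsto.mono_left ?_
      rw [← nhdsWithin_Ioc_eq_nhdsGT hab]
      exact nhdsWithin_mono _ Ioc_subset_Icc_self
    simpa using h2.sub_const p
  have hev : ∀ᶠ s in 𝓝[>] a, s ∈ Ioc a b := Ioc_mem_nhdsGT hab
  have hK := fun l : Fin n => ((G l).side p 1).quad_bound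
  choose K hK0 hK using hK
  refine exists_direction (fun l : {l : Fin n // (G l).lev p = 0} => (G l).side p 1)
    (fun l => K l) hab ?_ hcont ?_ ?_
  · exact (h.continuousOn.mono Ioo_subset_Icc_self).sub continuousOn_const
  · filter_upwards [hev] with s hs h0
    have := h.injOn ⟨hs.1.le, hs.2⟩ ⟨le_rfl, hab.le⟩ (sub_eq_zero.1 h0)
    exact hs.1.ne' this
  · have hin : ∀ l, 0 < (G l).lev p → ∀ᶠ w in 𝓝 (0 : Plane), 0 < (G l).lev (p + w) := by
      intro l hl
      have hc : Continuous fun w => (G l).lev (p + w) :=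
        (G l).continuous_lev.comp (continuous_const.add continuous_id)
      have := hc.tendsto 0
      rw [add_zero] at this
      exact this.eventually (lt_mem_nhds hl)
    -- A half plane whose boundary misses `p` contains a ball around `p`, so only one with boundary
    -- through `p` can be violated on a short segment.
    have hball : ∀ᶠ w in 𝓝 (0 : Plane), ∀ l, 0 < (G l).lev p → 0 < (G l).lev (p + w) := by
      rw [eventually_all]
      intro l
      by_cases hl : 0 < (G l).lev p
      · exact (hin l hl).mono fun w hw _ => hw
      · exact Eventually.of_forall fun w h' => absurd h' hl
    obtain ⟨r, hr, hball⟩ := Metric.eventually_nhds_iff.1 hball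
    have hξ : ∀ᶠ w in 𝓝 (0 : Plane), ∀ l : Fin n, |((G l).side p 1).ξ w| < 1 := by
      rw [eventually_all]
      intro l
      have hc : Continuous fun w => |((G l).side p 1).ξ w| := by fun_prop
      have := hc.tendsto 0
      simp only [map_zero, abs_zero] at this
      exact this.eventually (gt_mem_nhds one_pos)
    filter_upwards [hev, hcont.eventually hξ, hcont.eventually (Metric.ball_mem_nhds 0 hr)]
      with s hs h1 h2
    have h3 := hvis s hs
    rw [not_subset] at h3
    obtain ⟨q, hq, hqX⟩ := h3
    rw [segment_eq_image_lineMap] at hq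
    obtain ⟨c, hc, rfl⟩ := hq
    rw [AffineMap.lineMap_apply_module', mem_interHalfPlanes, add_comm] at hqX
    push Not at hqX
    obtain ⟨l, hl⟩ := hqX
    have hl0 : (G l).lev p = 0 := by
      by_contra hne
      have := hball (y := c • (η s - p)) (by
        rw [dist_zero_right, norm_smul, Real.norm_eq_abs, abs_of_nonneg hc.1]
        exact (mul_le_of_le_one_left (norm_nonneg _) hc.2).trans_lt (by simpa using h2)) l
        (lt_of_le_of_ne (hpX l) (Ne.symm hne))
      linarith
    refine ⟨⟨l, hl0⟩, ?_⟩
    rw [(G l).lev_add hl0 1] at hl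
    have h4 : 0 ≤ ((G l).side p 1).lev (η s - p) := by
      rw [← (G l).lev_add hl0 1, add_sub_cancel]
      exact mem_interHalfPlanes.1 (h.mem s ⟨hs.1.le, hs.2⟩) l
    exact ((G l).side p 1).thin_of_violated (hK0 l) (hK l) (h1 l).le h4 hc.1 hc.2 hl

/-- Near its starting point a taut curve is straight or runs along a boundary arc. -/
theorem exists_piece_right (h : Taut (interHalfPlanes G) η a b) (hab : a < b) :
    ∃ t ∈ Ioc a b, ∃ κ, Piece G η κ a t := by
  by_cases hvis : ∃ s ∈ Ioc a b, segment ℝ (η a) (η s) ⊆ interHalfPlanes G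
  · obtain ⟨s, hs, hseg⟩ := hvis
    exact ⟨s, hs, none, h.geo a ⟨le_rfl, hab.le⟩ s ⟨hs.1.le, hs.2⟩ hs.1.le hseg⟩
  push Not at hvis
  obtain ⟨u, hu, hw⟩ := h.exists_tendsto_horn hab hvis
  set p := η a with hp
  set w : ℝ → Plane := fun s => η s - p with hwdef
  have hpw : ∀ s, p + w s = η s := fun s => by simp [hwdef]
  have hpX : ∀ l, 0 ≤ (G l).lev p := mem_interHalfPlanes.1 (h.mem a ⟨le_rfl, hab.le⟩)
  have hev : ∀ᶠ s in 𝓝[>] a, s ∈ Ioc a b := Ioc_mem_nhdsGT hab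
  set S : Fin n → Side := fun l => (G l).side p ((G l).orient u) with hS
  have hlev : ∀ l, (G l).lev p = 0 → ∀ v, (G l).lev (p + v) = (S l).lev v :=
    fun l hl v => (G l).lev_add hl _ v
  have hkind : ∀ l, (∀ᶠ v in horn u, 0 < (G l).lev (p + v)) ∨
      ((G l).lev p = 0 ∧ (S l).Tang u) := by
    intro l
    refine (G l).free_or_tang hu (hpX l) fun hneg => ?_
    obtain ⟨s, hs, hs'⟩ := (hev.and (hw.eventually hneg)).exists
    rw [hpw] at hs'
    exact absurd (mem_interHalfPlanes.1 (h.mem s ⟨hs.1.le, hs.2⟩) l) (not_le.2 hs')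
  -- radii of convexity or concavity
  have hrad : ∀ l, ∃ ρ > 0, ((S l).Obst → StrictConvexOn ℝ (Ico 0 ρ) (fun x => (S l).ψ.eval x) ∧
      ∀ x ∈ Ioo 0 ρ, 0 < (S l).ψ.eval x ∧ 0 < (S l).ψ.derivative.derivative.eval x) ∧
      (¬ (S l).Obst → ConcaveOn ℝ (Ico 0 ρ) (fun x => (S l).ψ.eval x)) := by
    intro l
    by_cases ho : (S l).Obst
    · obtain ⟨ρ, hρ, h1, h2⟩ := ho.exists_radius
      exact ⟨ρ, hρ, fun _ => ⟨h1, h2⟩, fun hn => absurd ho hn⟩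
    · obtain ⟨ρ, hρ, h1⟩ := Side.exists_concave_radius ho
      exact ⟨ρ, hρ, fun hn => absurd hn ho, fun _ => h1⟩
  choose ρ hρ0 hρ1 hρ2 using hrad
  set Free : Fin n → Prop := fun l => ∀ᶠ v in horn u, 0 < (G l).lev (p + v) with hFree
  have htang : ∀ l, ¬ Free l → (G l).lev p = 0 ∧ (S l).Tang u :=
    fun l hl => (hkind l).resolve_left hl
  have hall : ∀ᶠ v in horn u, ∀ l, (Free l → 0 < (G l).lev (p + v)) ∧
      (¬ Free l → (S l).ξ v ∈ Ioo 0 (ρ l)) := by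
    rw [eventually_all]
    intro l
    by_cases hl : Free l
    · exact hl.mono fun v hv => ⟨fun _ => hv, fun h' => absurd hl h'⟩
    · exact ((tendsto_clm_horn_pos hu (htang l hl).2.2).eventually (Ioo_mem_nhdsGT (hρ0 l))).mono
        fun v hv => ⟨fun h' => absurd h' hl, fun _ => hv⟩
  have hmemX : ∀ s ∈ Icc a b, ∀ l, 0 ≤ (G l).lev (p + w s) := fun s hs l => by
    rw [hpw]; exact mem_interHalfPlanes.1 (h.mem s hs) l
  -- the obstructing sides
  have hviol : ∀ᶠ s in 𝓝[>] a, ∃ l, ¬ Free l ∧ (S l).Obst ∧ 0 < (S l).y (w s) := by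
    obtain ⟨δ₀, hδ₀, hcone₀⟩ := exists_coneSet hall
    filter_upwards [hev, hw.eventually (coneSet_mem_horn hδ₀)] with s hs hcs
    have h3 := hvis s hs
    rw [not_subset] at h3
    obtain ⟨q, hq, hqX⟩ := h3
    rw [segment_eq_image_lineMap] at hq
    obtain ⟨c, hc, rfl⟩ := hq
    rw [AffineMap.lineMap_apply_module', mem_interHalfPlanes, add_comm] at hqX
    push Not at hqX
    obtain ⟨l, hl⟩ := hqX
    change (G l).lev (p + c • w s) < 0 at hl
    have hc0 : 0 < c := lt_of_le_of_ne hc.1 fun h0 => by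
      rw [← h0, zero_smul, add_zero] at hl
      exact absurd (hpX l) (not_le.2 hl)
    have h4 := hcone₀ (smul_mem_coneSet hcs hc0 hc.2) l
    have hnf : ¬ Free l := fun hf => absurd (h4.1 hf) (not_lt.2 hl.le)
    have h6 := h4.2 hnf
    have h7 := hmemX s ⟨hs.1.le, hs.2⟩ l
    have h8 := (hcone₀ hcs l).2 hnf
    rw [hlev l (htang l hnf).1] at hl h7
    refine ⟨l, hnf, ?_⟩
    -- For an obstructing side `ψ` is positive, so a violation forces `y > 0`. A side that is not
    -- obstructing is concave here, and concavity excludes a violation between the origin and `w s`.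
    by_cases ho : (S l).Obst
    · refine ⟨ho, ?_⟩
      have := ((hρ1 l ho).2 _ h6).1
      unfold Side.lev at hl
      simp only [map_smul, smul_eq_mul] at hl this
      have h9 : 0 < c * (S l).y (w s) := by linarith
      exact (pos_iff_pos_of_mul_pos h9).1 hc0
    · exfalso
      have := Side.concave_level (hρ2 l ho) (w := w s) (w' := 0) ⟨h8.1.le, h8.2⟩
        ⟨by simp, by simpa using hρ0 l⟩ h7 (by simp [Side.lev, (S l).ψ_zero]) hc.1
        (sub_nonneg.2 hc.2) (by ring)
      rw [smul_zero, add_zero] at this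
      linarith
  -- There are finitely many sides, so one of them obstructs for arbitrarily small parameters.
  obtain ⟨l₀, hl₀⟩ : ∃ l, ∃ᶠ s in 𝓝[>] a, ¬ Free l ∧ (S l).Obst ∧ 0 < (S l).y (w s) := by
    by_contra hcon
    have hcon : ∀ᶠ s in 𝓝[>] a, ∀ l, ¬ (¬ Free l ∧ (S l).Obst ∧ 0 < (S l).y (w s)) :=
      eventually_all.2 fun l => not_frequently.1 fun hl => hcon ⟨l, hl⟩
    obtain ⟨s, ⟨l, hl⟩, hs⟩ := (hviol.and hcon).exists
    exact hs l hl
  obtain ⟨hnf₀, ho₀⟩ : ¬ Free l₀ ∧ (S l₀).Obst := by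
    obtain ⟨s, hs⟩ := hl₀.exists
    exact ⟨hs.1, hs.2.1⟩
  have hT₀ := (htang l₀ hnf₀).2
  have hy₀ := (S l₀).y_rotJ_ne_zero hu hT₀.1
  have hwc : ContinuousOn w (Icc a b) := h.continuousOn.sub continuousOn_const
  have hypos : ∀ᶠ s in 𝓝[>] a, 0 < (S l₀).y (w s) := by
    refine eventually_pos_of_frequently hab ?_ ?_ (hl₀.mono fun s hs => hs.2.2)
    · exact (S l₀).y.continuous.comp_continuousOn (hwc.mono Ioo_subset_Icc_self)
    -- The functionals `y` of all tangent sides are proportional, so a zero of one is a zero of all;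
    -- but some obstructing side has `y > 0`.
    · filter_upwards [hviol] with s hs h0
      obtain ⟨l, hl, -, hl'⟩ := hs
      obtain ⟨-, -, -, -, hc⟩ := Side.exists_coeffs hu hT₀ (htang l hl).2
      rw [hc, h0, mul_zero] at hl'
      exact hl'.false
  classical
  -- The obstructing sides that lie on the same side of the tangent as `l₀`; these are comparable by
  -- `Dom`.
  set U : Finset (Fin n) := Finset.univ.filter fun l => ¬ Free l ∧ (S l).Obst ∧
    0 < (S l₀).y (rotJ u) * (S l).y (rotJ u) with hUdef
  have hUmem : ∀ l, l ∈ U ↔ ¬ Free l ∧ (S l).Obst ∧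
    0 < (S l₀).y (rotJ u) * (S l).y (rotJ u) := fun l => by simp [hUdef]
  obtain ⟨i, hiU, hdom⟩ := exists_dominating S hu U (i₀ := l₀)
    ((hUmem _).2 ⟨hnf₀, ho₀, mul_self_pos.2 hy₀⟩) (fun l hl => (htang l ((hUmem l).1 hl).1).2)
    (fun l hl => ((hUmem l).1 hl).2.2)
  obtain ⟨hnfi, hoi, -⟩ := (hUmem i).1 hiU
  have hi0 := (htang i hnfi).1
  have hdom' : ∀ᶠ v in horn u, ∀ j, j ∈ U → 0 < (S i).lev v → 0 < (S j).lev v := by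
    rw [eventually_all]
    intro j
    by_cases hj : j ∈ U
    · obtain ⟨c, hc, hc'⟩ := hdom j hj
      filter_upwards [hc'] with v hv _ hv'
      exact (mul_pos hc hv').trans_le (hv hv'.le)
    · exact Eventually.of_forall fun v h' => absurd h' hj
  obtain ⟨δ, hδ, hcone⟩ := exists_coneSet (hall.and hdom')
  obtain ⟨c, hac, hc⟩ := mem_nhdsGT_iff_exists_Ioc_subset.1
    ((hev.and (hw.eventually (coneSet_mem_horn hδ))).and hypos)
  have hac : a < c := hac
  have hcb : c ≤ b := (hc ⟨hac, le_rfl⟩).1.1.2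
  -- on the open set `W` only sides with convex regions matter
  set W : Set Plane := coneSet u δ ∩ ({v | 0 < (S l₀).y v} ∩ {v | 0 < (S i).lev v}) with hW
  have hWo : IsOpen W := by
    have c1 : Continuous fun v => (S l₀).y v := (S l₀).y.continuous
    have c2 : Continuous fun v => (S i).lev v := by unfold Side.lev; fun_prop
    exact (isOpen_coneSet u δ).inter ((isOpen_lt continuous_const c1).inter
      (isOpen_lt continuous_const c2))
  have hWlev : ∀ v ∈ W, ∀ l, 0 < (G l).lev (p + v) ∨ (¬ Free l ∧ ¬ (S l).Obst ∧
      (S l).ξ v ∈ Ioo 0 (ρ l)) := by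
    rintro v ⟨hv1, hv2, hv3⟩ l
    obtain ⟨h4, h5⟩ := hcone hv1
    by_cases hf : Free l
    · exact .inl ((h4 l).1 hf)
    by_cases ho : (S l).Obst
    swap
    · exact .inr ⟨hf, ho, (h4 l).2 hf⟩
    left
    rw [hlev l (htang l hf).1]
    by_cases hU : l ∈ U
    · exact h5 l hU hv3
    -- An obstructing side oriented oppositely to `l₀` has `y ≤ 0` on `W`, while its `ψ` is
    -- positive, so its level is positive.
    · have hneg : ¬ 0 < (S l₀).y (rotJ u) * (S l).y (rotJ u) := fun h' =>
        hU ((hUmem l).2 ⟨hf, ho, h'⟩)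
      obtain ⟨-, -, -, -, hcy⟩ := Side.exists_coeffs hu hT₀ (htang l hf).2
      have h6 : (S l).y (rotJ u) / (S l₀).y (rotJ u) ≤ 0 := by
        have h9 : (S l).y (rotJ u) / (S l₀).y (rotJ u)
            = (S l₀).y (rotJ u) * (S l).y (rotJ u) / (S l₀).y (rotJ u) ^ 2 := by field_simp
        rw [h9]
        exact div_nonpos_of_nonpos_of_nonneg (not_lt.1 hneg) (sq_nonneg _)
      have h7 := ((hρ1 l ho).2 _ ((h4 l).2 hf)).1
      have h8 := hcy v
      unfold Side.lev
      have hv2 : 0 < (S l₀).y v := hv2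
      nlinarith
  -- While the curve is strictly inside the region of the dominating side, a short chord can only be
  -- blocked by concave sides, which do not block it. Nearby points therefore see each other.
  have hstraight : ∀ α β, a ≤ α → α < β → β ≤ c → (∀ s ∈ Ioo α β, 0 < (S i).lev (w s)) →
      dist (η α) (η β) = β - α := by
    intro α β hα hαβ hβ hpos
    refine h.straight_of_locally hα hαβ (hβ.trans hcb) fun r hr => ?_
    have hrI : r ∈ Ioc a c := ⟨hα.trans_lt hr.1, hr.2.le.trans hβ⟩
    obtain ⟨⟨hr1, hr2⟩, hr3⟩ := hc hrI
    have hrW : w r ∈ W := ⟨hr2, hr3, hpos r hr⟩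
    obtain ⟨ε, hε, hball⟩ := Metric.isOpen_iff.1 hWo _ hrW
    have hnear : ∀ r' ∈ Ioo (r - ε) (r + ε), r' ∈ Icc a b → w r' ∈ Metric.ball (w r) ε := by
      intro r' hr' hr'I
      rw [Metric.mem_ball]
      have := h.lip r' hr'I r ⟨hr1.1.le, hr1.2⟩
      have h9 : dist (w r') (w r) = dist (η r') (η r) := by simp [hwdef]
      rw [h9]
      exact this.trans_lt (abs_lt.2 ⟨by linarith [hr'.1], by linarith [hr'.2]⟩)
    refine ⟨ε, hε, fun r₁ h₁ r₂ h₂ h₁I h₂I => ?_⟩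
    rintro q ⟨x, y, hx, hy, hxy, rfl⟩
    have hw1 := hnear r₁ h₁ h₁I
    have hw2 := hnear r₂ h₂ h₂I
    have hq : x • w r₁ + y • w r₂ ∈ Metric.ball (w r) ε :=
      (convex_ball (w r) ε) hw1 hw2 hx hy hxy
    have hqe : x • η r₁ + y • η r₂ = p + (x • w r₁ + y • w r₂) := by
      have : p = x • p + y • p := by rw [← add_smul, hxy, one_smul]
      conv_rhs => rw [this]
      simp only [hwdef, smul_sub]; abel
    rw [hqe, mem_interHalfPlanes]
    intro l
    rcases hWlev _ (hball hq) l with h9 | ⟨h9, h10, h11⟩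
    · exact h9.le
    · have k1 := ((hcone (hball hw1).1).1 l).2 h9
      have k2 := ((hcone (hball hw2).1).1 l).2 h9
      have m1 := hmemX r₁ h₁I l
      have m2 := hmemX r₂ h₂I l
      rw [hlev l (htang l h9).1] at m1 m2 ⊢
      exact Side.concave_level (hρ2 l h10) ⟨k1.1.le, k1.2⟩ ⟨k2.1.le, k2.2⟩ m1 m2 hx hy hxy
  have hw0 : w a = 0 := by simp [hwdef, hp]
  have hξI : ∀ s ∈ Icc a c, (S i).ξ (w s) ∈ Ico 0 (ρ i) := by
    intro s hs
    rcases hs.1.eq_or_lt with h9 | h9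
    · rw [← h9, hw0, map_zero]; exact ⟨le_rfl, hρ0 i⟩
    · have := ((hcone (hc ⟨h9, hs.2⟩).1.2).1 i).2 hnfi
      exact ⟨this.1.le, this.2⟩
  obtain ⟨hconv, hconv'⟩ := hρ1 i hoi
  -- Between two contacts the curve would be a chord of a strictly convex graph. The midpoint of
  -- such a chord is strictly above the graph, hence outside the region.
  have hbump : ∀ α β, a ≤ α → α < β → β ≤ c → (S i).lev (w α) = 0 → (S i).lev (w β) = 0 →
      ¬ ∀ x ∈ Ioo α β, 0 < (S i).lev (w x) := by
    intro α β hα hαβ hβ h1 h2 hpos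
    have hd := hstraight α β hα hαβ hβ hpos
    obtain ⟨v, hv, hv'⟩ := h.affine hα hαβ (hβ.trans hcb) hd
    have hm := hpos ((α + β) / 2) ⟨by linarith, by linarith⟩
    have e1 := hv' ((α + β) / 2) ⟨by linarith, by linarith⟩
    have e2 := hv' β ⟨hαβ.le, le_rfl⟩
    have e3 : w ((α + β) / 2) = (1 / 2 : ℝ) • w α + (1 / 2 : ℝ) • w β := by
      simp only [hwdef, e1, e2]; module
    have hne : (S i).ξ (w α) ≠ (S i).ξ (w β) := by
      intro he
      unfold Side.lev at h1 h2
      have h3 : (S i).y (w α) = (S i).y (w β) := by rw [he] at h1; linarith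
      have h4 : w α - w β = 0 := (S i).inj _ (by rw [map_sub, he, sub_self])
        (by rw [map_sub, h3, sub_self])
      have h5 : η α = η β := by simpa [hwdef, sub_eq_zero] using h4
      exact hαβ.ne (h.injOn ⟨hα, hαβ.le.trans (hβ.trans hcb)⟩ ⟨hα.trans hαβ.le, hβ.trans hcb⟩ h5)
    have := hconv.2 (hξI α ⟨hα, hαβ.le.trans hβ⟩) (hξI β ⟨hα.trans hαβ.le, hβ⟩) hne
      (show (0 : ℝ) < 1 / 2 by norm_num) (show (0 : ℝ) < 1 / 2 by norm_num) (by norm_num)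
    rw [e3] at hm
    unfold Side.lev at h1 h2 hm
    simp only [map_add, map_smul, smul_eq_mul] at this hm
    linarith
  have hgc : ContinuousOn (fun s => (S i).lev (w s)) (Icc a c) := by
    have c2 : Continuous fun v => (S i).lev v := by unfold Side.lev; fun_prop
    exact c2.comp_continuousOn (hwc.mono (Icc_subset_Icc_right hcb))
  rcases zero_or_pos_of_no_bump hgc (by simp [hw0, Side.lev, (S i).ψ_zero])
    (fun s hs => by rw [← hlev i hi0]; exact hmemX s ⟨hs.1, hs.2.trans hcb⟩ i) hbump with
    ⟨t, ht, hz⟩ | hpos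
  · refine ⟨t, ⟨ht.1, ht.2.trans hcb⟩, some i, ?_, fun r hr => ⟨?_, ?_⟩⟩
    · intro h0
      have := (hconv' (ρ i / 2) ⟨by linarith [hρ0 i], by linarith [hρ0 i]⟩).2
      rw [hS, PolyHalfPlane.side_deriv2, h0, eval_zero] at this
      exact this.false
    · rw [← hpw r, hlev i hi0]; exact hz r hr
    -- Strict positivity of the second derivative is known for `x > 0`; at `x = 0` only the
    -- inequality survives, by continuity.
    · have hnn : ∀ x ∈ Ico 0 (ρ i), 0 ≤ (S i).ψ.derivative.derivative.eval x := by
        intro x hx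
        rcases hx.1.eq_or_lt with h9 | h9
        · rw [← h9]
          refine ge_of_tendsto (((S i).ψ.derivative.derivative.continuous.tendsto 0).mono_left
            (nhdsWithin_le_nhds (s := Ioi 0))) ?_
          filter_upwards [Ioo_mem_nhdsGT (hρ0 i)] with y hy using (hconv' y hy).2.le
        · exact (hconv' x ⟨h9, hx.2⟩).2.le
      have := hnn _ (hξI r ⟨hr.1, hr.2.trans ht.2⟩)
      rwa [hS, PolyHalfPlane.side_deriv2, PolyHalfPlane.side_ξ, ← mul_assoc,
        PolyHalfPlane.unit_sq_real, one_mul, ← map_add, hpw] at this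
  · refine ⟨c, ⟨hac, hcb⟩, none, hstraight a c le_rfl hac le_rfl fun s hs => hpos s ⟨hs.1, hs.2.le⟩⟩

end Taut

/-! ### Chains of pieces -/

/-- If a property of intervals holds locally on both sides of every point, then a chain of
intervals with this property, without two consecutive ones of equal kind, leads from `a` to `b`. -/
lemma exists_chain {ι : Type*} [Inhabited ι] (P : ι → ℝ → ℝ → Prop) {a b : ℝ} (hab : a < b)
    (right : ∀ s ∈ Ico a b, ∃ t ∈ Ioc s b, ∃ k, P k s t)
    (left : ∀ t ∈ Ioc a b, ∃ s ∈ Ico a t, ∃ k, P k s t)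
    (hered : ∀ k s t s' t', a ≤ s → s ≤ s' → s' < t' → t' ≤ t → t ≤ b → P k s t → P k s' t')
    (merge : ∀ k s t u, a ≤ s → s < t → t < u → u ≤ b → P k s t → P k t u → P k s u) :
    ∃ (N : ℕ) (τ : ℕ → ℝ) (κ : ℕ → ι), 0 < N ∧ τ 0 = a ∧ τ N = b ∧
      (∀ i < N, τ i < τ (i + 1) ∧ P (κ i) (τ i) (τ (i + 1))) ∧
      ∀ i, i + 1 < N → κ i ≠ κ (i + 1) := by
  set Ch : ℕ → ℝ → Prop := fun N t => ∃ (τ : ℕ → ℝ) (κ : ℕ → ι), τ 0 = a ∧ τ N = t ∧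
    ∀ i < N, τ i < τ (i + 1) ∧ P (κ i) (τ i) (τ (i + 1)) with hCh
  have snoc : ∀ N s t k, Ch N s → s < t → P k s t → Ch (N + 1) t := by
    rintro N s t k ⟨τ, κ, h0, hN, h⟩ hst hP
    refine ⟨fun i => if i ≤ N then τ i else t, fun i => if i < N then κ i else k, by simp [h0],
      by simp, fun i hi => ?_⟩
    rcases (Nat.lt_succ_iff.1 hi).eq_or_lt with rfl | hlt
    · simp [hN, hst, hP]
    · simp [hlt, hlt.le, Nat.succ_le_iff.2 hlt]
      exact h i hlt
  -- The parameters reachable by a finite chain. The hypothesis `left` shows that the supremum is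
  -- attained, and `right` that it cannot be less than `b`.
  set R : Set ℝ := {t | t ∈ Icc a b ∧ ∃ N, Ch N t} with hR
  have haR : a ∈ R := ⟨⟨le_rfl, hab.le⟩, 0, fun _ => a, fun _ => default, rfl, rfl, by simp⟩
  have hbdd : BddAbove R := ⟨b, fun t ht => ht.1.2⟩
  set T := sSup R with hT
  have haT : a ≤ T := le_csSup hbdd haR
  have hTb : T ≤ b := csSup_le ⟨a, haR⟩ fun t ht => ht.1.2
  have hTR : T ∈ R := by
    rcases haT.eq_or_lt with h | h
    · rwa [← h]
    obtain ⟨s, hs, k, hk⟩ := left T ⟨h, hTb⟩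
    obtain ⟨t, ht, hst⟩ := exists_lt_of_lt_csSup ⟨a, haR⟩ hs.2
    have htT : t ≤ T := le_csSup hbdd ht
    rcases htT.eq_or_lt with h' | h'
    · rwa [← h']
    obtain ⟨N, hN⟩ := ht.2
    exact ⟨⟨haT, hTb⟩, N + 1, snoc N t T k hN h' (hered k s T t T hs.1 hst.le h' le_rfl hTb hk)⟩
  have hTb' : T = b := by
    by_contra hne
    obtain ⟨t, ht, k, hk⟩ := right T ⟨haT, lt_of_le_of_ne hTb hne⟩
    obtain ⟨N, hN⟩ := hTR.2
    have : t ∈ R := ⟨⟨haT.trans ht.1.le, ht.2⟩, N + 1, snoc N T t k hN ht.1 hk⟩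
    exact not_le.2 ht.1 (le_csSup hbdd this)
  have hex : ∃ N, Ch N b := by rw [← hTb']; exact hTR.2
  classical
  -- A chain of minimal length has no consecutive equal kinds: otherwise `merge` would allow the
  -- break point `τ (i + 1)` to be deleted.
  obtain ⟨τ, κ, h0, hN, h⟩ := Nat.find_spec hex
  set N := Nat.find hex
  refine ⟨N, τ, κ, ?_, h0, hN, h, fun i hi heq => ?_⟩
  · rw [Nat.pos_iff_ne_zero]
    intro hz
    rw [hz, h0] at hN
    exact hab.ne hN
  have mono : ∀ j ≤ N, ∀ i ≤ j, τ i ≤ τ j := by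
    intro j hj i hij
    induction j, hij using Nat.le_induction with
    | base => exact le_rfl
    | succ m _ ih => exact (ih (by omega)).trans (h m (by omega)).1.le
  have hlt : N - 1 < N := by omega
  refine Nat.find_min hex hlt ⟨fun j => if j ≤ i then τ j else τ (j + 1),
    fun j => if j ≤ i then κ j else κ (j + 1), by simp [h0], ?_, fun j hj => ?_⟩
  · have : ¬ N - 1 ≤ i := by omega
    simp only [this, if_false]
    rw [Nat.sub_add_cancel (by omega), hN]
  · rcases lt_trichotomy j i with hji | rfl | hji
    · simp only [hji.le, if_true, Nat.succ_le_iff.2 hji]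
      exact h j (by omega)
    · simp only [le_rfl, if_true, show ¬ j + 1 ≤ j by omega, if_false]
      have e1 := h j (by omega)
      have e2 := h (j + 1) (by omega)
      refine ⟨e1.1.trans e2.1, merge _ _ _ _ ?_ e1.1 e2.1 ?_ e1.2 (heq ▸ e2.2)⟩
      · rw [← h0]; exact mono j (by omega) 0 (Nat.zero_le _)
      · rw [← hN]; exact mono N le_rfl _ (by omega)
    · simp only [show ¬ j ≤ i by omega, show ¬ j + 1 ≤ i by omega, if_false]
      exact h (j + 1) (by omega)

/-! ### Short cuts at corners -/

namespace Side

/-- The direction `v` points strictly into the region. Its linear gain `-(y v)` outweighs the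
bending of `ψ`, which has an arbitrarily small Lipschitz constant near `0`. -/
lemma eventually_segment_of_neg (S : Side) {u v : Plane} (hu : ∀ᶠ ε : ℝ in 𝓝[>] 0, 0 ≤ S.lev (ε • u))
    (hv : S.y v < 0) :
    ∀ᶠ ε : ℝ in 𝓝[>] 0, ∀ x y : ℝ, 0 ≤ x → 0 ≤ y → x + y = 1 →
      0 ≤ S.lev (x • ε • u + y • ε • v) := by
  set D := |S.ξ u - S.ξ v| with hD
  have hD0 : 0 ≤ D := abs_nonneg _
  set M := |S.ξ u| + |S.ξ v| + 1 with hM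
  have hM0 : 0 < M := by positivity
  -- The gain available at weight `y` is `y * ε * (-(S.y v))`. Each of the two Lipschitz comparisons
  -- of `ψ` may use a quarter of it, and the value of `ψ` at `ε * S.ξ v` the remaining half.
  set κ := -(S.y v) / (4 * (D + 1)) with hκ
  have hκ0 : 0 < κ := div_pos (by linarith) (by positivity)
  obtain ⟨ρ, hρ, hlip⟩ := S.small_lip hκ0
  obtain ⟨ρ', hρ', hlip'⟩ := S.small_lip (ε := -(S.y v) / (2 * M)) (div_pos (by linarith) (by positivity))
  filter_upwards [hu, self_mem_nhdsWithin, Ioo_mem_nhdsGT (show 0 < ρ / M by positivity),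
    Ioo_mem_nhdsGT (show 0 < ρ' / M by positivity)] with ε h1 h2 h3 h4 x y hx hy hxy
  have hε : 0 < ε := h2
  have h3 : ε * M < ρ := (lt_div_iff₀ hM0).1 h3.2
  have h4 : ε * M < ρ' := (lt_div_iff₀ hM0).1 h4.2
  have bu : |ε * S.ξ u| ≤ ε * M := by
    rw [abs_mul, abs_of_pos hε]
    exact mul_le_mul_of_nonneg_left (by rw [hM]; linarith [abs_nonneg (S.ξ v)]) hε.le
  have bv : |ε * S.ξ v| ≤ ε * M := by
    rw [abs_mul, abs_of_pos hε]
    exact mul_le_mul_of_nonneg_left (by rw [hM]; linarith [abs_nonneg (S.ξ u)]) hε.le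
  have bw : |x * (ε * S.ξ u) + y * (ε * S.ξ v)| ≤ ε * M := by
    refine (abs_add_le _ _).trans ?_
    rw [abs_mul x, abs_mul y, abs_of_nonneg hx, abs_of_nonneg hy]
    nlinarith
  have e1 := hlip _ _ (bw.trans_lt h3) (bu.trans_lt h3)
  have e2 := hlip _ _ (bw.trans_lt h3) (bv.trans_lt h3)
  have e3 := hlip' (ε * S.ξ v) 0 (bv.trans_lt h4) (by simpa using hρ')
  have d1 : x * (ε * S.ξ u) + y * (ε * S.ξ v) - ε * S.ξ u = -(y * ε * (S.ξ u - S.ξ v)) := by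
    rw [show x = 1 - y by linarith]; ring
  have d2 : x * (ε * S.ξ u) + y * (ε * S.ξ v) - ε * S.ξ v = x * ε * (S.ξ u - S.ξ v) := by
    rw [show y = 1 - x by linarith]; ring
  rw [d1, abs_neg, abs_mul, abs_of_nonneg (by positivity : 0 ≤ y * ε), ← hD] at e1
  rw [d2, abs_mul, abs_of_nonneg (by positivity : 0 ≤ x * ε), ← hD] at e2
  rw [S.ψ_zero, sub_zero, sub_zero] at e3
  have hkD : κ * (D + 1) = -(S.y v) / 4 := by rw [hκ]; field_simp
  have hkM : -(S.y v) / (2 * M) * |ε * S.ξ v| ≤ ε * (-(S.y v) / 2) := by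
    calc -(S.y v) / (2 * M) * |ε * S.ξ v| ≤ -(S.y v) / (2 * M) * (ε * M) :=
          mul_le_mul_of_nonneg_left bv (div_pos (by linarith) (by positivity)).le
      _ = ε * (-(S.y v) / 2) := by field_simp
  unfold lev at h1 ⊢
  simp only [map_add, map_smul, smul_eq_mul] at h1 ⊢
  have f1 := (abs_le.1 e1).1
  have f2 := (abs_le.1 e2).1
  have f3 := (abs_le.1 (e3.trans hkM)).1
  set A := S.ψ.eval (x * (ε * S.ξ u) + y * (ε * S.ξ v))
  set B := S.ψ.eval (ε * S.ξ u)
  set E := S.ψ.eval (ε * S.ξ v)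
  have g0 : κ * D ≤ -(S.y v) / 4 := by rw [← hkD]; nlinarith
  have g1 : x * (κ * (y * ε * D)) ≤ y * ε * (-(S.y v) / 4) := by
    calc x * (κ * (y * ε * D)) = x * (y * ε * (κ * D)) := by ring
      _ ≤ 1 * (y * ε * (κ * D)) := mul_le_mul_of_nonneg_right (by linarith) (by positivity)
      _ ≤ y * ε * (-(S.y v) / 4) := by
        rw [one_mul]; exact mul_le_mul_of_nonneg_left g0 (by positivity)
  have g2 : y * (κ * (x * ε * D)) ≤ y * ε * (-(S.y v) / 4) := by
    calc y * (κ * (x * ε * D)) = x * (y * ε * (κ * D)) := by ring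
      _ ≤ 1 * (y * ε * (κ * D)) := mul_le_mul_of_nonneg_right (by linarith) (by positivity)
      _ ≤ y * ε * (-(S.y v) / 4) := by
        rw [one_mul]; exact mul_le_mul_of_nonneg_left g0 (by positivity)
  have f1' := mul_le_mul_of_nonneg_left f1 hx
  have f2' := mul_le_mul_of_nonneg_left f2 hy
  have f3' := mul_le_mul_of_nonneg_left f3 hy
  have h1' := mul_le_mul_of_nonneg_left h1 hx
  -- The value at the intermediate point is split with weights `x` and `y`, the first part being
  -- compared with the end at `u` and the second with the end at `v`.
  have hA : A = x * A + y * A := by rw [← add_mul, hxy, one_mul]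
  have : 0 ≤ x * A + y * A - (x * (ε * S.y u) + y * (ε * S.y v)) := by nlinarith
  linarith

lemma y_nonpos_of_ray (S : Side) {u : Plane} (hu : ‖u‖ = 1)
    (h : ∀ᶠ ε : ℝ in 𝓝[>] 0, 0 ≤ S.lev (ε • u)) : S.y u ≤ 0 := by
  by_contra! hpos
  have hray : Tendsto (fun ε : ℝ => ε • u) (𝓝[>] 0) (horn u) := by
    rw [tendsto_horn_iff]
    simp only [map_smul, cx_self hu, cy_self, smul_eq_mul, mul_one, mul_zero, zero_div]
    exact ⟨tendsto_id, tendsto_const_nhds⟩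
  obtain ⟨ε, h1, h2⟩ := (h.and (hray.eventually (S.eventually_neg hu hpos))).exists
  linarith

end Side

/-- This is what allows corners to be cut off. For a side through `p`, either ray may point strictly
inside, and then `Side.eventually_segment_of_neg` applies. If both are tangent, then `u = v` because
opposite rays are excluded, and the segment degenerates. -/
lemma eventually_segment_subset {n : ℕ} {G : Fin n → PolyHalfPlane} {p u v : Plane}
    (hu : ‖u‖ = 1) (hv : ‖v‖ = 1) (huv : u ≠ -v)
    (h1 : ∀ᶠ ε : ℝ in 𝓝[>] 0, p + ε • u ∈ interHalfPlanes G)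
    (h2 : ∀ᶠ ε : ℝ in 𝓝[>] 0, p + ε • v ∈ interHalfPlanes G) :
    ∀ᶠ ε : ℝ in 𝓝[>] 0, segment ℝ (p + ε • u) (p + ε • v) ⊆ interHalfPlanes G := by
  have hlim : ∀ v : Plane, Tendsto (fun ε : ℝ => ε • v) (𝓝[>] 0) (𝓝 0) := fun v => by
    have : Continuous fun ε : ℝ => ε • v := by fun_prop
    have := this.tendsto 0
    rw [zero_smul] at this
    exact this.mono_left nhdsWithin_le_nhds
  have hp : p ∈ interHalfPlanes G := by
    refine (isClosed_inter G).mem_of_tendsto ?_ h1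
    simpa using (hlim u).const_add p
  have key : ∀ᶠ ε : ℝ in 𝓝[>] 0, ∀ l, ∀ x y : ℝ, 0 ≤ x → 0 ≤ y → x + y = 1 →
      0 ≤ (G l).lev (p + (x • ε • u + y • ε • v)) := by
    rw [eventually_all]
    intro l
    have h1l : ∀ᶠ ε : ℝ in 𝓝[>] 0, 0 ≤ (G l).lev (p + ε • u) :=
      h1.mono fun ε hε => mem_interHalfPlanes.1 hε l
    have h2l : ∀ᶠ ε : ℝ in 𝓝[>] 0, 0 ≤ (G l).lev (p + ε • v) :=
      h2.mono fun ε hε => mem_interHalfPlanes.1 hε l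
    rcases (mem_interHalfPlanes.1 hp l).lt_or_eq with hl | hl
    · have hc : Continuous fun w => (G l).lev (p + w) :=
        (G l).continuous_lev.comp (continuous_const.add continuous_id)
      have := hc.tendsto 0
      rw [add_zero] at this
      obtain ⟨r, hr, hball⟩ := Metric.eventually_nhds_iff_ball.1 (this.eventually (lt_mem_nhds hl))
      filter_upwards [(hlim u).eventually (Metric.ball_mem_nhds 0 hr),
        (hlim v).eventually (Metric.ball_mem_nhds 0 hr)] with ε e1 e2 x y hx hy hxy
      exact (hball _ (convex_ball (0 : Plane) r e1 e2 hx hy hxy)).le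
    · have hlev := (G l).lev_add hl.symm 1
      simp only [hlev] at h1l h2l ⊢
      set S := (G l).side p 1
      rcases (S.y_nonpos_of_ray hv h2l).lt_or_eq with hv0 | hv0
      · exact S.eventually_segment_of_neg h1l hv0
      rcases (S.y_nonpos_of_ray hu h1l).lt_or_eq with hu0 | hu0
      · filter_upwards [S.eventually_segment_of_neg h2l hu0] with ε hε x y hx hy hxy
        rw [add_comm]
        exact hε y x hy hx (by linarith)
      · have hne := S.y_rotJ_ne_zero hu hu0
        have hdec := frame_decomp hu v
        have hcy : cy u v = 0 := by
          rw [hdec, map_add, map_smul, map_smul, hu0, smul_zero, zero_add, smul_eq_mul] at hv0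
          exact (mul_eq_zero.1 hv0).resolve_right hne
        rw [hcy, zero_smul, add_zero] at hdec
        have hcx : |cx u v| = 1 := by
          rw [hdec, norm_smul, hu, mul_one, Real.norm_eq_abs] at hv
          exact hv
        rcases abs_eq (zero_le_one) |>.1 hcx with h | h
        · rw [h, one_smul] at hdec
          filter_upwards [h1l] with ε hε x y hx hy hxy
          rw [hdec, ← add_smul, hxy, one_smul]
          exact hε
        · rw [h] at hdec
          exact absurd (by rw [hdec]; simp) huv
  filter_upwards [key] with ε hε
  rintro q ⟨x, y, hx, hy, hxy, rfl⟩
  have hqe : x • (p + ε • u) + y • (p + ε • v) = p + (x • ε • u + y • ε • v) := by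
    have : p = x • p + y • p := by rw [← add_smul, hxy, one_smul]
    conv_rhs => rw [this]
    simp only [smul_add]; abel
  rw [hqe, mem_interHalfPlanes]
  exact fun l => hε l x y hx hy hxy

/-! ### Chains of pieces of a taut curve -/

namespace Taut

variable {n : ℕ} {G : Fin n → PolyHalfPlane} {η : ℝ → Plane} {a b : ℝ}

lemma piece_mono (h : Taut (interHalfPlanes G) η a b) {κ : Option (Fin n)} {s t s' t' : ℝ}
    (has : a ≤ s) (hs : s ≤ s') (hst : s' ≤ t') (ht : t' ≤ t) (htb : t ≤ b)
    (hP : Piece G η κ s t) : Piece G η κ s' t' := by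
  cases κ with
  | none => exact h.dist_sub has hs hst ht htb hP
  | some l => exact ⟨hP.1, fun r hr => hP.2 r ⟨hs.trans hr.1, hr.2.trans ht⟩⟩

theorem exists_piece_left (h : Taut (interHalfPlanes G) η a b) (hab : a < b) :
    ∃ s ∈ Ico a b, ∃ κ, Piece G η κ s b := by
  obtain ⟨t, ht, κ, hκ⟩ := h.reverse.exists_piece_right (neg_lt_neg hab)
  refine ⟨-t, ⟨by linarith [ht.2], by linarith [ht.1]⟩, κ, ?_⟩
  cases κ with
  | none =>
    have hκ : dist (η (- -b)) (η (-t)) = t - -b := hκ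
    rw [neg_neg] at hκ
    change dist (η (-t)) (η b) = b - -t
    rw [dist_comm, hκ]; ring
  | some l =>
    refine ⟨hκ.1, fun r hr => ?_⟩
    have := hκ.2 (-r) ⟨by linarith [hr.2], by linarith [hr.1]⟩
    simpa only [neg_neg] using this

/-- Two consecutive straight stretches form one straight stretch. -/
lemma straight_merge (h : Taut (interHalfPlanes G) η a b) {s t u : ℝ} (has : a ≤ s) (hst : s < t)
    (htu : t < u) (hub : u ≤ b) (h1 : dist (η s) (η t) = t - s) (h2 : dist (η t) (η u) = u - t) :
    dist (η s) (η u) = u - s := by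
  obtain ⟨v, hv, hv'⟩ := h.affine has hst (htu.le.trans hub) h1
  obtain ⟨v₂, hv₂, hv₂'⟩ := h.affine (has.trans hst.le) htu hub h2
  have ht := hv' t ⟨hst.le, le_rfl⟩
  have e1 : ∀ ε : ℝ, 0 ≤ ε → ε ≤ t - s → η (t - ε) = η t + ε • (-v) := fun ε h0 hε => by
    rw [hv' (t - ε) ⟨by linarith, by linarith⟩, ht]; module
  have e2 : ∀ ε : ℝ, 0 ≤ ε → ε ≤ u - t → η (t + ε) = η t + ε • v₂ := fun ε h0 hε => by
    rw [hv₂' (t + ε) ⟨by linarith, by linarith⟩]; module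
  -- With different velocities the corner at `η t` can be cut off inside the set. Tautness then
  -- makes the chord from `t - ε` to `t + ε` of full length `2 * ε`, so `‖v + v₂‖ = 2`, and the
  -- parallelogram law gives `v = v₂`.
  have hvv : v = v₂ := by
    by_contra hne
    have hI1 : Ioo 0 (t - s) ∈ 𝓝[>] (0 : ℝ) := Ioo_mem_nhdsGT (by linarith)
    have hI2 : Ioo 0 (u - t) ∈ 𝓝[>] (0 : ℝ) := Ioo_mem_nhdsGT (by linarith)
    have hseg := eventually_segment_subset (G := G) (p := η t) (u := -v) (v := v₂)
      (by rw [norm_neg, hv]) hv₂ (fun he => hne (neg_injective he))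
      (by filter_upwards [hI1] with ε hε
          rw [← e1 ε hε.1.le hε.2.le]
          exact h.mem _ ⟨by linarith [hε.2], by linarith [hε.1]⟩)
      (by filter_upwards [hI2] with ε hε
          rw [← e2 ε hε.1.le hε.2.le]
          exact h.mem _ ⟨by linarith [hε.1], by linarith [hε.2]⟩)
    obtain ⟨ε, ⟨hε1, hε2⟩, hε3⟩ := ((eventually_mem_set.2 (inter_mem hI1 hI2)).and hseg).exists
    rw [← e1 ε hε1.1.le hε1.2.le, ← e2 ε hε2.1.le hε2.2.le] at hε3
    have hd := h.geo (t - ε) ⟨by linarith [hε1.2], by linarith [hε1.1]⟩ (t + ε)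
      ⟨by linarith [hε1.1], by linarith [hε2.2]⟩ (by linarith [hε1.1]) hε3
    rw [e1 ε hε1.1.le hε1.2.le, e2 ε hε2.1.le hε2.2.le, dist_add_left, dist_eq_norm, ← smul_sub,
      norm_smul, Real.norm_eq_abs, abs_of_pos hε1.1] at hd
    have hn : ‖-v - v₂‖ = 2 := by
      have h3 : ε * ‖-v - v₂‖ = ε * 2 := by rw [hd]; ring
      exact mul_left_cancel₀ hε1.1.ne' h3
    have hpar := parallelogram_law_with_norm ℝ v v₂
    rw [show -v - v₂ = -(v + v₂) by abel, norm_neg] at hn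
    rw [hn, hv, hv₂] at hpar
    have h4 : ‖v - v₂‖ = 0 := by nlinarith [norm_nonneg (v - v₂)]
    exact hne (sub_eq_zero.1 (norm_eq_zero.1 h4))
  have h5 : η u = η s + (u - s) • v := by
    rw [hv₂' u ⟨htu.le, le_rfl⟩, ht, ← hvv]; module
  rw [h5, dist_self_add_right, norm_smul, hv, mul_one, Real.norm_eq_abs, abs_of_pos (by linarith)]

/-- A taut curve is a finite chain of pieces of alternating kinds. -/
theorem exists_alternating (h : Taut (interHalfPlanes G) η a b) (hab : a < b) :
    ∃ (N : ℕ) (τ : ℕ → ℝ) (κ : ℕ → Option (Fin n)), 0 < N ∧ τ 0 = a ∧ τ N = b ∧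
      (∀ i < N, τ i < τ (i + 1) ∧ Piece G η (κ i) (τ i) (τ (i + 1))) ∧
      ∀ i, i + 1 < N → κ i ≠ κ (i + 1) := by
  refine exists_chain (Piece G η) hab (fun s hs => ?_) (fun t ht => ?_)
    (fun k s t s' t' h1 h2 h3 h4 h5 h6 => h.piece_mono h1 h2 h3.le h4 h5 h6) ?_
  · exact (h.mono hs.1 le_rfl).exists_piece_right hs.2
  · exact (h.mono le_rfl ht.2).exists_piece_left ht.1
  · intro k s t u h1 h2 h3 h4 h5 h6
    cases k with
    | none => exact h.straight_merge h1 h2 h3 h4 h5 h6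
    | some l =>
      refine ⟨h5.1, fun r hr => ?_⟩
      rcases le_total r t with hrt | hrt
      · exact h5.2 r ⟨hr.1, hrt⟩
      · exact h6.2 r ⟨hrt, hr.2⟩

end Taut

/-! ### Piecewise `C²` curves -/

namespace IsPiecewiseC2

variable {γ δ : ℝ → Plane} {a b c d : ℝ}

lemma mono (h : IsPiecewiseC2 γ a b) (hac : a ≤ c) (hcd : c ≤ d) (hdb : d ≤ b) :
    IsPiecewiseC2 γ c d := by
  obtain ⟨hab, hc, N, t, h0, hN, ht⟩ := h
  -- The old break points are clamped to `[c, d]`; pieces outside that interval collapse to single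
  -- points, where smoothness is trivial.
  refine ⟨hcd, hc.mono (Icc_subset_Icc hac hdb), N, fun i => max c (min d (t i)), ?_, ?_,
    fun i hi => ⟨?_, ?_⟩⟩
  · simp only [h0]; rw [min_eq_right (hac.trans hcd), max_eq_left hac]
  · simp only [hN]; rw [min_eq_left hdb, max_eq_right hcd]
  · exact max_le_max le_rfl (min_le_min le_rfl (ht i hi).1)
  · have hle := (ht i hi).1
    beta_reduce
    rcases lt_or_ge d (t i) with h1 | h1
    · rw [min_eq_left h1.le, min_eq_left (h1.le.trans hle), Icc_self]
      intro x hx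
      rw [mem_singleton_iff.1 hx]
      exact contDiffWithinAt_singleton
    rcases lt_or_ge (t (i + 1)) c with h2 | h2
    · rw [max_eq_left ((min_le_right _ _).trans h2.le),
        max_eq_left ((min_le_right _ _).trans (hle.trans h2.le)), Icc_self]
      intro x hx
      rw [mem_singleton_iff.1 hx]
      exact contDiffWithinAt_singleton
    refine (ht i hi).2.mono (Icc_subset_Icc ?_ ?_)
    · rw [min_eq_right h1]; exact le_max_right _ _
    · exact max_le h2 (min_le_right _ _)

lemma congr (h : IsPiecewiseC2 γ a b) (he : EqOn δ γ (Icc a b)) : IsPiecewiseC2 δ a b := by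
  obtain ⟨hab, hc, N, t, h0, hN, ht⟩ := h
  have mono : ∀ j ≤ N, ∀ i ≤ j, t i ≤ t j := by
    intro j hj i hij
    induction j, hij using Nat.le_induction with
    | base => exact le_rfl
    | succ m _ ih => exact (ih (by omega)).trans (ht m (by omega)).1
  refine ⟨hab, hc.congr he, N, t, h0, hN, fun i hi => ⟨(ht i hi).1, (ht i hi).2.congr ?_⟩⟩
  intro x hx
  refine he ⟨?_, ?_⟩
  · rw [← h0]; exact (mono i hi.le 0 (Nat.zero_le _)).trans hx.1
  · rw [← hN]; exact hx.2.trans (mono N le_rfl (i + 1) hi)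

lemma trans (h : IsPiecewiseC2 γ a b) (h' : IsPiecewiseC2 γ b c) : IsPiecewiseC2 γ a c := by
  obtain ⟨hab, hc, N, t, h0, hN, ht⟩ := h
  obtain ⟨hbc, hc', N', t', h0', hN', ht'⟩ := h'
  refine ⟨hab.trans hbc, ?_, N + N', fun i => if i ≤ N then t i else t' (i - N), by simp [h0], ?_,
    fun i hi => ?_⟩
  · rw [← Icc_union_Icc_eq_Icc hab hbc]
    exact hc.union_of_isClosed hc' isClosed_Icc isClosed_Icc
  · by_cases hz : N' = 0
    · subst hz; simp [hN, ← hN', h0']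
    · simp [hz, hN']
  · rcases lt_trichotomy i N with hlt | rfl | hgt
    · simp only [hlt.le, if_true, Nat.succ_le_iff.2 hlt]
      exact ht i hlt
    · simp only [le_rfl, if_true, show ¬ i + 1 ≤ i by omega, if_false, hN]
      have := ht' 0 (by omega)
      rw [h0'] at this
      simpa using this
    · simp only [show ¬ i ≤ N by omega, show ¬ i + 1 ≤ N by omega, if_false]
      have := ht' (i - N) (by omega)
      rwa [show i - N + 1 = i + 1 - N by omega] at this

lemma comp_add (h : IsPiecewiseC2 γ a b) (e : ℝ) :
    IsPiecewiseC2 (fun x => γ (x + e)) (a - e) (b - e) := by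
  obtain ⟨hab, hc, N, t, h0, hN, ht⟩ := h
  refine ⟨by linarith, ?_, N, fun i => t i - e, by simp [h0], by simp [hN], fun i hi => ⟨?_, ?_⟩⟩
  · refine hc.comp (by fun_prop) fun x hx => ⟨by linarith [hx.1], by linarith [hx.2]⟩
  · linarith [(ht i hi).1]
  · refine (ht i hi).2.comp (contDiff_id.add contDiff_const).contDiffOn fun x hx => ⟨?_, ?_⟩
    · show t i ≤ x + e
      linarith [hx.1]
    · show x + e ≤ t (i + 1)
      linarith [hx.2]

/-- On each compact piece the curve is locally, hence globally, Lipschitz. This makes lengths finite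
and arc length continuous. -/
lemma exists_lipschitz (h : IsPiecewiseC2 γ a b) : ∃ C : ℝ, 0 ≤ C ∧ ∀ x ∈ Icc a b, ∀ y ∈ Icc a b,
    x ≤ y → dist (γ x) (γ y) ≤ C * (y - x) := by
  obtain ⟨hab, hc, N, t, h0, hN, ht⟩ := h
  have key : ∀ i ≤ N, a ≤ t i ∧ ∃ C : ℝ, 0 ≤ C ∧ ∀ x ∈ Icc a (t i), ∀ y ∈ Icc a (t i),
      x ≤ y → dist (γ x) (γ y) ≤ C * (y - x) := by
    intro i hi
    induction i with
    | zero =>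
      refine ⟨h0.ge, 0, le_rfl, fun x hx y hy _ => ?_⟩
      rw [h0, Icc_self] at hx hy
      rw [mem_singleton_iff.1 hx, mem_singleton_iff.1 hy]; simp
    | succ i ih =>
      obtain ⟨hai, C, hC, hCl⟩ := ih (by omega)
      obtain ⟨hle, hsm⟩ := ht i (by omega)
      have hloc : LocallyLipschitzOn (Icc (t i) (t (i + 1))) γ := fun x hx =>
        ((hsm x hx).of_le (by norm_num)).exists_lipschitzOnWith (convex_Icc _ _)
      obtain ⟨K, hK⟩ := hloc.exists_lipschitzOnWith_of_compact isCompact_Icc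
      have hK' : ∀ x ∈ Icc (t i) (t (i + 1)), ∀ y ∈ Icc (t i) (t (i + 1)), x ≤ y →
          dist (γ x) (γ y) ≤ K * (y - x) := fun x hx y hy hxy => by
        have := hK.dist_le_mul x hx y hy
        rwa [Real.dist_eq, abs_of_nonpos (by linarith), neg_sub] at this
      refine ⟨hai.trans hle, max C K, le_max_of_le_left hC, fun x hx y hy hxy => ?_⟩
      have b1 : ∀ z : ℝ, 0 ≤ z → C * z ≤ max C K * z := fun z hz =>
        mul_le_mul_of_nonneg_right (le_max_left _ _) hz
      have b2 : ∀ z : ℝ, 0 ≤ z → (K : ℝ) * z ≤ max C K * z := fun z hz =>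
        mul_le_mul_of_nonneg_right (le_max_right _ _) hz
      rcases le_total y (t i) with hy' | hy'
      · exact (hCl x ⟨hx.1, hxy.trans hy'⟩ y ⟨hy.1, hy'⟩ hxy).trans (b1 _ (by linarith))
      rcases le_total (t i) x with hx' | hx'
      · exact (hK' x ⟨hx', hx.2⟩ y ⟨hy', hy.2⟩ hxy).trans (b2 _ (by linarith))
      · have e1 := hCl x ⟨hx.1, hx'⟩ (t i) ⟨hai, le_rfl⟩ hx'
        have e2 := hK' (t i) ⟨le_rfl, hle⟩ y ⟨hy', hy.2⟩ hy'
        have e3 := b1 (t i - x) (by linarith)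
        have e4 := b2 (y - t i) (by linarith)
        have e5 := dist_triangle (γ x) (γ (t i)) (γ y)
        have e6 : max C K * (y - x) = max C K * (t i - x) + max C K * (y - t i) := by ring
        linarith
  obtain ⟨-, C, hC, h⟩ := key N le_rfl
  rw [hN] at h
  exact ⟨C, hC, h⟩

end IsPiecewiseC2

lemma eVariationOn_le_of_lipschitz {γ : ℝ → Plane} {a b C : ℝ} (hC : 0 ≤ C)
    (h : ∀ x ∈ Icc a b, ∀ y ∈ Icc a b, x ≤ y → dist (γ x) (γ y) ≤ C * (y - x)) :
    eVariationOn γ (Icc a b) ≤ ENNReal.ofReal (C * (b - a)) := by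
  have hL : LipschitzOnWith C.toNNReal γ (Icc a b) := LipschitzOnWith.of_dist_le_mul
    fun x hx y hy => by
      rw [Real.coe_toNNReal _ hC, Real.dist_eq]
      rcases le_total x y with hxy | hxy
      · rw [abs_of_nonpos (by linarith), neg_sub]; exact h x hx y hy hxy
      · rw [abs_of_nonneg (by linarith), dist_comm]; exact h y hy x hx hxy
  have := hL.comp_eVariationOn_le (g := id) (s := Icc a b) (mapsTo_id _)
  rw [eVariationOn_id_Icc, Function.comp_id] at this
  rwa [ENNReal.ofReal_mul hC]

lemma eVariationOn_add {γ : ℝ → Plane} {a b c : ℝ} (hab : a ≤ b) (hbc : b ≤ c) :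
    eVariationOn γ (Icc a c) = eVariationOn γ (Icc a b) + eVariationOn γ (Icc b c) := by
  have := eVariationOn.Icc_add_Icc γ (s := univ) hab hbc (mem_univ _)
  simpa using this.symm

lemma IsPiecewiseC2.eVariationOn_ne_top {γ : ℝ → Plane} {a b : ℝ} (h : IsPiecewiseC2 γ a b) :
    eVariationOn γ (Icc a b) ≠ ⊤ := by
  obtain ⟨C, hC, hl⟩ := h.exists_lipschitz
  exact ne_top_of_le_ne_top ENNReal.ofReal_ne_top (eVariationOn_le_of_lipschitz hC hl)

/-- Two curves in `X` of which the second starts at the end of the first can be joined. -/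
lemma IsCurveIn.concat {X : Set Plane} {γ δ : ℝ → Plane} {a b a' b' : ℝ} (h : IsCurveIn X γ a b)
    (h' : IsCurveIn X δ a' b') (he : γ b = δ a') : ∃ (ε : ℝ → Plane) (c : ℝ), IsCurveIn X ε a c ∧
      ε a = γ a ∧ ε c = δ b' ∧
      eVariationOn ε (Icc a c) = eVariationOn γ (Icc a b) + eVariationOn δ (Icc a' b') := by
  set e := a' - b with hedef
  have hab := h.1.1
  have hab' := h'.1.1
  set ε : ℝ → Plane := fun x => if x ≤ b then γ x else δ (x + e) with hε
  have h1 : EqOn ε γ (Icc a b) := fun x hx => by simp [hε, hx.2]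
  have h2 : EqOn ε (fun x => δ (x + e)) (Icc b (b' - e)) := fun x hx => by
    rcases hx.1.eq_or_lt with h | h
    · rw [← h]; simp [hε, he, hedef]
    · simp [hε, not_le.2 h]
  have hbc : b ≤ b' - e := by rw [hedef]; linarith
  have h3 := h'.1.comp_add e
  rw [show a' - e = b by rw [hedef]; ring] at h3
  refine ⟨ε, b' - e, ⟨(h.1.congr h1).trans (h3.congr h2), fun x hx => ?_⟩, ?_, ?_, ?_⟩
  · rcases le_total x b with hxb | hxb
    · rw [h1 ⟨hx.1, hxb⟩]; exact h.2 ⟨hx.1, hxb⟩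
    · rw [h2 ⟨hxb, hx.2⟩]
      exact h'.2 ⟨by rw [hedef]; linarith, by linarith [hx.2]⟩
  · exact h1 ⟨le_rfl, hab⟩
  · rw [h2 ⟨hbc, le_rfl⟩]; simp
  · rw [eVariationOn_add hab hbc, eVariationOn.congr h1, eVariationOn.congr h2]
    congr 1
    have hm : MonotoneOn (fun x : ℝ => x + e) (Icc b (b' - e)) := fun x _ y _ hxy => by
      simpa using hxy
    have := eVariationOn.comp_eq_of_monotoneOn δ (fun x => x + e) hm
    rw [image_add_const_Icc, show b + e = a' by rw [hedef]; ring, sub_add_cancel] at this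
    exact this

lemma isCurveIn_segment {X : Set Plane} {p q : Plane} (h : segment ℝ p q ⊆ X) :
    IsCurveIn X (fun x : ℝ => p + x • (q - p)) 0 1 ∧
      eVariationOn (fun x : ℝ => p + x • (q - p)) (Icc 0 1) ≤ ENNReal.ofReal (dist p q) := by
  have hs : ContDiff ℝ 2 (fun x : ℝ => p + x • (q - p)) := by fun_prop
  refine ⟨⟨⟨zero_le_one, hs.continuous.continuousOn, 1, fun i => i, by simp, by simp,
    fun i hi => ⟨by simp, hs.contDiffOn⟩⟩, fun x hx => h ?_⟩, ?_⟩
  · rw [segment_eq_image']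
    exact ⟨x, hx, rfl⟩
  · have := eVariationOn_le_of_lipschitz (γ := fun x : ℝ => p + x • (q - p)) (a := 0) (b := 1)
      (C := dist p q) dist_nonneg fun x _ y _ hxy => by
        rw [dist_add_left, dist_eq_norm, ← sub_smul, norm_smul, Real.norm_eq_abs,
          abs_of_nonpos (by linarith), dist_comm p q, dist_eq_norm]
        exact le_of_eq (by ring)
    simpa using this

/-- A part of a shortest curve that lies in `T ⊆ X` is a shortest curve in `T`. -/
lemma IsShortestCurve.restrict {X T : Set Plane} {γ : ℝ → Plane} {a b c d : ℝ}
    (h : IsShortestCurve X γ a b) (hT : T ⊆ X) (hac : a ≤ c) (hcd : c ≤ d) (hdb : d ≤ b)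
    (hm : MapsTo γ (Icc c d) T) : IsShortestCurve T γ c d := by
  obtain ⟨⟨hp, hX⟩, hmin⟩ := h
  refine ⟨⟨hp.mono hac hcd hdb, hm⟩, fun δ a' b' hδ h1 h2 => ?_⟩
  -- A competitor in `T` is spliced between the initial and the final part of `γ`. These parts have
  -- finite length, so they cancel from the comparison.
  have c1 : IsCurveIn X γ a c := ⟨hp.mono le_rfl hac (hcd.trans hdb),
    hX.mono_left (Icc_subset_Icc_right (hcd.trans hdb))⟩
  have c3 : IsCurveIn X γ d b := ⟨hp.mono (hac.trans hcd) hdb le_rfl,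
    hX.mono_left (Icc_subset_Icc_left (hac.trans hcd))⟩
  obtain ⟨ε, e, hε, hεa, hεe, hεV⟩ := c1.concat (⟨hδ.1, hδ.2.mono_right hT⟩) h1.symm
  obtain ⟨ε', e', hε', hεa', hεe', hεV'⟩ := hε.concat c3 (hεe.trans h2)
  have := hmin ε' a e' hε' (hεa'.trans hεa) hεe'
  rw [hεV', hεV, eVariationOn_add hac (hcd.trans hdb), eVariationOn_add hcd hdb, ← add_assoc] at this
  have f1 := c1.1.eVariationOn_ne_top
  have f3 := c3.1.eVariationOn_ne_top
  exact (ENNReal.add_le_add_iff_left f1).1 ((ENNReal.add_le_add_iff_right f3).1 this)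

/-- A shortest curve is a monotone reparametrization of a taut curve. -/
lemma IsShortestCurve.exists_taut {X : Set Plane} {γ : ℝ → Plane} {a b : ℝ}
    (h : IsShortestCurve X γ a b) : ∃ (L : ℝ) (len : ℝ → ℝ) (η : ℝ → Plane), 0 ≤ L ∧
      len a = 0 ∧ len b = L ∧ MonotoneOn len (Icc a b) ∧ ContinuousOn len (Icc a b) ∧
      (∀ t ∈ Icc a b, γ t = η (len t)) ∧ Taut X η 0 L := by
  have hp := h.1.1
  have hab := hp.1
  obtain ⟨C, hC, hlip⟩ := hp.exists_lipschitz
  set len : ℝ → ℝ := fun t => (eVariationOn γ (Icc a t)).toReal with hlen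
  have hfin : ∀ s t, a ≤ s → s ≤ t → t ≤ b → eVariationOn γ (Icc s t) ≠ ⊤ :=
    fun s t h1 h2 h3 => (hp.mono h1 h2 h3).eVariationOn_ne_top
  have hdiff : ∀ s t, a ≤ s → s ≤ t → t ≤ b →
      len t - len s = (eVariationOn γ (Icc s t)).toReal := by
    intro s t h1 h2 h3
    simp only [hlen]
    rw [eVariationOn_add h1 h2, ENNReal.toReal_add (hfin a s le_rfl h1 (h2.trans h3))
      (hfin s t h1 h2 h3)]
    ring
  have hmono : MonotoneOn len (Icc a b) := fun s hs t ht hst => by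
    have := hdiff s t hs.1 hst ht.2
    linarith [ENNReal.toReal_nonneg (a := eVariationOn γ (Icc s t))]
  have hle : ∀ s t, a ≤ s → s ≤ t → t ≤ b → len t - len s ≤ C * (t - s) := by
    intro s t h1 h2 h3
    rw [hdiff s t h1 h2 h3]
    refine ENNReal.toReal_le_of_le_ofReal (mul_nonneg hC (by linarith))
      (eVariationOn_le_of_lipschitz hC fun x hx y hy => hlip x ⟨h1.trans hx.1, hx.2.trans h3⟩ y
        ⟨h1.trans hy.1, hy.2.trans h3⟩)
  have hcont : ContinuousOn len (Icc a b) := by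
    have : LipschitzOnWith C.toNNReal len (Icc a b) := LipschitzOnWith.of_dist_le_mul
      fun x hx y hy => by
        rw [Real.coe_toNNReal _ hC, Real.dist_eq, Real.dist_eq]
        rcases le_total x y with hxy | hxy
        · have h1 := hle x y hx.1 hxy hy.2
          have h2 := hmono hx hy hxy
          rw [abs_of_nonpos (by linarith), abs_of_nonpos (by linarith)]; linarith
        · have h1 := hle y x hy.1 hxy hx.2
          have h2 := hmono hy hx hxy
          rw [abs_of_nonneg (by linarith), abs_of_nonneg (by linarith)]; linarith
    exact this.continuousOn
  have hdist : ∀ s t, a ≤ s → s ≤ t → t ≤ b → dist (γ s) (γ t) ≤ len t - len s := by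
    intro s t h1 h2 h3
    rw [hdiff s t h1 h2 h3, dist_edist]
    exact ENNReal.toReal_mono (hfin s t h1 h2 h3)
      (eVariationOn.edist_le γ ⟨le_rfl, h2⟩ ⟨h2, le_rfl⟩)
  have hdist' : ∀ s ∈ Icc a b, ∀ t ∈ Icc a b, dist (γ s) (γ t) ≤ |len s - len t| := by
    intro s hs t ht
    rcases le_total s t with hst | hst
    · rw [abs_sub_comm]; exact (hdist s t hs.1 hst ht.2).trans (le_abs_self _)
    · rw [dist_comm]; exact (hdist t s ht.1 hst hs.2).trans (le_abs_self _)
  have hlena : len a = 0 := by simp [hlen]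
  have himg : len '' Icc a b = Icc 0 (len b) := by
    rw [hcont.image_Icc_of_monotoneOn hab hmono, hlena]
  -- An arbitrary right inverse of arc length. The choice is immaterial because `γ` is constant
  -- where the arc length is.
  set τ := Function.invFunOn len (Icc a b) with hτ
  have hτm : ∀ s ∈ Icc 0 (len b), τ s ∈ Icc a b ∧ len (τ s) = s := fun s hs => by
    have : s ∈ len '' Icc a b := himg ▸ hs
    exact ⟨Function.invFunOn_mem this, Function.invFunOn_eq this⟩
  refine ⟨len b, len, fun s => γ (τ s), ?_, hlena, rfl, hmono, hcont, fun t ht => ?_, ?_, ?_, ?_⟩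
  · rw [← hlena]; exact hmono ⟨le_rfl, hab⟩ ⟨hab, le_rfl⟩ hab
  · have := hτm (len t) (himg ▸ mem_image_of_mem len ht)
    have h2 := hdist' t ht _ this.1
    rw [this.2, sub_self, abs_zero] at h2
    exact dist_le_zero.1 h2
  · intro s hs t ht
    have := hdist' _ (hτm s hs).1 _ (hτm t ht).1
    rwa [(hτm s hs).2, (hτm t ht).2] at this
  · exact fun s hs => h.1.2 (hτm s hs).1
  · intro s hs t ht hst hseg
    obtain ⟨s1, s2⟩ := hτm s hs
    obtain ⟨t1, t2⟩ := hτm t ht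
    have hup := hdist' _ s1 _ t1
    rw [s2, t2, abs_of_nonpos (by linarith), neg_sub] at hup
    refine le_antisymm hup ?_
    rcases le_total (τ s) (τ t) with hle' | hle'
    -- The part of `γ` between the two parameters is again shortest, so its length `t - s` is at
    -- most that of the segment.
    · have hres := h.restrict (T := X) Subset.rfl s1.1 hle' t1.2
        (h.1.2.mono_left (Icc_subset_Icc s1.1 t1.2))
      obtain ⟨k1, k2⟩ := isCurveIn_segment hseg
      have k3 := (hres.2 _ 0 1 k1 (by simp) (by simp)).trans k2
      have k4 := hdiff _ _ s1.1 hle' t1.2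
      rw [s2, t2] at k4
      rw [k4]
      exact ENNReal.toReal_le_of_le_ofReal dist_nonneg k3
    · have := hmono t1 s1 hle'
      rw [s2, t2] at this
      have : t - s ≤ 0 := by linarith
      exact this.trans dist_nonneg

/-- A weak inequality suffices: if the monotone polynomial `f'` took the same value at two points,
it would be constant on an interval, and then `f''` would be the zero polynomial. -/
lemma poly_strictConvexOn {f : ℝ[X]} (hf : f.derivative.derivative ≠ 0) {s u : ℝ}
    (h : ∀ x ∈ Icc s u, 0 ≤ f.derivative.derivative.eval x) :
    StrictConvexOn ℝ (Icc s u) (fun x => f.eval x) := by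
  have hm : MonotoneOn (fun x => f.derivative.eval x) (Icc s u) := by
    refine monotoneOn_of_deriv_nonneg (convex_Icc s u) f.derivative.continuous.continuousOn
      f.derivative.differentiable.differentiableOn fun x hx => ?_
    rw [poly_deriv]
    exact h x (interior_subset hx)
  have hs : StrictMonoOn (fun x => f.derivative.eval x) (Icc s u) := by
    intro x hx y hy hxy
    refine lt_of_le_of_ne (hm hx hy hxy.le) fun he => hf ?_
    have : f.derivative = C (f.derivative.eval x) := by
      refine Polynomial.eq_of_infinite_eval_eq _ _ ((Icc_infinite hxy).mono fun z hz => ?_)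
      have hzI : z ∈ Icc s u := ⟨hx.1.trans hz.1, hz.2.trans hy.2⟩
      have h1 := hm hx hzI hz.1
      have h2 := hm hzI hy hz.2
      simp only [mem_ofPred_eq, eval_C] at *
      linarith
    rw [this, derivative_C]
  refine StrictMonoOn.strictConvexOn_of_deriv (convex_Icc s u) f.continuous.continuousOn ?_
  rw [poly_deriv]
  exact hs.mono interior_subset

/-! ### Images of the pieces -/

namespace Taut

variable {n : ℕ} {G : Fin n → PolyHalfPlane} {η : ℝ → Plane} {a b : ℝ}

lemma image_straight {X : Set Plane} (h : Taut X η a b) {s t : ℝ} (has : a ≤ s) (hst : s < t)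
    (htb : t ≤ b) (hd : dist (η s) (η t) = t - s) : η '' Icc s t = segment ℝ (η s) (η t) := by
  obtain ⟨v, -, hv⟩ := h.affine has hst htb hd
  have ht := hv t ⟨hst.le, le_rfl⟩
  have hp : 0 < t - s := by linarith
  rw [segment_eq_image']
  ext q
  constructor
  · rintro ⟨r, hr, rfl⟩
    refine ⟨(r - s) / (t - s), ⟨div_nonneg (by linarith [hr.1]) hp.le,
      (div_le_one hp).2 (by linarith [hr.2])⟩, ?_⟩
    simp only
    rw [hv r hr, ht, add_sub_cancel_left, smul_smul, div_mul_cancel₀ _ hp.ne']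
  · rintro ⟨c, hc, rfl⟩
    have hr : s + c * (t - s) ∈ Icc s t := ⟨by nlinarith [hc.1], by nlinarith [hc.2]⟩
    refine ⟨s + c * (t - s), hr, ?_⟩
    simp only
    rw [hv _ hr, ht, add_sub_cancel_left, add_sub_cancel_left, smul_smul]

/-- Moving from a boundary point along the second axis of the frame leaves the half plane at once.
-/
lemma boundary_mem_frontier {p : Plane} (hp : p ∈ interHalfPlanes G) {l : Fin n}
    (hl : (G l).lev p = 0) : p ∈ frontier (interHalfPlanes G) := by
  refine ⟨subset_closure hp, fun hi => ?_⟩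
  have hc : Continuous fun ε : ℝ => p + ε • rotJ (G l).axis := by fun_prop
  have := hc.tendsto 0
  rw [zero_smul, add_zero] at this
  have hev : ∀ᶠ ε : ℝ in 𝓝[>] 0, p + ε • rotJ (G l).axis ∈ interHalfPlanes G :=
    (this.mono_left nhdsWithin_le_nhds).eventually (mem_interior_iff_mem_nhds.1 hi)
  obtain ⟨ε, h1, h2⟩ := (hev.and self_mem_nhdsWithin).exists
  have h1 := mem_interHalfPlanes.1 h1 l
  have h2 : 0 < ε := h2
  unfold PolyHalfPlane.lev at h1 hl
  simp only [map_add, map_smul, cx_rotJ, cy_rotJ (G l).norm_axis, smul_eq_mul, mul_zero, add_zero,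
    mul_one] at h1
  linarith

/-- On such a piece the curve is the graph over its continuous first coordinate, whose image is a
compact interval; injectivity of the curve makes this interval nondegenerate. -/
lemma image_arc (h : Taut (interHalfPlanes G) η a b) {s t : ℝ} (has : a ≤ s) (hst : s < t)
    (htb : t ≤ b) {l : Fin n} (hP : Piece G η (some l) s t) :
    η '' Icc s t ⊆ frontier (interHalfPlanes G) ∧ ∃ x y : ℝ, x < y ∧
      StrictConvexOn ℝ (Icc x y) (fun z => (G l).poly.eval z) ∧
      η '' Icc s t = (G l).graphPoint '' Icc x y := by
  obtain ⟨hne, hP⟩ := hP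
  have hsub : Icc s t ⊆ Icc a b := Icc_subset_Icc has htb
  constructor
  · rintro _ ⟨r, hr, rfl⟩
    exact boundary_mem_frontier (h.mem r (hsub hr)) (hP r hr).1
  have hc : ContinuousOn (fun r => (G l).fx (η r)) (Icc s t) :=
    (G l).fx.continuous.comp_continuousOn (h.continuousOn.mono hsub)
  have himg := hc.image_Icc hst.le
  set x := sInf ((fun r => (G l).fx (η r)) '' Icc s t)
  set y := sSup ((fun r => (G l).fx (η r)) '' Icc s t)
  have hgr : ∀ r ∈ Icc s t, η r = (G l).graphPoint ((G l).fx (η r)) :=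
    fun r hr => (G l).eq_graphPoint (hP r hr).1
  have ms : (G l).fx (η s) ∈ Icc x y := himg ▸ mem_image_of_mem _ ⟨le_rfl, hst.le⟩
  have mt : (G l).fx (η t) ∈ Icc x y := himg ▸ mem_image_of_mem _ ⟨hst.le, le_rfl⟩
  refine ⟨x, y, ?_, poly_strictConvexOn hne fun z hz => ?_, ?_⟩
  · refine lt_of_le_of_ne (ms.1.trans ms.2) fun hxy => hst.ne ?_
    refine h.injOn (hsub ⟨le_rfl, hst.le⟩) (hsub ⟨hst.le, le_rfl⟩) ?_
    have : (G l).fx (η s) = (G l).fx (η t) :=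
      le_antisymm (ms.2.trans (hxy ▸ mt.1)) (mt.2.trans (hxy ▸ ms.1))
    rw [hgr s ⟨le_rfl, hst.le⟩, hgr t ⟨hst.le, le_rfl⟩, this]
  · rw [← himg] at hz
    obtain ⟨r, hr, rfl⟩ := hz
    exact (hP r hr).2
  · rw [← himg, image_image]
    exact image_congr hgr

end Taut

/-- A shortest curve in an intersection of polynomial half planes is a point or an alternating
sequence of segments and boundary arcs. -/
theorem IsShortestCurve.point_or_alternating {n : ℕ} {G : Fin n → PolyHalfPlane} {γ : ℝ → Plane}
    {a b : ℝ} (h : IsShortestCurve (interHalfPlanes G) γ a b) :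
    IsPointCurve γ a b ∨ IsAlternating G γ a b := by
  obtain ⟨L, len, η, hL, h0, hLb, hmono, hcont, hγ, hη⟩ := h.exists_taut
  have hab := h.1.1.1
  have hmem : ∀ t ∈ Icc a b, len t ∈ Icc 0 L := fun t ht =>
    ⟨h0 ▸ hmono ⟨le_rfl, hab⟩ ht ht.1, hLb ▸ hmono ht ⟨hab, le_rfl⟩ ht.2⟩
  rcases hL.eq_or_lt with hL0 | hL0
  · left
    intro t ht
    have h1 := hmem t ht
    have : len t = 0 := by rw [← hL0] at h1; exact le_antisymm h1.2 h1.1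
    rw [hγ t ht, hγ a ⟨le_rfl, hab⟩, this, h0]
  right
  obtain ⟨N, τ, κ, hN, hτ0, hτN, hP, hκ⟩ := hη.exists_alternating hL0
  have mono : ∀ j ≤ N, ∀ i ≤ j, τ i ≤ τ j := by
    intro j hj i hij
    induction j, hij using Nat.le_induction with
    | base => exact le_rfl
    | succ m _ ih => exact (ih (by omega)).trans (hP m (by omega)).1.le
  have hτI : ∀ i ≤ N, τ i ∈ Icc 0 L := fun i hi =>
    ⟨hτ0 ▸ mono i hi 0 (Nat.zero_le _), hτN ▸ mono N le_rfl i hi⟩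
  have hex : ∀ i, ∃ t, i ≤ N → t ∈ Icc a b ∧ len t = τ i ∧ (i = 0 → t = a) ∧ (i = N → t = b) := by
    intro i
    by_cases hi : i ≤ N
    swap
    · exact ⟨0, fun h' => absurd h' hi⟩
    rcases Nat.eq_zero_or_pos i with rfl | hi0
    · exact ⟨a, fun _ => ⟨⟨le_rfl, hab⟩, by rw [h0, hτ0], fun _ => rfl, fun he => by omega⟩⟩
    rcases hi.eq_or_lt with rfl | hiN
    · exact ⟨b, fun _ => ⟨⟨hab, le_rfl⟩, by rw [hLb, hτN], fun he => by omega, fun _ => rfl⟩⟩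
    have := intermediate_value_Icc hab hcont
    rw [h0, hLb] at this
    obtain ⟨t, ht, ht'⟩ := this (hτI i hi)
    exact ⟨t, fun _ => ⟨ht, ht', fun he => by omega, fun he => by omega⟩⟩
  choose σ hσ using hex
  refine ⟨N, σ, κ, hN, (hσ 0 (Nat.zero_le _)).2.2.1 rfl, (hσ N le_rfl).2.2.2 rfl, fun i hi => ?_, hκ⟩
  obtain ⟨m1, e1, -, -⟩ := hσ i hi.le
  obtain ⟨m2, e2, -, -⟩ := hσ (i + 1) hi
  obtain ⟨hlt, hPi⟩ := hP i hi
  have hσlt : σ i < σ (i + 1) := by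
    by_contra! hle
    have := hmono m2 m1 hle
    rw [e1, e2] at this
    exact not_lt.2 this hlt
  refine ⟨hσlt, ?_⟩
  have hsub : Icc (σ i) (σ (i + 1)) ⊆ Icc a b := Icc_subset_Icc m1.1 m2.2
  have himg : γ '' Icc (σ i) (σ (i + 1)) = η '' Icc (τ i) (τ (i + 1)) := by
    rw [← e1, ← e2, ← (hcont.mono hsub).image_Icc_of_monotoneOn hσlt.le (hmono.mono hsub),
      image_image]
    exact image_congr fun t ht => hγ t (hsub ht)
  have hI1 := hτI i hi.le
  have hI2 := hτI (i + 1) hi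
  rcases hκi : κ i with _ | l
  · rw [hκi] at hPi
    have hPi : dist (η (τ i)) (η (τ (i + 1))) = τ (i + 1) - τ i := hPi
    change IsSegmentPiece γ (σ i) (σ (i + 1))
    refine ⟨fun he => ?_, ?_⟩
    · rw [hγ _ m1, hγ _ m2, e1, e2] at he
      rw [he, dist_self] at hPi
      linarith
    · rw [himg, hγ _ m1, hγ _ m2, e1, e2]
      exact hη.image_straight hI1.1 hlt hI2.2 hPi
  · rw [hκi] at hPi
    change IsConvexArcPiece (interHalfPlanes G) (G l) γ (σ i) (σ (i + 1))
    unfold IsConvexArcPiece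
    rw [himg]
    exact hη.image_arc hI1.1 hlt hI2.2 hPi

/-! ### The part of a curve inside a region -/

namespace Taut

variable {n : ℕ} {G : Fin n → PolyHalfPlane} {η : ℝ → Plane} {a b : ℝ}

/-- The level of a half plane along a taut curve has eventually a constant sign. -/
lemma lev_germ_right (h : Taut (interHalfPlanes G) η a b) (hab : a < b) (H : PolyHalfPlane) :
    (∀ᶠ s in 𝓝[>] a, 0 ≤ H.lev (η s)) ∨ (∀ᶠ s in 𝓝[>] a, H.lev (η s) < 0) := by
  obtain ⟨t, ht, κ, hP⟩ := h.exists_piece_right hab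
  have hev : ∀ᶠ s in 𝓝[>] a, s ∈ Ioc a t := Ioc_mem_nhdsGT ht.1
  cases κ with
  | none =>
    obtain ⟨v, -, hv⟩ := h.affine le_rfl ht.1 ht.2 hP
    -- On a straight piece the level is a polynomial in the parameter.
    set q : ℝ[X] := H.poly.comp (C (H.fx (η a)) + (X - C a) * C (H.fx v))
      - (C (H.fy (η a)) + (X - C a) * C (H.fy v)) with hq
    have hqe : ∀ s ∈ Icc a t, q.eval s = H.lev (η s) := by
      intro s hs
      rw [hv s hs, hq, PolyHalfPlane.lev]
      simp
    refine (polyGerm_right a q).imp (fun hg => ?_) (fun hg => ?_)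
    · filter_upwards [hg, hev] with s h1 h2
      rwa [← hqe s ⟨h2.1.le, h2.2⟩]
    · filter_upwards [hg, hev] with s h1 h2
      rwa [← hqe s ⟨h2.1.le, h2.2⟩]
  | some l =>
    obtain ⟨-, hP⟩ := hP
    have hsub : Icc a t ⊆ Icc a b := Icc_subset_Icc le_rfl ht.2
    set x : ℝ → ℝ := fun s => (G l).fx (η s) with hx
    have hgr : ∀ s ∈ Icc a t, η s = (G l).graphPoint (x s) :=
      fun s hs => (G l).eq_graphPoint (hP s hs).1
    have hxc : ContinuousOn x (Icc a t) :=
      (G l).fx.continuous.comp_continuousOn (h.continuousOn.mono hsub)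
    have hxi : InjOn x (Icc a t) := fun s hs s' hs' he =>
      h.injOn (hsub hs) (hsub hs') (by rw [hgr s hs, hgr s' hs', he])
    have hlim : Tendsto x (𝓝[>] a) (𝓝 (x a)) := by
      have := (hxc a ⟨le_rfl, ht.1.le⟩).tendsto
      refine this.mono_left ?_
      rw [← nhdsWithin_Ioc_eq_nhdsGT ht.1]
      exact nhdsWithin_mono _ Ioc_subset_Icc_self
    -- On an arc the level is a polynomial in the first coordinate in the frame of `G l`.
    set q : ℝ[X] := H.poly.comp (C (H.fx (!₂[Real.cos (G l).angle, Real.sin (G l).angle])) * X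
      + C (H.fx (!₂[-Real.sin (G l).angle, Real.cos (G l).angle])) * (G l).poly)
      - (C (H.fy (!₂[Real.cos (G l).angle, Real.sin (G l).angle])) * X
      + C (H.fy (!₂[-Real.sin (G l).angle, Real.cos (G l).angle])) * (G l).poly) with hq
    have hqe : ∀ s ∈ Icc a t, q.eval (x s) = H.lev (η s) := by
      intro s hs
      have he : η s = x s • (!₂[Real.cos (G l).angle, Real.sin (G l).angle] : Plane)
          + (G l).poly.eval (x s) • (!₂[-Real.sin (G l).angle, Real.cos (G l).angle] : Plane) := by
        rw [hgr s hs]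
        apply plane_ext <;> simp [PolyHalfPlane.graphPoint] <;> ring
      rw [he, hq, PolyHalfPlane.lev]
      simp only [eval_sub, eval_comp, eval_add, eval_mul, eval_C, eval_X, map_add, map_smul,
        smul_eq_mul]
      congr 2 <;> ring
    have main : ∀ 𝓕 : Filter ℝ, PolyGerm 𝓕 → Tendsto x (𝓝[>] a) 𝓕 →
        (∀ᶠ s in 𝓝[>] a, 0 ≤ H.lev (η s)) ∨ (∀ᶠ s in 𝓝[>] a, H.lev (η s) < 0) := by
      intro 𝓕 h𝓕 hx𝓕
      refine (h𝓕 q).imp (fun hg => ?_) (fun hg => ?_)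
      · filter_upwards [hx𝓕.eventually hg, hev] with s h1 h2
        rwa [← hqe s ⟨h2.1.le, h2.2⟩]
      · filter_upwards [hx𝓕.eventually hg, hev] with s h1 h2
        rwa [← hqe s ⟨h2.1.le, h2.2⟩]
    -- The first coordinate is continuous and injective, hence strictly monotone, so it approaches
    -- its limit from one side only.
    rcases hxc.strictMonoOn_of_injOn_Icc' ht.1.le hxi with hm | hm
    · refine main _ (polyGerm_right (x a)) (tendsto_nhdsWithin_iff.2 ⟨hlim, ?_⟩)
      filter_upwards [hev] with s hs
      exact hm ⟨le_rfl, ht.1.le⟩ ⟨hs.1.le, hs.2⟩ hs.1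
    · refine main _ (polyGerm_left (x a)) (tendsto_nhdsWithin_iff.2 ⟨hlim, ?_⟩)
      filter_upwards [hev] with s hs
      exact hm ⟨le_rfl, ht.1.le⟩ ⟨hs.1.le, hs.2⟩ hs.1

lemma mem_germ_right (h : Taut (interHalfPlanes G) η a b) (hab : a < b) {m : ℕ}
    (F : Fin m → PolyHalfPlane) :
    (∀ᶠ s in 𝓝[>] a, η s ∈ interHalfPlanes F) ∨ (∀ᶠ s in 𝓝[>] a, η s ∉ interHalfPlanes F) := by
  simp only [mem_interHalfPlanes]
  by_cases hall : ∀ l, ∀ᶠ s in 𝓝[>] a, 0 ≤ (F l).lev (η s)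
  · exact .inl (eventually_all.2 hall)
  · push Not at hall
    obtain ⟨l, hl⟩ := hall
    right
    filter_upwards [(h.lev_germ_right hab (F l)).resolve_left (by simpa using hl)] with s hs hcon
    exact absurd (hcon l) (not_le.2 hs)

lemma mem_germ_left (h : Taut (interHalfPlanes G) η a b) (hab : a < b) {m : ℕ}
    (F : Fin m → PolyHalfPlane) :
    (∀ᶠ s in 𝓝[<] b, η s ∈ interHalfPlanes F) ∨ (∀ᶠ s in 𝓝[<] b, η s ∉ interHalfPlanes F) := by
  have ht : Tendsto (fun s : ℝ => -s) (𝓝[<] b) (𝓝[>] (-b)) := tendsto_neg_nhdsLT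
  refine (h.reverse.mem_germ_right (neg_lt_neg hab) F).imp (fun hg => ?_) (fun hg => ?_)
  · exact (ht.eventually hg).mono fun s hs => by simpa using hs
  · exact (ht.eventually hg).mono fun s hs => by simpa using hs

end Taut

lemma union_mem_nhds {A B : Set ℝ} {x : ℝ} (hA : A ∈ 𝓝[>] x) (hB : B ∈ 𝓝[<] x) :
    A ∪ B ∪ {x} ∈ 𝓝 x := by
  rw [← nhdsNE_sup_pure, ← nhdsLT_sup_nhdsGT]
  refine mem_sup.2 ⟨mem_sup.2 ⟨mem_of_superset hB ?_, mem_of_superset hA ?_⟩, by simp⟩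
  · exact fun y hy => .inl (.inr hy)
  · exact fun y hy => .inl (.inl hy)

/-- A compact set of reals that does not oscillate at any point is a finite disjoint union of
compact intervals. -/
lemma exists_intervals {K : Set ℝ} (hK : IsCompact K)
    (right : ∀ x ∈ K, (∀ᶠ y in 𝓝[>] x, y ∈ K) ∨ ∀ᶠ y in 𝓝[>] x, y ∉ K)
    (left : ∀ x ∈ K, (∀ᶠ y in 𝓝[<] x, y ∈ K) ∨ ∀ᶠ y in 𝓝[<] x, y ∉ K) :
    ∃ (r : ℕ) (c d : Fin r → ℝ), (∀ i, c i ≤ d i) ∧ K = ⋃ i, Icc (c i) (d i) ∧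
      Pairwise fun i j => Disjoint (Icc (c i) (d i)) (Icc (c j) (d j)) := by
  -- `p S` says that `S` meets only finitely many components of `K`. This holds near each point,
  -- since `K` contains or avoids each one-sided germ, and passes to `K` by compactness.
  set p : Set ℝ → Prop := fun S => ((fun x => connectedComponentIn K x) '' (S ∩ K)).Finite with hp
  have p_mono : ∀ ⦃S T⦄, S ⊆ T → p T → p S := fun S T hST hT =>
    hT.subset (image_mono (inter_subset_inter_left _ hST))
  have p_union : ∀ ⦃S T⦄, p S → p T → p (S ∪ T) := fun S T hS hT => by
    simp only [hp, union_inter_distrib_right, image_union] at *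
    exact hS.union hT
  have p_conn : ∀ S, IsPreconnected S → S ⊆ K → p S := by
    intro S hS hSK
    refine Set.Subsingleton.finite ?_
    rintro _ ⟨x, hx, rfl⟩ _ ⟨y, hy, rfl⟩
    exact connectedComponentIn_eq (hS.subset_connectedComponentIn hx.1 hSK hy.1)
  have p_disj : ∀ S, (∀ x ∈ S, x ∉ K) → p S := by
    intro S hS
    have : S ∩ K = ∅ := by
      ext x; simp only [mem_inter_iff, mem_empty_iff_false, iff_false, not_and]; exact hS x
    simp [hp, this]
  have hfin : p K := by
    refine hK.induction_on (p := p) (by simp [hp]) p_mono p_union fun x hx => ?_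
    obtain ⟨A, hA, hpA⟩ : ∃ A ∈ 𝓝[>] x, p A := by
      rcases right x hx with h | h
      · obtain ⟨u, hu, hsub⟩ := mem_nhdsGT_iff_exists_Ioo_subset.1 h
        exact ⟨Ioo x u, Ioo_mem_nhdsGT hu, p_conn _ isPreconnected_Ioo hsub⟩
      · exact ⟨_, h, p_disj _ fun y hy => hy⟩
    obtain ⟨B, hB, hpB⟩ : ∃ B ∈ 𝓝[<] x, p B := by
      rcases left x hx with h | h
      · obtain ⟨u, hu, hsub⟩ := mem_nhdsLT_iff_exists_Ioo_subset.1 h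
        exact ⟨Ioo u x, Ioo_mem_nhdsLT hu, p_conn _ isPreconnected_Ioo hsub⟩
      · exact ⟨_, h, p_disj _ fun y hy => hy⟩
    exact ⟨A ∪ B ∪ {x}, mem_nhdsWithin_of_mem_nhds (union_mem_nhds hA hB),
      p_union (p_union hpA hpB) (p_conn {x} isPreconnected_singleton (singleton_subset_iff.2 hx))⟩
  simp only [hp, inter_self] at hfin
  obtain ⟨r, e⟩ : ∃ r, Nonempty (Fin r ≃ ((fun x => connectedComponentIn K x) '' K)) := by
    have := hfin.to_subtype
    obtain ⟨r, ⟨e⟩⟩ := Finite.exists_equiv_fin ((fun x => connectedComponentIn K x) '' K)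
    exact ⟨r, ⟨e.symm⟩⟩
  obtain ⟨e⟩ := e
  have hcomp : ∀ i, ∃ x ∈ K, (e i : Set ℝ) = connectedComponentIn K x := fun i => by
    obtain ⟨x, hx, hx'⟩ := (e i).2
    exact ⟨x, hx, hx'.symm⟩
  have hIcc : ∀ i, (e i : Set ℝ) = Icc (sInf (e i : Set ℝ)) (sSup (e i : Set ℝ)) := by
    intro i
    obtain ⟨x, hx, hx'⟩ := hcomp i
    have hconn : IsConnected (e i : Set ℝ) := by
      rw [hx']; exact isConnected_connectedComponentIn_iff.2 hx
    refine eq_Icc_of_connected_compact hconn (hK.of_isClosed_subset ?_ ?_)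
    -- The closure of a component is connected and stays in the closed set `K`, so the component is
    -- closed.
    · refine isClosed_of_closure_subset ?_
      have hcl : closure (e i : Set ℝ) ⊆ K := closure_minimal
        (hx' ▸ connectedComponentIn_subset K x) hK.isClosed
      have hxm : x ∈ (e i : Set ℝ) := hx' ▸ mem_connectedComponentIn hx
      have := hconn.isPreconnected.closure.subset_connectedComponentIn (subset_closure hxm) hcl
      rwa [← hx'] at this
    · rw [hx']; exact connectedComponentIn_subset K x
  refine ⟨r, fun i => sInf (e i : Set ℝ), fun i => sSup (e i : Set ℝ), fun i => ?_, ?_, ?_⟩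
  · obtain ⟨x, hx, hx'⟩ := hcomp i
    have hxm : x ∈ (e i : Set ℝ) := hx' ▸ mem_connectedComponentIn hx
    rw [hIcc i] at hxm
    exact hxm.1.trans hxm.2
  · simp only [← hIcc]
    ext x
    rw [mem_iUnion]
    constructor
    · intro hx
      refine ⟨e.symm ⟨connectedComponentIn K x, x, hx, rfl⟩, ?_⟩
      rw [Equiv.apply_symm_apply]
      exact mem_connectedComponentIn hx
    · rintro ⟨i, hi⟩
      obtain ⟨y, -, hy⟩ := hcomp i
      rw [hy] at hi
      exact connectedComponentIn_subset K y hi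
  · intro i j hij
    simp only [← hIcc]
    rw [Set.disjoint_left]
    intro x hxi hxj
    apply hij
    apply e.injective
    apply Subtype.ext
    obtain ⟨y, -, hy⟩ := hcomp i
    obtain ⟨z, -, hz⟩ := hcomp j
    rw [hy] at hxi
    rw [hz] at hxj
    rw [hy, hz, connectedComponentIn_eq hxi, connectedComponentIn_eq hxj]

/-- A shortest curve in `X` runs inside a region `T ⊆ X` during finitely many intervals. -/
theorem IsShortestCurve.exists_intervals {k n : ℕ} {F : Fin k → PolyHalfPlane}
    {G : Fin n → PolyHalfPlane} (hGF : interHalfPlanes G ⊆ interHalfPlanes F) {γ : ℝ → Plane}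
    {a b : ℝ} (h : IsShortestCurve (interHalfPlanes F) γ a b) :
    ∃ (r : ℕ) (c d : Fin r → ℝ),
      {t | t ∈ Icc a b ∧ γ t ∈ interHalfPlanes G} = ⋃ i, Icc (c i) (d i) ∧
      (Pairwise fun i i' => Disjoint (γ '' Icc (c i) (d i)) (γ '' Icc (c i') (d i'))) ∧
      ∀ i, IsShortestCurve (interHalfPlanes G) γ (c i) (d i) := by
  obtain ⟨L, len, η, hL, h0, hLb, hmono, hcont, hγ, hη⟩ := h.exists_taut
  have hab := h.1.1.1
  have hmem : ∀ t ∈ Icc a b, len t ∈ Icc 0 L := fun t ht =>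
    ⟨h0 ▸ hmono ⟨le_rfl, hab⟩ ht ht.1, hLb ▸ hmono ht ⟨hab, le_rfl⟩ ht.2⟩
  set K : Set ℝ := {s | s ∈ Icc 0 L ∧ η s ∈ interHalfPlanes G} with hKdef
  have hKc : IsCompact K := by
    have : K = Icc 0 L ∩ η ⁻¹' interHalfPlanes G := rfl
    rw [this]
    exact isCompact_Icc.of_isClosed_subset (hη.continuousOn.preimage_isClosed_of_isClosed
      isClosed_Icc (isClosed_inter G)) inter_subset_left
  obtain ⟨r, c, d, hcd, hKU, hdisj⟩ := _root_.exists_intervals hKc (fun x hx => by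
      rcases hx.1.2.eq_or_lt with hxL | hxL
      · right
        filter_upwards [self_mem_nhdsWithin] with y hy hyK
        exact not_le.2 (show x < y from hy) (hxL ▸ hyK.1.2)
      · have hI : ∀ᶠ y in 𝓝[>] x, y ∈ Ioo x L := Ioo_mem_nhdsGT hxL
        refine ((hη.mono hx.1.1 le_rfl).mem_germ_right hxL G).imp (fun hg => ?_) (fun hg => ?_)
        · filter_upwards [hg, hI] with y h1 h2 using ⟨⟨hx.1.1.trans h2.1.le, h2.2.le⟩, h1⟩
        · filter_upwards [hg] with y h1 h2 using h1 h2.2)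
    (fun x hx => by
      rcases hx.1.1.eq_or_lt with hxL | hxL
      · right
        filter_upwards [self_mem_nhdsWithin] with y hy hyK
        exact not_le.2 (show y < x from hy) (hxL ▸ hyK.1.1)
      · have hI : ∀ᶠ y in 𝓝[<] x, y ∈ Ioo 0 x := Ioo_mem_nhdsLT hxL
        refine ((hη.mono le_rfl hx.1.2).mem_germ_left hxL G).imp (fun hg => ?_) (fun hg => ?_)
        · filter_upwards [hg, hI] with y h1 h2 using ⟨⟨h2.1.le, h2.2.le.trans hx.1.2⟩, h1⟩
        · filter_upwards [hg] with y h1 h2 using h1 h2.2)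
  have hsubK : ∀ i, Icc (c i) (d i) ⊆ K := fun i => by rw [hKU]; exact subset_iUnion (fun i => Icc (c i) (d i)) i
  have himgL : len '' Icc a b = Icc 0 L := by
    rw [hcont.image_Icc_of_monotoneOn hab hmono, h0, hLb]
  -- the preimages of the intervals are intervals
  have hpre : ∀ i, ∃ c' d', a ≤ c' ∧ c' ≤ d' ∧ d' ≤ b ∧
      {t | t ∈ Icc a b ∧ len t ∈ Icc (c i) (d i)} = Icc c' d' := by
    intro i
    set A := {t | t ∈ Icc a b ∧ len t ∈ Icc (c i) (d i)} with hA
    have hAc : IsCompact A := isCompact_Icc.of_isClosed_subset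
      (hcont.preimage_isClosed_of_isClosed isClosed_Icc isClosed_Icc) inter_subset_left
    have hAne : A.Nonempty := by
      have : c i ∈ len '' Icc a b := himgL ▸ (hsubK i ⟨le_rfl, hcd i⟩).1
      obtain ⟨t, ht, hct⟩ := this
      exact ⟨t, ht, by rw [hct]; exact ⟨le_rfl, hcd i⟩⟩
    have hAo : A.OrdConnected := ⟨fun x hx y hy z hz => by
      have hzI : z ∈ Icc a b := ⟨hx.1.1.trans hz.1, hz.2.trans hy.1.2⟩
      exact ⟨hzI, hx.2.1.trans (hmono hx.1 hzI hz.1), (hmono hzI hy.1 hz.2).trans hy.2.2⟩⟩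
    have hAeq := eq_Icc_of_connected_compact ⟨hAne, hAo.isPreconnected⟩ hAc
    have m1 := hAc.sInf_mem hAne
    have m2 := hAc.sSup_mem hAne
    exact ⟨sInf A, sSup A, m1.1.1, csInf_le hAc.bddBelow m2, m2.1.2, hAeq⟩
  choose c' d' hc' hcd' hd' hpre using hpre
  have himg : ∀ i, γ '' Icc (c' i) (d' i) ⊆ η '' Icc (c i) (d i) := by
    rintro i _ ⟨t, ht, rfl⟩
    rw [← hpre i] at ht
    exact ⟨len t, ht.2, (hγ t ht.1).symm⟩
  refine ⟨r, c', d', ?_, fun i j hij => ?_, fun i => ?_⟩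
  · simp only [← hpre]
    ext t
    simp only [mem_ofPred_eq, mem_iUnion]
    constructor
    · rintro ⟨ht, htG⟩
      have : len t ∈ K := ⟨hmem t ht, hγ t ht ▸ htG⟩
      rw [hKU, mem_iUnion] at this
      obtain ⟨i, hi⟩ := this
      exact ⟨i, ht, hi⟩
    · rintro ⟨i, ht, hi⟩
      exact ⟨ht, hγ t ht ▸ (hsubK i hi).2⟩
  · refine Disjoint.mono (himg i) (himg j) ?_
    rw [Set.disjoint_left]
    rintro _ ⟨s, hs, rfl⟩ ⟨s', hs', he⟩
    have := hη.injOn (hsubK j hs').1 (hsubK i hs).1 he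
    rw [this] at hs'
    exact Set.disjoint_left.1 (hdisj hij) hs hs'
  · refine h.restrict hGF (hc' i) (hcd' i) (hd' i) fun t ht => ?_
    rw [← hpre i] at ht
    rw [hγ t ht.1]
    exact (hsubK i ht.2).2

/-! ### Simply connected sets with convex fibers -/

lemma isSimplyConnected_of_convex {T : Set Plane} (h : Convex ℝ T) (hne : T.Nonempty) :
    IsSimplyConnected T := by
  have := h.contractibleSpace hne
  exact SimplyConnectedSpace.ofContractible T

/-- A set with convex fibers over an interval which has a continuous section is simply
connected. -/
lemma isSimplyConnected_of_fibers {T : Set Plane} (φ : Plane →L[ℝ] ℝ) {J : Set ℝ}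
    (hJ : Convex ℝ J) (hJne : J.Nonempty) {β : ℝ → Plane} (hβ : Continuous β)
    (hβT : ∀ x ∈ J, β x ∈ T) (hφβ : ∀ x ∈ J, φ (β x) = x) (hφ : ∀ w ∈ T, φ w ∈ J)
    (hfib : ∀ w ∈ T, ∀ w' ∈ T, φ w = φ w' → segment ℝ w w' ⊆ T) : IsSimplyConnected T := by
  have hJc := hJ.contractibleSpace hJne
  let f : C(T, J) := ⟨fun w => ⟨φ w, hφ w w.2⟩, by fun_prop⟩
  let g : C(J, T) := ⟨fun x => ⟨β x, hβT x x.2⟩, by fun_prop⟩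
  have h1 : (g.comp f).Homotopic (ContinuousMap.id T) := by
    -- The homotopy moves each point along a straight line inside its fiber, starting on the
    -- section.
    refine ⟨⟨⟨fun q => ⟨AffineMap.lineMap (β (φ q.2)) (q.2 : Plane) (q.1 : ℝ), ?_⟩, ?_⟩, ?_, ?_⟩⟩
    · refine hfib _ (hβT _ (hφ _ q.2.2)) _ q.2.2 (hφβ _ (hφ _ q.2.2)) ?_
      rw [segment_eq_image_lineMap]
      exact ⟨q.1, q.1.2, rfl⟩
    · refine Continuous.subtype_mk ?_ _
      simp only [AffineMap.lineMap_apply_module']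
      fun_prop
    · intro w; apply Subtype.ext; simp [f, g]
    · intro w; apply Subtype.ext; simp
  have h2 : f.comp g = ContinuousMap.id J := by
    ext x
    simp [f, g, hφβ x x.2]
  have e : ContinuousMap.HomotopyEquiv T J := ⟨f, g, h1, h2 ▸ ContinuousMap.Homotopic.refl _⟩
  have := e.contractibleSpace
  exact SimplyConnectedSpace.ofContractible T

/-! ### Intersections of half planes as sets -/

/-- The set is an intersection of finitely many closed polynomial half planes. -/
def PolySet (T : Set Plane) : Prop :=
  ∃ (n : ℕ) (G : Fin n → PolyHalfPlane), interHalfPlanes G = T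

lemma polySet_interHalfPlanes {n : ℕ} (G : Fin n → PolyHalfPlane) : PolySet (interHalfPlanes G) :=
  ⟨n, G, rfl⟩

lemma PolySet.inter {S T : Set Plane} (hS : PolySet S) (hT : PolySet T) : PolySet (S ∩ T) := by
  obtain ⟨n, G, rfl⟩ := hS
  obtain ⟨m, G', rfl⟩ := hT
  refine ⟨n + m, Fin.append G G', ?_⟩
  ext p
  simp only [mem_interHalfPlanes, mem_inter_iff]
  constructor
  · intro h
    exact ⟨fun l => by simpa using h (Fin.castAdd m l), fun l => by simpa using h (Fin.natAdd n l)⟩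
  · rintro ⟨h1, h2⟩ l
    refine Fin.addCases (fun i => ?_) (fun i => ?_) l
    · simpa using h1 i
    · simpa using h2 i

lemma exists_angle {x y : ℝ} (h : x ^ 2 + y ^ 2 = 1) : ∃ θ : ℝ, Real.cos θ = x ∧ Real.sin θ = y := by
  have hn : ‖(⟨x, y⟩ : ℂ)‖ = 1 := by
    rw [Complex.norm_eq_sqrt_sq_add_sq, h, Real.sqrt_one]
  have hne : (⟨x, y⟩ : ℂ) ≠ 0 := fun h0 => by rw [h0, norm_zero] at hn; exact zero_ne_one hn
  refine ⟨Complex.arg ⟨x, y⟩, ?_, ?_⟩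
  · rw [Complex.cos_arg hne, hn, div_one]
  · rw [Complex.sin_arg, hn, div_one]

/-- Straight half planes are polynomial half planes. -/
lemma polySet_linear {φ : Plane →L[ℝ] ℝ} (hφ : φ ≠ 0) (c : ℝ) : PolySet {w | φ w ≤ c} := by
  set α := φ !₂[1, 0] with hα
  set β := φ !₂[0, 1] with hβ
  have hφe : ∀ w, φ w = α * w 0 + β * w 1 := by
    intro w
    have : w = w 0 • (!₂[1, 0] : Plane) + w 1 • (!₂[0, 1] : Plane) := by
      apply plane_ext <;> simp
    conv_lhs => rw [this]
    rw [map_add, map_smul, map_smul, smul_eq_mul, smul_eq_mul, mul_comm, mul_comm (w 1)]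
  have hpos : 0 < α ^ 2 + β ^ 2 := by
    by_contra! h
    have h1 : α = 0 := by nlinarith [sq_nonneg α, sq_nonneg β]
    have h2 : β = 0 := by nlinarith [sq_nonneg α, sq_nonneg β]
    exact hφ (by ext w; rw [hφe, h1, h2]; simp)
  set r := Real.sqrt (α ^ 2 + β ^ 2) with hr
  have hr0 : 0 < r := Real.sqrt_pos.2 hpos
  have hr2 : r ^ 2 = α ^ 2 + β ^ 2 := Real.sq_sqrt hpos.le
  -- The second axis `(-sin θ, cos θ)` becomes the unit normal `(α / r, β / r)` of `φ`; the half
  -- plane then lies below the graph of the constant `c / r`.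
  obtain ⟨θ, h1, h2⟩ := exists_angle (x := β / r) (y := -α / r) (by
    rw [div_pow, div_pow, ← add_div, hr2, neg_sq, add_comm, div_self hpos.ne'])
  refine ⟨1, fun _ => ⟨C (c / r), θ⟩, ?_⟩
  ext w
  simp only [interHalfPlanes, mem_iInter, PolyHalfPlane.carrier, h1, h2, eval_C, mem_ofPred_eq,
    hφe w]
  have : c / r - (-(-α / r) * w 0 + β / r * w 1) = (c - (α * w 0 + β * w 1)) / r := by
    field_simp
  rw [this]
  constructor
  · intro h
    have := h 0
    rw [le_div_iff₀ hr0] at this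
    linarith
  · intro h _
    exact div_nonneg (by linarith) hr0.le

/-- The set is a region of type I. -/
def TypeISet (T : Set Plane) : Prop := PolySet T ∧ IsSimplyConnected T

/-- The part of `X` in `S` is covered by finitely many regions of type I contained in `X`. -/
def Coverable (X S : Set Plane) : Prop :=
  ∃ 𝒯 : Set (Set Plane), 𝒯.Finite ∧ (∀ T ∈ 𝒯, TypeISet T ∧ T ⊆ X) ∧ X ∩ S ⊆ ⋃₀ 𝒯

namespace Coverable

variable {X S S' : Set Plane}

lemma of_disjoint (h : ∀ w ∈ S, w ∉ X) : Coverable X S :=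
  ⟨∅, finite_empty, by simp, fun w hw => absurd hw.1 (h w hw.2)⟩

lemma of_typeI {T : Set Plane} (hT : TypeISet T) (hTX : T ⊆ X) (h : X ∩ S ⊆ T) : Coverable X S :=
  ⟨{T}, finite_singleton T, by simpa using ⟨hT, hTX⟩, by simpa using h⟩

lemma mono (h : Coverable X S) (hS : S' ⊆ S) : Coverable X S' := by
  obtain ⟨𝒯, h1, h2, h3⟩ := h
  exact ⟨𝒯, h1, h2, (inter_subset_inter_right _ hS).trans h3⟩

lemma union (h : Coverable X S) (h' : Coverable X S') : Coverable X (S ∪ S') := by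
  obtain ⟨𝒯, h1, h2, h3⟩ := h
  obtain ⟨𝒯', h1', h2', h3'⟩ := h'
  refine ⟨𝒯 ∪ 𝒯', h1.union h1', ?_, ?_⟩
  · rintro T (hT | hT)
    · exact h2 T hT
    · exact h2' T hT
  · rw [inter_union_distrib_left, sUnion_union]
    exact union_subset_union h3 h3'

lemma empty : Coverable X ∅ := of_disjoint (by simp)

lemma exists_decomposition (h : Coverable X univ) : ∃ (m : ℕ) (n : Fin m → ℕ)
    (G : ∀ j, Fin (n j) → PolyHalfPlane), IsTypeIDecomposition X G := by
  obtain ⟨𝒯, h1, h2, h3⟩ := h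
  have := h1.to_subtype
  obtain ⟨m, ⟨e⟩⟩ := Finite.exists_equiv_fin 𝒯
  have hG : ∀ j : Fin m, ∃ (n : ℕ) (G : Fin n → PolyHalfPlane),
      interHalfPlanes G = (e.symm j : Set Plane) := fun j => (h2 _ (e.symm j).2).1.1
  choose n G hG using hG
  refine ⟨m, n, G, fun j => ?_, ?_⟩
  · rw [IsTypeI, hG j]
    exact (h2 _ (e.symm j).2).1.2
  · simp only [hG]
    apply Subset.antisymm
    · intro w hw
      obtain ⟨T, hT, hwT⟩ := h3 ⟨hw, mem_univ w⟩
      rw [mem_iUnion]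
      exact ⟨e ⟨T, hT⟩, by simpa using hwT⟩
    · intro w hw
      rw [mem_iUnion] at hw
      obtain ⟨j, hj⟩ := hw
      exact (h2 _ (e.symm j).2).2 hj

end Coverable

/-! ### Cells around a direction -/

/-- The closed triangle with vertex `p` given in linear coordinates by `0 ≤ ξ ≤ δ` and
`|y| ≤ κ ξ`. -/
def triCell (p : Plane) (ξ y : Plane →L[ℝ] ℝ) (κ δ : ℝ) : Set Plane :=
  {q | ξ (q - p) ≤ δ ∧ |y (q - p)| ≤ κ * ξ (q - p)}

lemma polySet_triCell (p : Plane) {ξ y : Plane →L[ℝ] ℝ} {u : Plane} (hy : y u = 0) (hξ : 0 < ξ u)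
    {κ : ℝ} (hκ : 0 < κ) (δ : ℝ) : PolySet (triCell p ξ y κ δ) := by
  have h1 : ξ ≠ 0 := fun h => by simp [h] at hξ
  have h2 : y - κ • ξ ≠ 0 := fun h => by
    have := congrArg (fun φ : Plane →L[ℝ] ℝ => φ u) h
    simp [hy, hκ.ne', hξ.ne'] at this
  have h3 : -y - κ • ξ ≠ 0 := fun h => by
    have := congrArg (fun φ : Plane →L[ℝ] ℝ => φ u) h
    simp [hy, hκ.ne', hξ.ne'] at this
  convert ((polySet_linear h1 (δ + ξ p)).inter (polySet_linear h2 (y p - κ * ξ p))).inter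
    (polySet_linear h3 (-y p - κ * ξ p)) using 1
  ext q
  simp only [triCell, mem_ofPred_eq, mem_inter_iff, map_sub, abs_le, sub_apply, neg_apply,
    smul_apply, smul_eq_mul]
  constructor
  · rintro ⟨h1, h2, h3⟩
    exact ⟨⟨by linarith, by linarith⟩, by linarith⟩
  · rintro ⟨⟨h1, h2⟩, h3⟩
    exact ⟨by linarith, by linarith, by linarith⟩

lemma convex_triCell (p : Plane) (ξ y : Plane →L[ℝ] ℝ) (κ δ : ℝ) :
    Convex ℝ (triCell p ξ y κ δ) := by
  intro q hq q' hq' a b ha hb hab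
  have e : a • q + b • q' - p = a • (q - p) + b • (q' - p) := by
    have : p = a • p + b • p := by rw [← add_smul, hab, one_smul]
    conv_lhs => rw [this]
    simp only [smul_sub]
    abel
  obtain ⟨h1, h2⟩ := hq
  obtain ⟨h3, h4⟩ := hq'
  rw [abs_le] at h2 h4
  refine ⟨?_, ?_⟩
  · rw [e]; simp only [map_add, map_smul, smul_eq_mul]
    obtain rfl : b = 1 - a := by linarith
    nlinarith
  · rw [e, abs_le]; simp only [map_add, map_smul, smul_eq_mul]
    constructor <;> nlinarith

/-- Cones around `u` do not depend on the coordinates: in any linear coordinates with `y u = 0` and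
`ξ u > 0`, points with `ξ → 0` from above and `y / ξ → 0` enter the horn of `u`. The horn can thus
be tested on triangles adapted to a side. -/
lemma exists_triCell {ξ y : Plane →L[ℝ] ℝ} (hinj : ∀ w, ξ w = 0 → y w = 0 → w = 0) {u : Plane}
    (hu : ‖u‖ = 1) (hy : y u = 0) (hξ : 0 < ξ u) {s : Set Plane} (hs : s ∈ horn u) :
    ∃ δ > 0, ∀ w, 0 < ξ w → ξ w ≤ δ → |y w| ≤ δ * ξ w → w ∈ s := by
  have hyJ : y (rotJ u) ≠ 0 := by
    intro h0
    have h1 : ξ (ξ (rotJ u) • u - ξ u • rotJ u) = 0 := by simp; ring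
    have h2 : y (ξ (rotJ u) • u - ξ u • rotJ u) = 0 := by simp [h0, hy]
    have h3 := congrArg (cy u) (hinj _ h1 h2)
    simp [cy_self, cy_rotJ hu] at h3
    exact hξ.ne' h3
  set 𝓕 : Filter Plane := comap (fun w => (ξ w, y w / ξ w)) (𝓝[>] (0 : ℝ) ×ˢ 𝓝 (0 : ℝ))
  have t1 : Tendsto ξ 𝓕 (𝓝[>] 0) := tendsto_fst.comp tendsto_comap
  have t2 : Tendsto (fun w => y w / ξ w) 𝓕 (𝓝 0) := tendsto_snd.comp tendsto_comap
  have hpos : ∀ᶠ w in 𝓕, 0 < ξ w := t1.eventually self_mem_nhdsWithin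
  have ey : ∀ w, cy u w = y w / y (rotJ u) := by
    intro w
    have := congrArg y (frame_decomp hu w)
    rw [this]; simp [hy, hyJ]
  have ex : ∀ w, cx u w = (ξ w - cy u w * ξ (rotJ u)) / ξ u := by
    intro w
    have := congrArg ξ (frame_decomp hu w)
    rw [this, eq_div_iff hξ.ne']; simp
  have t3 : Tendsto (fun w => cy u w / ξ w) 𝓕 (𝓝 0) := by
    have := t2.div_const (y (rotJ u))
    rw [zero_div] at this
    refine this.congr fun w => ?_
    rw [ey]; ring
  have t4 : Tendsto (fun w => cx u w / ξ w) 𝓕 (𝓝 (1 / ξ u)) := by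
    have := (tendsto_const_nhds (x := (1 : ℝ)).sub (t3.mul_const (ξ (rotJ u)))).div_const (ξ u)
    rw [zero_mul, sub_zero] at this
    refine this.congr' ?_
    filter_upwards [hpos] with w hw
    rw [ex]; field_simp
  have hle : Tendsto id 𝓕 (horn u) := by
    rw [tendsto_horn_iff]
    refine ⟨tendsto_nhdsWithin_iff.2 ⟨?_, ?_⟩, ?_⟩
    · have := t4.mul (t1.mono_right nhdsWithin_le_nhds)
      rw [mul_zero] at this
      refine this.congr' ?_
      filter_upwards [hpos] with w hw
      simp; field_simp
    · filter_upwards [hpos, t4.eventually (lt_mem_nhds (by positivity))] with w hw hw'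
      exact (div_pos_iff_of_pos_right hw).1 hw'
    · have := t3.div t4 (by positivity)
      rw [zero_div] at this
      refine this.congr' ?_
      filter_upwards [hpos] with w hw
      simp only [id]
      exact div_div_div_cancel_right₀ hw.ne' _ _
  obtain ⟨t, ht, hts⟩ := hle hs
  obtain ⟨A, hA, B, hB, hAB⟩ := mem_prod_iff.1 ht
  obtain ⟨a, ha, hA⟩ := mem_nhdsGT_iff_exists_Ioo_subset.1 hA
  obtain ⟨b, hb, hB⟩ := Metric.mem_nhds_iff.1 hB
  rw [mem_Ioi] at ha
  have hm : 0 < min a b := lt_min ha hb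
  refine ⟨min a b / 2, by positivity, fun w h1 h2 h3 => hts (hAB ⟨hA ⟨h1, ?_⟩, hB ?_⟩)⟩
  · linarith [min_le_left a b]
  · rw [mem_ball_zero_iff, Real.norm_eq_abs, abs_div, abs_of_pos h1, div_lt_iff₀ h1]
    nlinarith [min_le_right a b]

lemma triCell_mem_horn {ξ y : Plane →L[ℝ] ℝ} {u : Plane}
    (hu : ‖u‖ = 1) (hy : y u = 0) (hξ : 0 < ξ u) (p : Plane) {κ δ : ℝ} (hκ : 0 < κ) (hδ : 0 < δ) :
    ∀ᶠ w in horn u, p + w ∈ triCell p ξ y κ δ := by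
  have t1 := tendsto_clm_horn_pos hu hξ
  have t2 := (tendsto_div_horn hu y).div (tendsto_div_horn hu ξ) hξ.ne'
  rw [hy, zero_div] at t2
  filter_upwards [t1.eventually (Ioo_mem_nhdsGT hδ), cx_pos_horn u,
    t2.eventually (Metric.ball_mem_nhds 0 hκ)] with w h1 h2 h3
  rw [Pi.div_apply, div_div_div_cancel_right₀ h2.ne', dist_zero_right, Real.norm_eq_abs, abs_div,
    abs_of_pos h1.1, div_lt_iff₀ h1.1] at h3
  exact ⟨by simpa using h1.2.le, by simpa using h3.le⟩

/-- The points whose position relative to `p` is in `N`. -/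
def around (p : Plane) (N : Set Plane) : Set Plane := {q | q - p ∈ N}

lemma Coverable.of_eventually {X : Set Plane} {p u : Plane}
    (h : ∀ᶠ w in horn u, p + w ∉ X) : ∃ N ∈ horn u, Coverable X (around p N) :=
  ⟨_, h, Coverable.of_disjoint fun w hw => by simpa [around] using hw⟩

/-- A small closed triangle at `p` serves as the region: away from its vertex it lies in the given
cone, and the vertex is `p`. -/
lemma coverable_of_free {X : Set Plane} {p u : Plane} (hu : ‖u‖ = 1) (hp : p ∈ X)
    (h : ∀ᶠ w in horn u, p + w ∈ X) : ∃ N ∈ horn u, Coverable X (around p N) := by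
  have hinj : ∀ w, cx u w = 0 → cy u w = 0 → w = 0 := fun w h1 h2 =>
    frame_ext hu (by rw [h1, map_zero]) (by rw [h2, map_zero])
  have hξ : 0 < cx u u := by rw [cx_self hu]; exact one_pos
  obtain ⟨δ, hδ, h⟩ := exists_triCell hinj hu (cy_self u) hξ h
  refine ⟨_, triCell_mem_horn hu (cy_self u) hξ p hδ hδ,
    Coverable.of_typeI (T := triCell p (cx u) (cy u) δ δ) ⟨polySet_triCell p (cy_self u) hξ hδ δ,
      isSimplyConnected_of_convex (convex_triCell ..) ⟨p, by simp [triCell, hδ.le]⟩⟩ ?_ ?_⟩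
  · rintro q ⟨h1, h2⟩
    rcases (nonneg_of_mul_nonneg_right ((abs_nonneg _).trans h2) hδ).lt_or_eq with h0 | h0
    · simpa using h _ h0 h1 h2
    · rw [← h0, mul_zero] at h2
      have := hinj _ h0.symm (abs_eq_zero.1 (le_antisymm h2 (abs_nonneg _)))
      rwa [sub_eq_zero.1 this]
  · rintro q ⟨-, hq⟩
    simpa [around] using hq

/-! ### Coverings around a direction that touches the boundary -/

namespace Side

/-- If the coordinates `y` of two sides are opposite, then the level of the second one increases
along the fibers of the first one. -/
lemma fiber_monotone {S T : Side} {a b c : ℝ} (hc : c < 0)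
    (hξ : ∀ w, T.ξ w = a * S.ξ w + b * S.y w) (hy : ∀ w, T.y w = c * S.y w) :
    ∀ᶠ r in 𝓝 (0 : Plane) ×ˢ 𝓝 (0 : Plane), S.ξ r.1 = S.ξ r.2 → S.y r.1 ≤ S.y r.2 →
      T.lev r.1 ≤ T.lev r.2 := by
  obtain ⟨ρ, hρ, h⟩ := T.cross_lip a b hc.ne
  have t1 : Tendsto (fun w => |S.ξ w|) (𝓝 0) (𝓝 0) := by
    have : Continuous fun w => |S.ξ w| := by fun_prop
    simpa using this.tendsto 0
  have t2 : Tendsto (fun w => |S.y w|) (𝓝 0) (𝓝 0) := by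
    have : Continuous fun w => |S.y w| := by fun_prop
    simpa using this.tendsto 0
  have h1 := (t1.eventually (gt_mem_nhds hρ)).and (t2.eventually (gt_mem_nhds hρ))
  filter_upwards [h1.prod_mk h1] with ⟨w, w'⟩ ⟨h2, h3⟩ h4 h5
  dsimp only at h4 h5 ⊢
  have := h (S.ξ w) (S.y w) (S.y w') h2.1 h2.2 h3.2
  rw [abs_of_nonneg (sub_nonneg.2 h5), abs_of_neg hc] at this
  have h6 := (abs_le.1 this).1
  unfold lev
  rw [hξ, hξ, hy, hy, ← h4]
  nlinarith [mul_nonneg (neg_pos.2 hc).le (sub_nonneg.2 h5)]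

/-- On the fibers of `S` in a neighbourhood of the direction `u`, the region `0 ≤ L` is convex
below the boundary of `S`. -/
def FiberConvex (u : Plane) (S : Side) (L : Plane → ℝ) : Prop :=
  ∃ V ∈ horn u, ∀ w ∈ V, ∀ v ∈ V, ∀ w' ∈ V, S.ξ v = S.ξ w → S.ξ w' = S.ξ w → 0 ≤ S.lev v →
    v ∈ segment ℝ w w' → 0 ≤ L w → 0 ≤ L w' → 0 ≤ L v

lemma FiberConvex.of_imp {u : Plane} {S : Side} {L : Plane → ℝ}
    (h : ∀ᶠ w in horn u, 0 ≤ S.lev w → 0 ≤ L w) : FiberConvex u S L :=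
  ⟨_, h, fun _ _ _ hv _ _ _ _ h0 _ _ _ => hv h0⟩

/-- Along a fiber the level of `T` increases with `S.y`, so at an intermediate point it is at least
the level at the endpoint with the smaller `S.y`. -/
lemma fiberConvex_of_opposite {u : Plane} (hu : ‖u‖ = 1) {S T : Side} {a b c : ℝ} (hc : c < 0)
    (hξ : ∀ w, T.ξ w = a * S.ξ w + b * S.y w) (hy : ∀ w, T.y w = c * S.y w) :
    FiberConvex u S T.lev := by
  obtain ⟨V, hV, V', hV', h⟩ := mem_prod_iff.1 (fiber_monotone hc hξ hy)
  refine ⟨_, horn_le_nhds hu (inter_mem hV hV'), fun w hw v hv w' hw' h1 h2 _ h3 h4 h5 => ?_⟩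
  obtain ⟨s, t, hs, ht, hst, rfl⟩ := h3
  have e : S.y (s • w + t • w') = s * S.y w + t * S.y w' := by simp
  obtain rfl : s = 1 - t := by linarith
  rcases le_total (S.y w) (S.y w') with h6 | h6
  · refine h4.trans (h (mk_mem_prod hw.1 hv.2) h1.symm ?_)
    dsimp only
    rw [e]; nlinarith
  · refine h5.trans (h (mk_mem_prod hw'.1 hv.2) (h2.trans h1.symm) ?_)
    dsimp only
    rw [e]; nlinarith

end Side

/-- The boundary arc of a side starts in the direction that it touches. -/
lemma Side.Tang.eventually_arc {S : Side} {u : Plane} (hu : ‖u‖ = 1) (hT : S.Tang u) {s : Set Plane}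
    (hs : s ∈ horn u) :
    ∀ᶠ h in 𝓝[>] 0, ∀ w, S.ξ w = h → S.y w = S.ψ.eval h → w ∈ s := by
  obtain ⟨δ, hδ, h⟩ := exists_triCell S.inj hu hT.1 hT.2 hs
  obtain ⟨K, hK, hquad⟩ := S.quad_bound
  have hm : 0 < min (min δ 1) (δ / K) := by positivity
  filter_upwards [Ioo_mem_nhdsGT hm] with r hr w hξ hy
  have h1 : r < δ := hr.2.trans_le ((min_le_left _ _).trans (min_le_left _ _))
  have h2 : r < 1 := hr.2.trans_le ((min_le_left _ _).trans (min_le_right _ _))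
  have h3 : r * K < δ := (lt_div_iff₀ hK).1 (hr.2.trans_le (min_le_right _ _))
  have h0 : 0 < r := hr.1
  refine h w (hξ ▸ h0) (hξ ▸ h1.le) ?_
  rw [hξ, hy]
  refine (hquad r (by rw [abs_of_pos h0]; exact h2.le)).trans ?_
  nlinarith

/-- A point of `X` in a direction along which one of the boundary arcs stays in `X` has a covering
around this direction. -/
lemma coverable_of_arc {n : ℕ} (G : Fin n → PolyHalfPlane) {p u : Plane} (hu : ‖u‖ = 1)
    (hp : p ∈ interHalfPlanes G) (i : Fin n) (hi : (G i).lev p = 0) (σ : ℤˣ)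
    (hT : ((G i).side p σ).Tang u)
    (harc : ∀ l, ∀ᶠ h in 𝓝[>] 0, 0 ≤ (G l).lev ((G i).graphPoint ((G i).fx p + ((σ : ℤ) : ℝ) * h)))
    (hconv : ∀ l, Side.FiberConvex u ((G i).side p σ) (fun w => (G l).lev (p + w))) :
    ∃ N ∈ horn u, Coverable (interHalfPlanes G) (around p N) := by
  set S := (G i).side p σ with hS
  choose V hV hVc using hconv
  have hVall : ⋂ l, V l ∈ horn u := iInter_mem.2 hV
  obtain ⟨κ, hκ, hcell⟩ := exists_triCell S.inj hu hT.1 hT.2 hVall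
  obtain ⟨K, hK, hquad⟩ := S.quad_bound
  obtain ⟨ρ, hρ, harc'⟩ := mem_nhdsGT_iff_exists_Ioo_subset.1 (eventually_all.2 harc)
  rw [mem_Ioi] at hρ
  -- The bounds ensure in turn that the triangle lies in the sets of fiber convexity, that the arc
  -- lies in the set, that the quadratic bound applies, and that the arc stays within slope `κ`.
  obtain ⟨δ, hδ, hδκ, hδρ, hδ1, hδK⟩ : ∃ δ > 0, δ ≤ κ ∧ δ < ρ ∧ δ ≤ 1 ∧ K * δ ≤ κ := by
    refine ⟨min (min κ (ρ / 2)) (min 1 (κ / K)), by positivity, ?_, ?_, ?_, ?_⟩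
    · exact (min_le_left _ _).trans (min_le_left _ _)
    · exact ((min_le_left _ _).trans (min_le_right _ _)).trans_lt (by linarith)
    · exact (min_le_right _ _).trans (min_le_left _ _)
    · rw [mul_comm, ← le_div_iff₀ hK]
      exact (min_le_right _ _).trans (min_le_right _ _)
  set C := triCell p S.ξ S.y κ δ with hC
  refine ⟨_, triCell_mem_horn hu hT.1 hT.2 p hκ hδ,
    Coverable.of_typeI (T := interHalfPlanes G ∩ C)
      ⟨(polySet_interHalfPlanes G).inter (polySet_triCell p hT.1 hT.2 hκ δ), ?_⟩
      inter_subset_left fun q hq => ⟨hq.1, by simpa [around] using hq.2⟩⟩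
  have hCnn : ∀ q ∈ C, 0 ≤ S.ξ (q - p) := fun q hq =>
    nonneg_of_mul_nonneg_right ((abs_nonneg _).trans hq.2) hκ
  have hC0 : ∀ q ∈ C, S.ξ (q - p) = 0 → q = p := fun q hq h0 => by
    have h1 := hq.2
    rw [h0, mul_zero] at h1
    exact sub_eq_zero.1 (S.inj _ h0 (abs_eq_zero.1 (le_antisymm h1 (abs_nonneg _))))
  have hCV : ∀ q ∈ C, S.ξ (q - p) ≠ 0 → ∀ l, q - p ∈ V l := fun q hq h0 =>
    mem_iInter.1 (hcell _ ((hCnn q hq).lt_of_ne' h0) (hq.1.trans hδκ) hq.2)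
  -- The boundary arc of `G i`, parametrized by the coordinate `S.ξ` so as to be a section of it.
  set β : ℝ → Plane := fun t => (G i).graphPoint ((G i).fx p + ((σ : ℤ) : ℝ) * (t - S.ξ p)) with hβ
  have hβξ : ∀ t, S.ξ (β t) = t := by
    intro t
    rw [hS, PolyHalfPlane.side_ξ, hβ, PolyHalfPlane.fx_graphPoint, mul_add, ← mul_assoc,
      PolyHalfPlane.unit_sq_real, PolyHalfPlane.side_ξ]
    ring
  have hβy : ∀ t, S.y (β t - p) = S.ψ.eval (t - S.ξ p) := by
    intro t
    have h1 := (G i).lev_graphPoint ((G i).fx p + ((σ : ℤ) : ℝ) * (t - S.ξ p))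
    have h2 := (G i).lev_add hi σ (β t - p)
    rw [add_sub_cancel, h1, Side.lev, map_sub, hβξ] at h2
    linarith
  refine isSimplyConnected_of_fibers S.ξ (J := Icc (S.ξ p) (S.ξ p + δ)) (convex_Icc _ _)
    ⟨S.ξ p, by simp [hδ.le]⟩ (β := β) ?_ ?_ (fun t _ => hβξ t) ?_ ?_
  · exact (G i).continuous_graphPoint.comp (by fun_prop)
  · rintro t ⟨ht1, ht2⟩
    have habs : |t - S.ξ p| ≤ 1 := by rw [abs_of_nonneg (by linarith)]; linarith
    refine ⟨?_, ?_, ?_⟩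
    · rcases ht1.eq_or_lt with h0 | h0
      · rw [← h0]
        have : β (S.ξ p) = p := by
          rw [hβ]; simp only [sub_self, mul_zero, add_zero]
          exact ((G i).eq_graphPoint hi).symm
        rwa [this]
      · exact mem_interHalfPlanes.2 (harc' ⟨sub_pos.2 h0, by linarith⟩)
    · rw [map_sub, hβξ]; linarith
    · rw [hβy, map_sub, hβξ]
      refine (hquad _ habs).trans ?_
      have h0 : 0 ≤ t - S.ξ p := by linarith
      have h1 : K * (t - S.ξ p) ≤ κ :=
        (mul_le_mul_of_nonneg_left (by linarith) hK.le).trans hδK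
      nlinarith [mul_le_mul_of_nonneg_right h1 h0]
  · rintro w ⟨-, hw⟩
    have h1 := hCnn w hw
    have h2 := hw.1
    rw [map_sub] at h1 h2
    exact ⟨by linarith, by linarith⟩
  · rintro w ⟨hwX, hwC⟩ w' ⟨hwX', hwC'⟩ hww q hq
    have hqC : q ∈ C := (convex_triCell p S.ξ S.y κ δ).segment_subset hwC hwC' hq
    refine ⟨mem_interHalfPlanes.2 fun l => ?_, hqC⟩
    have hqs : q - p ∈ segment ℝ (w - p) (w' - p) := by
      simpa only [sub_eq_neg_add] using (mem_segment_translate ℝ (-p)).2 hq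
    have hξq : S.ξ (q - p) = S.ξ (w - p) := by
      obtain ⟨s, t, -, -, hst, rfl⟩ := hq
      simp only [map_sub, map_add, map_smul, smul_eq_mul, ← hww]
      linear_combination (S.ξ w) * hst
    have hξw : S.ξ (w' - p) = S.ξ (w - p) := by rw [map_sub, map_sub, hww]
    -- The fiber through the vertex is the single point `p`, where the horn conditions say nothing.
    by_cases h0 : S.ξ (w - p) = 0
    · rw [hC0 q hqC (hξq.trans h0)]
      exact mem_interHalfPlanes.1 hp l
    · have hlevw : 0 ≤ S.lev (w - p) := by
        rw [← (G i).lev_add hi σ, add_sub_cancel]; exact mem_interHalfPlanes.1 hwX i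
      have hlevw' : 0 ≤ S.lev (w' - p) := by
        rw [← (G i).lev_add hi σ, add_sub_cancel]; exact mem_interHalfPlanes.1 hwX' i
      have hlev : 0 ≤ S.lev (q - p) := by
        obtain ⟨s, t, hs, ht, hst, hst'⟩ := hqs
        unfold Side.lev at hlevw hlevw' ⊢
        rw [hξw] at hlevw'
        rw [hξq, ← hst', map_add, map_smul, map_smul, smul_eq_mul, smul_eq_mul]
        obtain rfl : s = 1 - t := by linarith
        nlinarith
      have := hVc l (w - p) (hCV w hwC h0 l) (q - p) (hCV q hqC (hξq ▸ h0) l) (w' - p)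
        (hCV w' hwC' (hξw ▸ h0) l) hξq hξw hlev hqs
      simp only [add_sub_cancel] at this
      exact this (mem_interHalfPlanes.1 hwX l) (mem_interHalfPlanes.1 hwX' l)

/-- Every point of `X` has coverings around all directions. -/
lemma coverable_around {n : ℕ} (G : Fin n → PolyHalfPlane) {p u : Plane} (hu : ‖u‖ = 1)
    (hp : p ∈ interHalfPlanes G) :
    ∃ N ∈ horn u, Coverable (interHalfPlanes G) (around p N) := by
  classical
  by_cases hneg : ∃ l, ∀ᶠ w in horn u, (G l).lev (p + w) < 0
  · obtain ⟨l, hl⟩ := hneg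
    exact Coverable.of_eventually (hl.mono fun w hw h => hw.not_ge (mem_interHalfPlanes.1 h l))
  have hcl := fun l => (G l).free_or_tang hu (mem_interHalfPlanes.1 hp l) (not_exists.1 hneg l)
  set S : Fin n → Side := fun l => (G l).side p ((G l).orient u)
  by_cases htan : ∃ l, (G l).lev p = 0 ∧ (S l).Tang u
  swap
  · refine coverable_of_free hu hp ?_
    simp only [mem_interHalfPlanes, eventually_all]
    exact fun l => ((hcl l).resolve_right (not_exists.1 htan l)).mono fun w hw => hw.le
  obtain ⟨i₀, hi₀⟩ := htan
  set U : Finset (Fin n) := Finset.univ.filter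
    (fun l => ((G l).lev p = 0 ∧ (S l).Tang u) ∧ 0 < (S i₀).y (rotJ u) * (S l).y (rotJ u)) with hU
  have hUmem : ∀ l, l ∈ U ↔ ((G l).lev p = 0 ∧ (S l).Tang u) ∧
      0 < (S i₀).y (rotJ u) * (S l).y (rotJ u) := fun l => by simp [hU]
  obtain ⟨i, hiU, hdom⟩ := exists_dominating S hu U (i₀ := i₀)
    ((hUmem _).2 ⟨hi₀, mul_self_pos.2 ((S i₀).y_rotJ_ne_zero hu hi₀.2.1)⟩)
    (fun l hl => ((hUmem l).1 hl).1.2) (fun l hl => ((hUmem l).1 hl).2)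
  obtain ⟨⟨hi, hT⟩, hiy⟩ := (hUmem i).1 hiU
  -- If some half plane is disjoint from the dominating region near `u`, the set is empty there and
  -- nothing has to be covered.
  by_cases hbad : ∃ l, (G l).lev p = 0 ∧ ∀ᶠ w in horn u, 0 ≤ (S i).lev w → (S l).lev w < 0
  · obtain ⟨l, hl, hbad⟩ := hbad
    refine Coverable.of_eventually (hbad.mono fun w hw h => ?_)
    rw [mem_interHalfPlanes] at h
    have h1 := h i
    have h2 := h l
    rw [(G i).lev_add hi ((G i).orient u)] at h1
    rw [(G l).lev_add hl ((G l).orient u)] at h2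
    exact (hw h1).not_ge h2
  -- the half planes are implied by the dominating one, or bound the fibers from the other side
  have hkey : ∀ l, (∀ᶠ w in horn u, 0 ≤ (S i).lev w → 0 ≤ (G l).lev (p + w)) ∨
      ((G l).lev p = 0 ∧ ∃ a b c : ℝ, c < 0 ∧ (∀ w, (S l).ξ w = a * (S i).ξ w + b * (S i).y w) ∧
        (∀ w, (S l).y w = c * (S i).y w) ∧
        ∀ᶠ h in 𝓝[>] 0, 0 ≤ (Side.along (S i) (S l) a b c).eval h) := by
    intro l
    rcases hcl l with hfree | ⟨hl, hlT⟩
    · exact .inl (hfree.mono fun w hw _ => hw.le)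
    by_cases hlU : l ∈ U
    · left
      obtain ⟨c, hc, h⟩ := hdom l hlU
      filter_upwards [h] with w hw h0
      rw [(G l).lev_add hl ((G l).orient u)]
      exact (mul_nonneg hc.le h0).trans (hw h0)
    · right
      obtain ⟨a, b, -, hξ, hy⟩ := Side.exists_coeffs hu hT hlT
      have hc : (S l).y (rotJ u) / (S i).y (rotJ u) < 0 := by
        have h1 : (S i₀).y (rotJ u) * (S l).y (rotJ u) ≤ 0 :=
          not_lt.1 fun h => hlU ((hUmem l).2 ⟨⟨hl, hlT⟩, h⟩)
        have h2 := (S l).y_rotJ_ne_zero hu hlT.1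
        have h3 := (S i₀).y_rotJ_ne_zero hu hi₀.2.1
        have h4 : (S i₀).y (rotJ u) * (S l).y (rotJ u) < 0 := h1.lt_of_ne (mul_ne_zero h3 h2)
        rcases h3.lt_or_gt with h5 | h5
        · exact div_neg_of_pos_of_neg (by nlinarith) (by nlinarith)
        · exact div_neg_of_neg_of_pos (by nlinarith) (by nlinarith)
      refine ⟨hl, a, b, _, hc, hξ, hy, ?_⟩
      exact (Side.opposite_alternative hu hT hc hξ hy).resolve_right fun h => hbad ⟨l, hl, h⟩
  have harc0 : ∀ h : ℝ, (S i).ξ ((G i).graphPoint ((G i).fx p + (((G i).orient u : ℤ) : ℝ) * h) - p)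
      = h ∧ (S i).y ((G i).graphPoint ((G i).fx p + (((G i).orient u : ℤ) : ℝ) * h) - p)
      = (S i).ψ.eval h := by
    intro h
    have h1 : (S i).ξ ((G i).graphPoint ((G i).fx p + (((G i).orient u : ℤ) : ℝ) * h) - p) = h := by
      rw [PolyHalfPlane.side_ξ, map_sub, PolyHalfPlane.fx_graphPoint, add_sub_cancel_left,
        ← mul_assoc, PolyHalfPlane.unit_sq_real, one_mul]
    refine ⟨h1, ?_⟩
    have h2 := (G i).lev_add hi ((G i).orient u)
      ((G i).graphPoint ((G i).fx p + (((G i).orient u : ℤ) : ℝ) * h) - p)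
    rw [add_sub_cancel, PolyHalfPlane.lev_graphPoint, Side.lev, h1] at h2
    linarith
  refine coverable_of_arc G hu hp i hi _ hT (fun l => ?_) fun l => ?_
  · rcases hkey l with h | ⟨hl, a, b, c, hc, hξ, hy, h⟩
    · filter_upwards [hT.eventually_arc hu h] with r hr
      obtain ⟨h1, h2⟩ := harc0 r
      have := hr _ h1 h2
      rw [add_sub_cancel, Side.lev, h1, h2, sub_self] at this
      exact this le_rfl
    · filter_upwards [h] with r hr
      obtain ⟨h1, h2⟩ := harc0 r
      have h3 := (G l).lev_add hl ((G l).orient u)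
        ((G i).graphPoint ((G i).fx p + (((G i).orient u : ℤ) : ℝ) * r) - p)
      rw [add_sub_cancel] at h3
      rw [h3]
      change 0 ≤ (S l).lev _
      rw [Side.along_eval] at hr
      rwa [Side.lev, hξ, hy, h1, h2]
  · rcases hkey l with h | ⟨hl, a, b, c, hc, hξ, hy, h⟩
    · exact Side.FiberConvex.of_imp h
    · simp only [(G l).lev_add hl ((G l).orient u)]
      exact Side.fiberConvex_of_opposite hu hc hξ hy

/-! ### Compactness arguments for coverings -/

/-- If all directions have coverable neighbourhoods, then an annulus is coverable. -/
lemma coverable_annulus {X : Set Plane} {p : Plane} {𝓡 : Filter ℝ}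
    (h : ∀ u : Plane, ‖u‖ = 1 → ∃ R ∈ 𝓡, ∃ D ∈ 𝓝 u,
      Coverable X {q | ‖q - p‖ ∈ R ∧ ‖q - p‖⁻¹ • (q - p) ∈ D}) :
    ∃ R ∈ 𝓡, Coverable X {q | ‖q - p‖ ∈ R ∧ q ≠ p} := by
  have := (isCompact_sphere (0 : Plane) 1).induction_on
    (p := fun D => ∃ R ∈ 𝓡, Coverable X {q | ‖q - p‖ ∈ R ∧ ‖q - p‖⁻¹ • (q - p) ∈ D}) ?_ ?_ ?_ ?_
  · obtain ⟨R, hR, h⟩ := this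
    refine ⟨R, hR, h.mono fun q hq => ⟨hq.1, ?_⟩⟩
    have : ‖q - p‖ ≠ 0 := norm_ne_zero_iff.2 (sub_ne_zero.2 hq.2)
    rw [mem_sphere_zero_iff_norm, norm_smul, norm_inv, norm_norm, inv_mul_cancel₀ this]
  · exact ⟨univ, univ_mem, by simpa using Coverable.empty⟩
  · rintro D D' hD ⟨R, hR, h⟩
    exact ⟨R, hR, h.mono fun q hq => ⟨hq.1, hD hq.2⟩⟩
  · rintro D D' ⟨R, hR, h⟩ ⟨R', hR', h'⟩
    refine ⟨R ∩ R', inter_mem hR hR', (h.union h').mono ?_⟩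
    rintro q ⟨⟨hq, hq'⟩, hqD | hqD⟩
    · exact .inl ⟨hq, hqD⟩
    · exact .inr ⟨hq', hqD⟩
  · intro u hu
    obtain ⟨R, hR, D, hD, h⟩ := h u (mem_sphere_zero_iff_norm.1 hu)
    exact ⟨D, mem_nhdsWithin_of_mem_nhds hD, R, hR, h⟩

/-- The open cone of slope `δ` around `u` is a neighbourhood of `u`. -/
lemma sector_mem_nhds {u : Plane} (hu : ‖u‖ = 1) {δ : ℝ} (hδ : 0 < δ) :
    {d | 1 / 2 < cx u d ∧ |cy u d| < δ * cx u d} ∈ 𝓝 u := by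
  have c1 : Continuous fun w => cx u w := (cx u).continuous
  have c2 : Continuous fun w => |cy u w| := (cy u).continuous.abs
  refine ((isOpen_lt continuous_const c1).inter (isOpen_lt c2 (continuous_const.mul c1))).mem_nhds
    ⟨?_, ?_⟩
  · rw [mem_ofPred_eq, cx_self hu]; norm_num
  · change |cy u u| < δ * cx u u
    rw [cx_self hu, cy_self]; simpa using hδ

lemma sector_bounds {u : Plane} {δ : ℝ} {w : Plane} (hw : 0 < ‖w‖)
    (h : ‖w‖⁻¹ • w ∈ {d | 1 / 2 < cx u d ∧ |cy u d| < δ * cx u d}) :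
    ‖w‖ / 2 < cx u w ∧ |cy u w| < δ * cx u w := by
  obtain ⟨h1, h2⟩ := h
  rw [map_smul, smul_eq_mul, inv_mul_eq_div] at h1 h2
  rw [map_smul, smul_eq_mul, inv_mul_eq_div, abs_div, abs_of_pos hw, mul_div_assoc',
    div_lt_div_iff_of_pos_right hw] at h2
  rw [lt_div_iff₀ hw] at h1
  exact ⟨by linarith, h2⟩

/-- A point is a triangle of height `0`. -/
lemma typeI_singleton (p : Plane) : TypeISet {p} := by
  have hu : ‖(!₂[1, 0] : Plane)‖ = 1 := by
    have : ‖(!₂[1, 0] : Plane)‖ ^ 2 = 1 := by rw [norm_sq_plane]; simp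
    nlinarith [norm_nonneg (!₂[1, 0] : Plane)]
  set u : Plane := !₂[1, 0]
  refine ⟨?_, isSimplyConnected_of_convex (convex_singleton p) (singleton_nonempty p)⟩
  convert polySet_triCell p (cy_self u) (by rw [cx_self hu]; exact one_pos) one_pos 0 using 1
  ext q
  rw [mem_singleton_iff, triCell, mem_ofPred_eq]
  constructor
  · rintro rfl; simp
  · rintro ⟨h1, h2⟩
    have h3 := (abs_nonneg _).trans h2
    rw [one_mul] at h2 h3
    have h4 := le_antisymm h1 h3
    rw [h4] at h2
    have h5 := abs_eq_zero.1 (le_antisymm h2 (abs_nonneg _))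
    exact sub_eq_zero.1 (frame_ext hu (by rw [h4, map_zero]) (by rw [h5, map_zero]))

/-- Finitely many directions suffice for a punctured neighbourhood; the point itself, if it belongs
to the set, is added as a region of its own. -/
lemma coverable_nhds {n : ℕ} (G : Fin n → PolyHalfPlane) (p : Plane) :
    ∃ N ∈ 𝓝 p, Coverable (interHalfPlanes G) N := by
  by_cases hp : p ∈ interHalfPlanes G
  swap
  · exact ⟨_, (isClosed_inter G).isOpen_compl.mem_nhds hp, Coverable.of_disjoint fun w hw => hw⟩
  obtain ⟨R, hR, h⟩ := coverable_annulus (X := interHalfPlanes G) (p := p) (𝓡 := 𝓝[>] 0) (by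
    intro u hu
    obtain ⟨N, hN, h⟩ := coverable_around G hu hp
    obtain ⟨δ, hδ, hδN⟩ := mem_horn_iff.1 hN
    refine ⟨Ioo 0 δ, Ioo_mem_nhdsGT hδ, _, sector_mem_nhds hu hδ, h.mono ?_⟩
    rintro q ⟨hq1, hq2⟩
    obtain ⟨h1, h2⟩ := sector_bounds hq1.1 hq2
    exact hδN _ ((by linarith [hq1.1] : (0 : ℝ) < ‖q - p‖ / 2).trans h1)
      (((le_abs_self _).trans (abs_cx_le hu _)).trans_lt hq1.2) h2)
  obtain ⟨r, hr, hrR⟩ := mem_nhdsGT_iff_exists_Ioo_subset.1 hR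
  refine ⟨Metric.ball p r, Metric.ball_mem_nhds p hr, (h.union (Coverable.of_typeI (S := {p})
    (typeI_singleton p) (singleton_subset_iff.2 hp) inter_subset_right)).mono fun q hq => ?_⟩
  rw [Metric.mem_ball, dist_eq_norm] at hq
  by_cases hqp : q = p
  · exact .inr hqp
  · exact .inl ⟨hrR ⟨norm_pos_iff.2 (sub_ne_zero.2 hqp), hq⟩, hqp⟩

lemma coverable_compact {n : ℕ} (G : Fin n → PolyHalfPlane) {K : Set Plane} (hK : IsCompact K) :
    Coverable (interHalfPlanes G) K := by
  refine hK.induction_on Coverable.empty (fun _ _ h h' => h'.mono h) (fun _ _ h h' => h.union h') ?_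
  intro p _
  obtain ⟨N, hN, h⟩ := coverable_nhds G p
  exact ⟨N, mem_nhdsWithin_of_mem_nhds hN, h⟩

/-! ### Regions bounded by graphs in the same frame -/

/-- A finite system of inequalities `a i * y ≤ p i` that has a solution is solved by `0` or by one
of the bounds. -/
lemma exists_extremal_solution {ι : Type*} [Finite ι] {a p : ι → ℝ} {y : ℝ}
    (h : ∀ i, a i * y ≤ p i) :
    (∀ i, a i * 0 ≤ p i) ∨ ∃ k, ∀ i, a i * ((a k)⁻¹ * p k) ≤ p i := by
  classical
  cases nonempty_fintype ι
  by_cases ha : ∀ i, a i = 0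
  · left
    intro i
    have := h i
    rw [ha i] at this ⊢
    linarith
  right
  obtain ⟨i₀, hi₀⟩ := not_forall.1 ha
  -- The bound `(a k)⁻¹ * p k` nearest to the solution `y` is taken: moving from `y` to it passes
  -- strictly beyond no other bound.
  obtain ⟨k, hk, hmin⟩ := (Finset.univ.filter (fun i => a i ≠ 0)).exists_min_image
    (fun i => |(a i)⁻¹ * p i - y|) ⟨i₀, by simp [hi₀]⟩
  simp only [Finset.mem_filter, Finset.mem_univ, true_and] at hk hmin
  refine ⟨k, fun i => ?_⟩
  set z := (a k)⁻¹ * p k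
  rcases lt_trichotomy (a i) 0 with hi | hi | hi
  · have e : p i = a i * ((a i)⁻¹ * p i) := (mul_inv_cancel_left₀ hi.ne _).symm
    have h1 := hmin i hi.ne
    have h2 := h i
    set e' := (a i)⁻¹ * p i
    rw [e] at h2 ⊢
    have h3 : e' ≤ y := (mul_le_mul_left_of_neg hi).1 h2
    rw [abs_of_nonpos (sub_nonpos.2 h3)] at h1
    exact mul_le_mul_of_nonpos_left (by linarith [neg_abs_le (z - y)]) hi.le
  · have := h i
    rw [hi] at this ⊢
    linarith
  · have e : p i = a i * ((a i)⁻¹ * p i) := (mul_inv_cancel_left₀ hi.ne' _).symm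
    have h1 := hmin i hi.ne'
    have h2 := h i
    set e' := (a i)⁻¹ * p i
    rw [e] at h2 ⊢
    have h3 : y ≤ e' := le_of_mul_le_mul_left h2 hi
    rw [abs_of_nonneg (sub_nonneg.2 h3)] at h1
    exact mul_le_mul_of_nonneg_left (by linarith [le_abs_self (z - y)]) hi.le

/-- Along a germ of an interval, the region bounded by finitely many graphs of polynomials contains
the graph of a polynomial or is empty. -/
lemma PolyGerm.exists_section {𝓕 : Filter ℝ} (h𝓕 : PolyGerm 𝓕) {ι : Type*} [Finite ι] (a : ι → ℝ)
    (P : ι → ℝ[X]) : (∃ q : ℝ[X], ∀ᶠ x in 𝓕, ∀ i, a i * q.eval x ≤ (P i).eval x) ∨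
      ∀ᶠ x in 𝓕, ∀ y, ¬ ∀ i, a i * y ≤ (P i).eval x := by
  by_cases hq : ∃ q : ℝ[X], ∀ᶠ x in 𝓕, ∀ i, a i * q.eval x ≤ (P i).eval x
  · exact .inl hq
  right
  have hbad : ∀ q : ℝ[X], ∀ᶠ x in 𝓕, ¬ ∀ i, a i * q.eval x ≤ (P i).eval x := by
    intro q
    have h1 := not_exists.1 hq q
    rw [eventually_all, not_forall] at h1
    obtain ⟨i, hi⟩ := h1
    have h2 := (h𝓕 (P i - C (a i) * q)).resolve_left fun h => hi (h.mono fun x hx => by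
      simpa using hx)
    refine h2.mono fun x hx h => ?_
    have := h i
    simp at hx
    linarith
  -- Any solution yields an extremal one, namely `0` or some `(a k)⁻¹ * P k`. These finitely many
  -- candidates are polynomials in `x`, and all of them eventually fail.
  filter_upwards [hbad 0, eventually_all.2 fun k => hbad (C (a k)⁻¹ * P k)] with x h1 h2 y hy
  rcases exists_extremal_solution hy with h | ⟨k, h⟩
  · exact h1 (by simpa using h)
  · exact h2 k (by simpa using h)

section

variable {u : Plane} {ι : Type*} {a : ι → ℝ} {P : ι → ℝ[X]} {Z : Set Plane}

lemma cy_ne_zero (hu : ‖u‖ = 1) : cy u ≠ 0 := fun h => by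
  have := cy_rotJ hu
  rw [h] at this
  simp at this

lemma polySet_cy_le (hu : ‖u‖ = 1) (c : ℝ) : PolySet {w | cy u w ∈ Iic c} :=
  polySet_linear (cy_ne_zero hu) c

lemma polySet_cy_ge (hu : ‖u‖ = 1) (c : ℝ) : PolySet {w | cy u w ∈ Ici c} := by
  convert polySet_linear (neg_ne_zero.2 (cy_ne_zero hu)) (-c) using 1
  ext w
  simp

lemma polySet_cy_Icc (hu : ‖u‖ = 1) (c d : ℝ) : PolySet {w | cy u w ∈ Icc c d} := by
  convert (polySet_cy_ge hu c).inter (polySet_cy_le hu d) using 1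
  ext w; rfl

lemma segment_in_fiber (hZ : ∀ w, w ∈ Z ↔ ∀ i, a i * cx u w ≤ (P i).eval (cy u w)) {w w' : Plane}
    (hw : w ∈ Z) (hw' : w' ∈ Z) (h : cy u w = cy u w') {q : Plane} (hq : q ∈ segment ℝ w w') :
    q ∈ Z ∧ cy u q = cy u w := by
  obtain ⟨s, t, hs, ht, hst, rfl⟩ := hq
  have e : cy u (s • w + t • w') = cy u w := by
    simp only [map_add, map_smul, smul_eq_mul, ← h]
    linear_combination (cy u w) * hst
  refine ⟨(hZ _).2 fun i => ?_, e⟩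
  have h1 := (hZ w).1 hw i
  have h2 := (hZ w').1 hw' i
  rw [← h] at h2
  rw [e]
  simp only [map_add, map_smul, smul_eq_mul]
  obtain rfl : s = 1 - t := by linarith
  nlinarith

variable [Finite ι]

/-- On a slab the fibers of constant `cy u` are convex because the inequalities are affine in `cx
u`, and a polynomial provides a section, which extends to the closed slab by continuity. Without
such a section the slab is eventually empty. -/
lemma coverable_slab (hu : ‖u‖ = 1) (hZp : PolySet Z)
    (hZ : ∀ w, w ∈ Z ↔ ∀ i, a i * cx u w ≤ (P i).eval (cy u w)) {𝓕 : Filter ℝ} (h𝓕 : PolyGerm 𝓕)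
    (hbasis : ∀ s ∈ 𝓕, ∃ t ∈ 𝓕, t ⊆ s ∧ Convex ℝ t ∧ t.Nonempty ∧
      PolySet {w | cy u w ∈ closure t}) :
    ∃ t ∈ 𝓕, Coverable Z {w | cy u w ∈ t} := by
  rcases h𝓕.exists_section a P with ⟨q, hq⟩ | hempty
  · obtain ⟨t, ht, hts, hconv, hne, hpoly⟩ := hbasis _ hq
    have hcl : closure t ⊆ {x | ∀ i, a i * q.eval x ≤ (P i).eval x} := by
      refine closure_minimal hts ?_
      simp only [ofPred_forall]
      exact isClosed_iInter fun i => isClosed_le (by fun_prop) (by fun_prop)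
    refine ⟨t, ht, Coverable.of_typeI (T := Z ∩ {w | cy u w ∈ closure t})
      ⟨hZp.inter hpoly, isSimplyConnected_of_fibers (cy u) hconv.closure hne.closure
        (β := fun x => q.eval x • u + x • rotJ u) (by fun_prop) ?_ ?_ ?_ ?_⟩ inter_subset_left ?_⟩
    · intro x hx
      refine ⟨(hZ _).2 fun i => ?_, ?_⟩
      · simpa [cx_self hu, cx_rotJ, cy_self, cy_rotJ hu] using hcl hx i
      · simpa [cy_self, cy_rotJ hu] using hx
    · intro x _
      simp [cy_self, cy_rotJ hu]
    · exact fun w hw => hw.2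
    · rintro w ⟨hw, hwt⟩ w' ⟨hw', -⟩ h r hr
      obtain ⟨h1, h2⟩ := segment_in_fiber hZ hw hw' h hr
      exact ⟨h1, by rw [mem_ofPred_eq, h2]; exact hwt⟩
    · exact fun w hw => ⟨hw.1, subset_closure hw.2⟩
  · exact ⟨_, hempty, Coverable.of_disjoint fun w hw hwZ => hw _ ((hZ w).1 hwZ)⟩

/-- A region bounded by graphs of polynomials in the same frame is a finite union of regions of
type I. -/
lemma coverable_same_frame (hu : ‖u‖ = 1) (hZp : PolySet Z)
    (hZ : ∀ w, w ∈ Z ↔ ∀ i, a i * cx u w ≤ (P i).eval (cy u w)) : Coverable Z univ := by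
  have hloc : ∀ x : ℝ, ∃ N ∈ 𝓝 x, Coverable Z {w | cy u w ∈ N} := by
    intro x
    obtain ⟨A, hA, hA'⟩ := coverable_slab hu hZp hZ (polyGerm_right x) (fun s hs => by
      obtain ⟨b, hb, hbs⟩ := mem_nhdsGT_iff_exists_Ioo_subset.1 hs
      refine ⟨Ioo x b, Ioo_mem_nhdsGT hb, hbs, convex_Ioo x b, nonempty_Ioo.2 hb, ?_⟩
      rw [closure_Ioo (ne_of_lt hb)]
      exact polySet_cy_Icc hu x b)
    obtain ⟨B, hB, hB'⟩ := coverable_slab hu hZp hZ (polyGerm_left x) (fun s hs => by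
      obtain ⟨b, hb, hbs⟩ := mem_nhdsLT_iff_exists_Ioo_subset.1 hs
      refine ⟨Ioo b x, Ioo_mem_nhdsLT hb, hbs, convex_Ioo b x, nonempty_Ioo.2 hb, ?_⟩
      rw [closure_Ioo (ne_of_lt hb)]
      exact polySet_cy_Icc hu b x)
    have hx : Coverable Z {w | cy u w ∈ Icc x x} := by
      rcases (Z ∩ {w | cy u w ∈ Icc x x}).eq_empty_or_nonempty with h | h
      · exact Coverable.of_disjoint fun w hw hwZ => h.le ⟨hwZ, hw⟩
      · refine Coverable.of_typeI ⟨hZp.inter (polySet_cy_Icc hu x x),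
          isSimplyConnected_of_convex ?_ h⟩ inter_subset_left subset_rfl
        rw [convex_iff_segment_subset]
        rintro w ⟨hw, hwx⟩ w' ⟨hw', hwx'⟩ r hr
        rw [mem_ofPred_eq, Icc_self, mem_singleton_iff] at hwx hwx'
        obtain ⟨h1, h2⟩ := segment_in_fiber hZ hw hw' (hwx.trans hwx'.symm) hr
        exact ⟨h1, by rw [mem_ofPred_eq, Icc_self, h2]; exact hwx⟩
    refine ⟨_, union_mem_nhds hA hB, ((hA'.union hB').union hx).mono ?_⟩
    rintro w ((hw | hw) | hw)
    · exact .inl (.inl hw)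
    · exact .inl (.inr hw)
    · exact .inr (by rw [mem_ofPred_eq, Icc_self]; exact hw)
  obtain ⟨A, hA, hA'⟩ := coverable_slab hu hZp hZ polyGerm_atTop (fun s hs => by
    obtain ⟨b, hb⟩ := mem_atTop_sets.1 hs
    refine ⟨Ioi b, Ioi_mem_atTop b, fun x hx => hb x (le_of_lt hx), convex_Ioi b, nonempty_Ioi, ?_⟩
    rw [closure_Ioi]
    exact polySet_cy_ge hu b)
  obtain ⟨B, hB, hB'⟩ := coverable_slab hu hZp hZ polyGerm_atBot (fun s hs => by
    obtain ⟨b, hb⟩ := mem_atBot_sets.1 hs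
    refine ⟨Iio b, Iio_mem_atBot b, fun x hx => hb x (le_of_lt hx), convex_Iio b, nonempty_Iio, ?_⟩
    rw [closure_Iio]
    exact polySet_cy_le hu b)
  obtain ⟨α, hα⟩ := mem_atTop_sets.1 hA
  obtain ⟨β, hβ⟩ := mem_atBot_sets.1 hB
  have hmid : Coverable Z {w | cy u w ∈ Icc β α} := by
    refine (isCompact_Icc (a := β) (b := α)).induction_on
      (p := fun J => Coverable Z {w | cy u w ∈ J}) ?_ ?_ ?_ ?_
    · simpa using Coverable.empty
    · exact fun s t hst ht => ht.mono fun w hw => hst hw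
    · exact fun s t hs ht => hs.union ht
    · intro x _
      obtain ⟨N, hN, h⟩ := hloc x
      exact ⟨N, mem_nhdsWithin_of_mem_nhds hN, h⟩
  refine ((hA'.union hB').union hmid).mono fun w _ => ?_
  rcases le_total α (cy u w) with h | h
  · exact .inl (.inl (hα _ h))
  · rcases le_total (cy u w) β with h' | h'
    · exact .inl (.inr (hβ _ h'))
    · exact .inr ⟨h', h⟩

end

/-! ### Coverings at infinity -/

/-- The filter of germs at infinity of cones around the direction `u`. -/
def farCone (u : Plane) : Filter Plane :=
  comap (fun w => (cx u w, cy u w / cx u w)) (atTop ×ˢ 𝓝 (0 : ℝ))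

lemma tendsto_cx_farCone (u : Plane) : Tendsto (cx u) (farCone u) atTop :=
  tendsto_fst.comp tendsto_comap

lemma clm_frame {u : Plane} (hu : ‖u‖ = 1) (φ : Plane →L[ℝ] ℝ) (w : Plane) :
    φ w = cx u w * φ u + cy u w * φ (rotJ u) := by
  conv_lhs => rw [frame_decomp hu w]
  simp only [map_add, map_smul, smul_eq_mul]

lemma tendsto_div_farCone {u : Plane} (hu : ‖u‖ = 1) (φ : Plane →L[ℝ] ℝ) :
    Tendsto (fun w => φ w / cx u w) (farCone u) (𝓝 (φ u)) := by
  have h0 : Tendsto (fun w => cy u w / cx u w) (farCone u) (𝓝 0) := tendsto_snd.comp tendsto_comap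
  have h : Tendsto (fun w => φ u + cy u w / cx u w * φ (rotJ u)) (farCone u)
      (𝓝 (φ u + 0 * φ (rotJ u))) :=
    tendsto_const_nhds.add (h0.mul tendsto_const_nhds)
  rw [zero_mul, add_zero] at h
  refine h.congr' ?_
  filter_upwards [(tendsto_cx_farCone u).eventually (eventually_gt_atTop 0)] with w hw
  rw [clm_frame hu φ w]
  field_simp

lemma exists_of_farCone {u : Plane} {s : Set Plane} (hs : s ∈ farCone u) :
    ∃ κ > 0, ∃ R > 0, ∀ w, R ≤ cx u w → |cy u w| ≤ κ * cx u w → w ∈ s := by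
  obtain ⟨t, ht, hts⟩ := hs
  obtain ⟨A, hA, B, hB, hAB⟩ := mem_prod_iff.1 ht
  obtain ⟨r, hr⟩ := mem_atTop_sets.1 hA
  obtain ⟨b, hb, hB⟩ := Metric.mem_nhds_iff.1 hB
  refine ⟨b / 2, by positivity, max r 1, by positivity, fun w h1 h2 =>
    hts (hAB ⟨hr _ ((le_max_left _ _).trans h1), hB ?_⟩)⟩
  have h0 : 0 < cx u w := one_pos.trans_le ((le_max_right _ _).trans h1)
  rw [mem_ball_zero_iff, Real.norm_eq_abs, abs_div, abs_of_pos h0, div_lt_iff₀ h0]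
  nlinarith

lemma superlinear {g : ℝ[X]} (hg : 1 < g.natDegree) (M : ℝ) :
    (∀ᶠ x in atTop, M * x ≤ g.eval x) ∨ ∀ᶠ x in atTop, g.eval x < -(M * x) := by
  have hdeg : (X : ℝ[X]).degree < g.degree := by
    rw [degree_X]
    rw [degree_eq_natDegree (ne_zero_of_natDegree_gt hg)]
    exact_mod_cast hg
  rcases le_total 0 g.leadingCoeff with h | h
  · left
    have := div_tendsto_atTop_of_degree_gt g X hdeg X_ne_zero (by simpa using h)
    filter_upwards [this.eventually (eventually_ge_atTop M), eventually_gt_atTop 0] with x h1 h2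
    rwa [eval_X, le_div_iff₀ h2] at h1
  · right
    have := div_tendsto_atBot_of_degree_gt g X hdeg X_ne_zero (by simpa using h)
    filter_upwards [this.eventually (eventually_lt_atBot (-M)), eventually_gt_atTop 0] with x h1 h2
    rw [eval_X, div_lt_iff₀ h2] at h1
    linarith

/-- In a cone around `u` at infinity, a polynomial half plane is described by a polynomial
inequality in the frame of `u`. -/
lemma PolyHalfPlane.eventually_frame (H : PolyHalfPlane) {u : Plane} (hu : ‖u‖ = 1) :
    ∃ (a : ℝ) (P : ℝ[X]), ∀ᶠ w in farCone u, 0 ≤ H.lev w ↔ a * cx u w ≤ P.eval (cy u w) := by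
  by_cases hdeg : H.poly.natDegree ≤ 1
  · obtain ⟨c, d, hcd⟩ := exists_eq_X_add_C_of_natDegree_le_one hdeg
    refine ⟨H.fy u - c * H.fx u, C (c * H.fx (rotJ u) - H.fy (rotJ u)) * X + C d,
      Eventually.of_forall fun w => ?_⟩
    rw [lev, hcd, clm_frame hu H.fx w, clm_frame hu H.fy w]
    simp only [eval_add, eval_mul, eval_C, eval_X]
    constructor <;> intro h <;> linarith
  -- The first coordinate of `H` then depends on `cy u` alone, so the inequality already has the
  -- desired form in any degree.
  by_cases hx : H.fx u = 0
  · refine ⟨H.fy u, H.poly.comp (C (H.fx (rotJ u)) * X) - C (H.fy (rotJ u)) * X,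
      Eventually.of_forall fun w => ?_⟩
    rw [lev, clm_frame hu H.fx w, clm_frame hu H.fy w, hx]
    simp only [mul_zero, zero_add, eval_sub, eval_comp, eval_mul, eval_C, eval_X]
    rw [mul_comm (cy u w) (H.fx (rotJ u))]
    constructor <;> intro h <;> linarith
  -- Now the first coordinate grows like `cx u`, and a polynomial of degree at least two outgrows
  -- the linear `fy`. So the half plane contains the far cone or misses it, which is encoded by `0 ≤
  -- 0` or `0 ≤ -1`. The sign `σ` makes the coordinate tend to `+∞`.
  obtain ⟨σ, hσ⟩ : ∃ σ : ℤˣ, 0 < ((σ : ℤ) : ℝ) * H.fx u := by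
    rcases lt_or_gt_of_ne hx with h | h
    · exact ⟨-1, by simpa using h⟩
    · exact ⟨1, by simpa using h⟩
  set s : ℝ := ((σ : ℤ) : ℝ)
  have hs : s * s = 1 := unit_sq_real σ
  set g : ℝ[X] := H.poly.comp (C s * X)
  have hge : ∀ w, g.eval (s * H.fx w) = H.poly.eval (H.fx w) := fun w => by
    simp only [g, eval_comp, eval_mul, eval_C, eval_X, ← mul_assoc, hs, one_mul]
  have hg : 1 < g.natDegree := by
    rw [natDegree_comp, natDegree_C_mul_X _ (left_ne_zero_of_mul_eq_one hs), mul_one]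
    exact not_le.1 hdeg
  set M := (|H.fy u| + 1) / (s * H.fx u / 2)
  have t1 := tendsto_div_farCone hu (s • H.fx)
  have t2 := tendsto_div_farCone hu H.fy
  have hpos := (tendsto_cx_farCone u).eventually (eventually_gt_atTop 0)
  have e1 : ∀ᶠ w in farCone u, s * H.fx u / 2 * cx u w < s * H.fx w := by
    have : s * H.fx u / 2 < (s • H.fx) u := by
      simp only [smul_apply, smul_eq_mul]; linarith
    filter_upwards [t1.eventually (lt_mem_nhds this), hpos] with w h1 h2
    rwa [lt_div_iff₀ h2] at h1
  have e2 : ∀ᶠ w in farCone u, |H.fy w| < (|H.fy u| + 1) * cx u w := by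
    filter_upwards [t2.abs.eventually (gt_mem_nhds (lt_add_one _)), hpos] with w h1 h2
    rwa [abs_div, abs_of_pos h2, div_lt_iff₀ h2] at h1
  have e3 : ∀ᶠ w in farCone u, |H.fy w| < M * (s * H.fx w) := by
    filter_upwards [e1, e2] with w h1 h2
    refine h2.trans ?_
    rw [div_mul_eq_mul_div, lt_div_iff₀ (by positivity), mul_assoc]
    exact mul_lt_mul_of_pos_left (by linarith) (by positivity)
  have t3 : Tendsto (fun w => s * H.fx w) (farCone u) atTop := by
    refine tendsto_atTop_mono' _ (e1.mono fun w hw => hw.le) ?_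
    exact (tendsto_cx_farCone u).const_mul_atTop (by positivity)
  rcases superlinear hg M with h | h
  · refine ⟨0, 0, ?_⟩
    filter_upwards [e3, t3.eventually h] with w h1 h2
    rw [hge] at h2
    simp only [zero_mul, eval_zero, le_refl, iff_true, lev]
    linarith [le_abs_self (H.fy w)]
  · refine ⟨0, -1, ?_⟩
    filter_upwards [e3, t3.eventually h] with w h1 h2
    rw [hge] at h2
    simp only [zero_mul, eval_neg, eval_one, lev]
    constructor <;> intro h
    · linarith [neg_abs_le (H.fy w)]
    · linarith

/-- The closed cone at infinity around the direction `u`. -/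
def farCell (u : Plane) (κ R : ℝ) : Set Plane := {w | R ≤ cx u w ∧ |cy u w| ≤ κ * cx u w}

lemma polySet_farCell {u : Plane} (hu : ‖u‖ = 1) {κ : ℝ} (hκ : 0 < κ) (R : ℝ) :
    PolySet (farCell u κ R) := by
  have h1 : -cx u ≠ 0 := fun h => by
    have := congrArg (fun φ : Plane →L[ℝ] ℝ => φ u) h
    simp [cx_self hu] at this
  have h2 : cy u - κ • cx u ≠ 0 := fun h => by
    have := congrArg (fun φ : Plane →L[ℝ] ℝ => φ u) h
    simp [cx_self hu, cy_self, hκ.ne'] at this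
  have h3 : -cy u - κ • cx u ≠ 0 := fun h => by
    have := congrArg (fun φ : Plane →L[ℝ] ℝ => φ u) h
    simp [cx_self hu, cy_self, hκ.ne'] at this
  convert ((polySet_linear h1 (-R)).inter (polySet_linear h2 0)).inter (polySet_linear h3 0) using 1
  ext q
  simp only [farCell, mem_ofPred_eq, mem_inter_iff, abs_le, sub_apply, neg_apply,
    smul_apply, smul_eq_mul]
  constructor
  · rintro ⟨h1, h2, h3⟩
    exact ⟨⟨by linarith, by linarith⟩, by linarith⟩
  · rintro ⟨⟨h1, h2⟩, h3⟩
    exact ⟨by linarith, by linarith, by linarith⟩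

/-- Far out around `u` all half planes are inequalities in the single frame of `u`, and so are the
three that bound the cell; `coverable_same_frame` applies to the joint system. -/
lemma coverable_farCell {n : ℕ} (G : Fin n → PolyHalfPlane) {u : Plane} (hu : ‖u‖ = 1) :
    ∃ κ > 0, ∃ R > 0, Coverable (interHalfPlanes G) (farCell u κ R) := by
  choose a P h using fun l => (G l).eventually_frame hu
  obtain ⟨κ, hκ, R, hR, h⟩ := exists_of_farCone (eventually_all.2 h)
  refine ⟨κ, hκ, R, hR, ?_⟩
  have := coverable_same_frame (Z := interHalfPlanes G ∩ farCell u κ R)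
    (a := Sum.elim a ![-1, -κ, -κ]) (P := Sum.elim P ![C (-R), X, -X]) hu
    ((polySet_interHalfPlanes G).inter (polySet_farCell hu hκ R)) (by
      intro w
      simp only [Sum.forall, Fin.forall_fin_succ, mem_inter_iff, mem_interHalfPlanes, farCell,
        mem_ofPred_eq, abs_le]
      simp
      exact fun h2 h3 h4 => forall_congr' (h w h2 (abs_le.2 ⟨h3, h4⟩)))
  obtain ⟨𝒯, h1, h2, h3⟩ := this
  refine ⟨𝒯, h1, fun T hT => ⟨(h2 T hT).1, (h2 T hT).2.trans inter_subset_left⟩, ?_⟩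
  rwa [inter_univ] at h3

/-- An intersection of finitely many polynomial half planes is a finite union of regions of
type I. -/
lemma coverable_univ {n : ℕ} (G : Fin n → PolyHalfPlane) : Coverable (interHalfPlanes G) univ := by
  obtain ⟨S, hS, h⟩ := coverable_annulus (X := interHalfPlanes G) (p := 0) (𝓡 := atTop) (by
    intro u hu
    obtain ⟨κ, hκ, R, hR, h⟩ := coverable_farCell G hu
    -- In the sector only `cx u q > ‖q‖ / 2` is available, hence the radius `2 * R`.
    refine ⟨Ioi (2 * R), Ioi_mem_atTop _, _, sector_mem_nhds hu hκ, h.mono ?_⟩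
    rintro q ⟨hq1, hq2⟩
    rw [mem_Ioi] at hq1
    obtain ⟨h1, h2⟩ := sector_bounds (by linarith) hq2
    rw [sub_zero] at h1 h2 hq1
    exact ⟨by linarith, h2.le⟩)
  obtain ⟨R, hR⟩ := mem_atTop_sets.1 hS
  refine (h.union (coverable_compact G (isCompact_closedBall (0 : Plane) (max R 1)))).mono ?_
  intro q _
  by_cases hq : ‖q‖ ≤ max R 1
  · exact .inr (mem_closedBall_zero_iff.2 hq)
  · rw [not_le, max_lt_iff] at hq
    refine .inl ⟨by rw [sub_zero]; exact hR _ hq.1.le, ?_⟩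
    rintro rfl
    rw [norm_zero] at hq
    linarith [hq.2]

end

theorem corollary3p8 {k : ℕ} (F : Fin k → PolyHalfPlane) :
    (∃ (m : ℕ) (n : Fin m → ℕ) (G : ∀ j, Fin (n j) → PolyHalfPlane),
      IsTypeIDecomposition (interHalfPlanes F) G) ∧
    ∀ (m : ℕ) (n : Fin m → ℕ) (G : ∀ j, Fin (n j) → PolyHalfPlane),
      IsTypeIDecomposition (interHalfPlanes F) G →
      ∀ (γ : ℝ → Plane) (a b : ℝ), IsShortestCurve (interHalfPlanes F) γ a b →
      ∀ j : Fin m, ∃ (r : ℕ) (c d : Fin r → ℝ),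
        {t | t ∈ Set.Icc a b ∧ γ t ∈ interHalfPlanes (G j)} = ⋃ i, Set.Icc (c i) (d i) ∧
        (Pairwise fun i i' =>
          Disjoint (γ '' Set.Icc (c i) (d i)) (γ '' Set.Icc (c i') (d i'))) ∧
        ∀ i, IsShortestCurve (interHalfPlanes (G j)) γ (c i) (d i) ∧
          (IsPointCurve γ (c i) (d i) ∨ IsAlternating (G j) γ (c i) (d i)) := by
  refine ⟨(coverable_univ F).exists_decomposition, fun m n G hG γ a b hγ j => ?_⟩
  have hGF : interHalfPlanes (G j) ⊆ interHalfPlanes F := by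
    rw [hG.2]
    exact Set.subset_iUnion (fun j => interHalfPlanes (G j)) j
  obtain ⟨r, c, d, h1, h2, h3⟩ := hγ.exists_intervals hGF
  exact ⟨r, c, d, h1, h2, fun i => ⟨h3 i, (h3 i).point_or_alternating⟩⟩
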